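/- Notation. $\langle x\rangle=(1+x^2)^{1/2}$, $\mathbb R_\pm=\{x:\pm x>0\}$, $\|\cdot\|$ is the norm of $L^2(\mathbb R)$, square roots are principal, and $H_U f=-f''+Uf$ denotes the maximal operator in $L^2(\mathbb R)$, with domain $\{f\in L^2(\mathbb R): -f''+Uf\in L^2(\mathbb R)\}$. For $\phi:\mathbb R\to\mathbb C$ and $J\subset\mathbb R$ put $\omega_p(\varepsilon;\phi,J)=\sup_{0<|t|<\varepsilon}\|\phi(\cdot+t)-\phi\|_{L^p(J)}\in[0,\infty]$. Statements with $\pm$ are meant for each of the two signs separately. Assumptions on $V$. Let $N\in\{1,2\}$, $n\in\{0,1\}$ with $n+1\le N$, $\nu_\pm<0$ and $\varepsilon_1>0$. Let $V\in W^{N,\infty}_{\rm loc}(\mathbb R)$ be complex-valued (identified with its continuous representative) such that (a) $\limsup_{x\to-\infty}\operatorname{Im}V(x)<0<\liminf_{x\to+\infty}\operatorname{Im}V(x)$; (b) for $1\le m\le N$, as $x\to\pm\infty$, $|\operatorname{Im}V^{(m)}(x)|=O(|\operatorname{Im}V(x)|\langle x\rangle^{m\nu_\pm})$ and $|V^{(m)}(x)|=O(|V(x)|\langle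 x\rangle^{m\nu_\pm})$; (c) if $V$ is unbounded at $\pm\infty$, then $\langle x\rangle^{4(\nu_\pm+\varepsilon_1)+2}\big(\langle x\rangle^{4\nu_\pm+2}+|\operatorname{Re}V(x)|\big)=O(|\operatorname{Im}V(x)|^2)$ as $x\to\pm\infty$. Cut-off. Fix $0<\varepsilon_2^\pm<1-\nu_\pm$. For $\lambda>0$, if $V$ is unbounded at $\pm\infty$ put $\delta_\pm=\inf\{\delta\ge0:|\operatorname{Im}V(\pm\delta)|^2\langle\delta\rangle^{-(4\nu_\pm+2\varepsilon_1+2)}=\lambda\}$ and $\Delta_\pm=\tfrac14\delta_\pm^{-\nu_\pm}$ ($\delta_\pm$ is finite for all large $\lambda$); if $V$ is bounded at $\pm\infty$ put $\delta_\pm=\lambda^{(1+\varepsilon_2^\pm)/2}$ and $\Delta_\pm=\tfrac14\delta_\pm$. Let $J_\pm=\{x\in\mathbb R_\pm:|x|<\delta_\pm\}$. Let $\xi=\xi_\lambda\in C_0^\infty(\mathbb R)$ satisfy $0\le\xi\le1$, $\xi=1$ on $(-\delta_-+\Delta_-,\delta_+-\Delta_+)$, $\xi=0$ outside $(-\delta_-,\delta_+)$,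 and $|\xi^{(j)}|\le C\Delta_\pm^{-j}$ on $\mathbb R_\pm$ for $j=1,2$, with $C$ independent of $\lambda$, for all large $\lambda$. Assumptions on $W=W_1+W_2$. $W_1$ is measurable; for some $0<\varepsilon<1$, $|\operatorname{Im}W_1|\le(1-\varepsilon)|\operatorname{Im}V|$ a.e.; for some constants $C_\pm$, $|\operatorname{Re}W_1(x)|\le C_\pm|\operatorname{Im}V(x)|^2\langle x\rangle^{-4(\nu_\pm+\varepsilon_1)-2}$ for a.e. $x\in\mathbb R_\pm$; if $V$ is bounded at $\pm\infty$, then moreover $\operatorname{Re}W_1(x)=o(|x|^{2/(1+\varepsilon_2^\pm)})$ as $x\to\pm\infty$ (i.e. $\operatorname{Re}W_1=o(\lambda)$ uniformly on $J_\pm$). $W_2\in L^2(\mathbb R)$ has compact support. Pseudomode. Let $w\in C_0^\infty(\mathbb R)$, $0\le w\le1$, $\operatorname{supp}w=[-1,1]$, $\int w=1$, $w_\varepsilon(x)=\varepsilon^{-1}w(x/\varepsilon)$ and $\phi^\varepsilon=w_\varepsilon*\phi$. For $\alpha_-,\alpha_+,\alpha_0\in(0,1)$ put $\varepsilon_\iota=\lambda^{-\alpha_\iota}$,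 let $\chi_\pm$ be the indicator function of $\mathbb R_\pm$, and set $$\tilde V=V+(\chi_-W_1)^{\varepsilon_-}+(\chi_+W_1)^{\varepsilon_+}+W_2^{\varepsilon_0}.$$ Let $\tilde f=\xi\tilde g$ with $\tilde g=\exp\big(-\sum_{k=-1}^{n-1}\lambda^{-k/2}\psi_k\big)$, $\psi_k(0)=0$, $\psi_{-1}'=i\lambda^{-1/2}(\lambda-\tilde V)^{1/2}$ and $\psi_0'=-\tfrac14\tilde V'/(\lambda-\tilde V)$. Theorem. For all sufficiently large $\lambda>0$, $0\ne\tilde f\in\operatorname{Dom}(H_{V+W})$ and $$\frac{\|(H_{V+W}-\lambda)\tilde f\|}{\|\tilde f\|}=\kappa(\lambda)+\sigma^{(n)}(\lambda)+\frac{\zeta^{(n)}(\lambda)}{\|\tilde f\|},$$ where $\kappa=\kappa_-+\kappa_+$, $\sigma^{(n)}=\sigma^{(n)}_-+\sigma^{(n)}_+$, $\zeta^{(n)}=\zeta_-^{(n)}+\zeta_+^{(n)}+\zeta_0^{(n)}$ are real functions of $\lambda$ satisfying, as $\lambda\to+\infty$: - if $V$ is unbounded at $\pm\infty$: $\kappa_\pm=O(\exp(-c\,\delta_\pm^{\nu_\pm+1+\varepsilon_1}))$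 for some $c>0$, and $\sigma_\pm^{(n)}=O\big(\lambda^{-\frac{n+1}2}\sup_{x\in J_\pm}|V(x)|\langle x\rangle^{(n+1)\nu_\pm}\big)$; - if $V$ is bounded at $\pm\infty$: $\kappa_\pm=O(\exp(-c\,\lambda^{\varepsilon_2^\pm/2}))$ for some $c>0$, and $\sigma_\pm^{(n)}=O(\lambda^{-\frac{n+1}2})$; - $\zeta_\pm^{(0)}=O\big(\omega_2(\varepsilon_\pm;\chi_\pm W_1,J_\pm)(1+\varepsilon_\pm^{-1}\lambda^{-1/2})\big)$ and $\zeta_0^{(0)}=O\big(\omega_2(\varepsilon_0;W_2,\mathbb R)(1+\varepsilon_0^{-1}\lambda^{-1/2})\big)$; - $\zeta_\pm^{(1)}=O\big(\omega_2(\varepsilon_\pm;\chi_\pm W_1,J_\pm)(1+\varepsilon_\pm^{-2}\lambda^{-1})+\omega_4(\varepsilon_\pm;\chi_\pm W_1,J_\pm)\varepsilon_\pm^{-2}\lambda^{-2}\big)$ and $\zeta_0^{(1)}=O\big(\omega_2(\varepsilon_0;W_2,\mathbb R)(1+\varepsilon_0^{-2}\lambda^{-1})+\omega_4(\varepsilon_0;W_2,\mathbb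 R)\varepsilon_0^{-2}\lambda^{-2}\big)$. If $\alpha_-=\alpha_+$, or if $W_1$ vanishes almost everywhere in a neighbourhood of $0$, then there is also such a decomposition in which the bounds for $\zeta_\pm^{(n)}$ hold with $W_1$ in place of $\chi_\pm W_1$. -/

import Mathlib

open MeasureTheory Filter Topology Asymptotics Set
open scoped ENNReal NNReal ContDiff

noncomputable section

namespace Pseudomode

/-- The two ends of the real line. -/
inductive Side : Type where
  | minus : Side
  | plus : Side

/-- The sign `-1` or `+1` of an end. -/
def Side.sgn : Side → ℝ
  | .minus => -1
  | .plus => 1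

/-- The filter of neighbourhoods of `-∞`, respectively `+∞`. -/
def Side.atEnd : Side → Filter ℝ
  | .minus => atBot
  | .plus => atTop

/-- The open half-lines `ℝ₋ = (-∞, 0)` and `ℝ₊ = (0, ∞)`. -/
def Side.halfLine : Side → Set ℝ
  | .minus => Iio 0
  | .plus => Ioi 0

/-- The bracket `⟨x⟩ = (1 + x²)^{1/2}`. -/
def bracket (x : ℝ) : ℝ := Real.sqrt (1 + x ^ 2)

/-- The norm of `L²(ℝ)`. It is only used for square-integrable functions. -/
def norm2 (f : ℝ → ℂ) : ℝ := (eLpNorm f 2 volume).toReal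

/-- `v` is the `m`-th weak derivative of `u` on `ℝ`. -/
def IsWeakDeriv (m : ℕ) (u v : ℝ → ℂ) : Prop :=
  LocallyIntegrable u volume ∧ LocallyIntegrable v volume ∧
    ∀ φ : ℝ → ℝ, ContDiff ℝ ∞ φ → HasCompactSupport φ →
      ∫ x, iteratedDeriv m φ x • u x = (-1 : ℂ) ^ m * ∫ x, φ x • v x

/-- `h = -f'' + U f` in the sense of distributions, with `f` and `h` in `L²(ℝ)`. -/
def IsSchrodingerImage (U f h : ℝ → ℂ) : Prop :=
  MemLp f 2 volume ∧ MemLp h 2 volume ∧ IsWeakDeriv 2 f (fun x => U x * f x - h x)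

/-- The domain of the maximal operator `H_U = -d²/dx² + U` in `L²(ℝ)`. -/
def schrodingerDomain (U : ℝ → ℂ) : Set (ℝ → ℂ) :=
  {f | ∃ h, IsSchrodingerImage U f h}

open Classical in
/-- The maximal operator `H_U f = -f'' + U f`; the value is unique almost everywhere, and the
value outside the domain is irrelevant. -/
def schrodinger (U f : ℝ → ℂ) : ℝ → ℂ :=
  if hf : ∃ h, IsSchrodingerImage U f h then hf.choose else 0

/-- `V` is bounded at the end `s`. -/
def BoundedAt (V : ℝ → ℂ) (s : Side) : Prop := ∃ C : ℝ, ∀ᶠ x in s.atEnd, ‖V x‖ ≤ C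

/-- The assumptions on the regular potential `V ∈ W^{N,∞}_loc(ℝ)`, which is identified with its
continuous representative. -/
structure RegularPotential (N : ℕ) (ν : Side → ℝ) (ε₁ : ℝ) (V : ℝ → ℂ) : Prop where
  continuous : Continuous V
  limsup_neg : limsup (fun x => (((V x).im : ℝ) : EReal)) atBot < 0
  liminf_pos : 0 < liminf (fun x => (((V x).im : ℝ) : EReal)) atTop
  /-- The weak derivatives up to order `N` exist, are locally essentially bounded and are
  controlled by `V` at both ends. -/
  derivs : ∀ m : ℕ, 1 ≤ m → m ≤ N → ∃ v : ℝ → ℂ, IsWeakDeriv m V v ∧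
    (∀ K : Set ℝ, IsCompact K → MemLp v ∞ (volume.restrict K)) ∧
    ∀ s : Side,
      (fun x => (v x).im) =O[s.atEnd ⊓ ae volume]
        (fun x => (V x).im * bracket x ^ ((m : ℝ) * ν s)) ∧
      v =O[s.atEnd ⊓ ae volume] (fun x => ‖V x‖ * bracket x ^ ((m : ℝ) * ν s))
  eps_pos : 0 < ε₁
  unbounded_end : ∀ s : Side, ¬ BoundedAt V s →
    (fun x => bracket x ^ (4 * (ν s + ε₁) + 2) *
        (bracket x ^ (4 * ν s + 2) + |(V x).re|)) =O[s.atEnd] (fun x => (V x).im ^ 2)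
  bounded_end : ∀ s : Side, BoundedAt V s → ν s < 1

/-- The assumptions on the two parts of the rough potential `W = W₁ + W₂`. -/
structure RoughPotential (ν : Side → ℝ) (ε₁ : ℝ) (ε₂ : Side → ℝ) (V W₁ W₂ : ℝ → ℂ) : Prop where
  measurable₁ : AEStronglyMeasurable W₁ volume
  im_le : ∃ ε : ℝ, 0 < ε ∧ ε < 1 ∧ ∀ᵐ x ∂volume, |(W₁ x).im| ≤ (1 - ε) * |(V x).im|
  re_le : ∀ s : Side, ∃ C : ℝ, ∀ᵐ x ∂volume, x ∈ s.halfLine →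
    |(W₁ x).re| ≤ C * ((V x).im ^ 2 * bracket x ^ (-4 * (ν s + ε₁) - 2))
  /-- At an end at which `V` is bounded, `Re W₁` is negligible with respect to `λ` on the
  support of the cut-off, whose radius there is `λ^{(1+ε₂)/2}`. -/
  re_bounded_end : ∀ s : Side, BoundedAt V s →
    (fun x => (W₁ x).re) =o[s.atEnd ⊓ ae volume] (fun x => |x| ^ (2 / (1 + ε₂ s)))
  memLp₂ : MemLp W₂ 2 volume
  support₂ : ∃ R : ℝ, ∀ᵐ x ∂volume, R < |x| → W₂ x = 0

open Classical in
/-- The radius `δ_±` of the cut-off. At an unbounded end, the set is non-empty for all large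
`λ` under the assumptions on `V`. -/
def cutRadius (ν : Side → ℝ) (ε₁ : ℝ) (ε₂ : Side → ℝ) (V : ℝ → ℂ) (s : Side) (lam : ℝ) : ℝ :=
  if BoundedAt V s then lam ^ ((1 + ε₂ s) / 2)
  else sInf {d : ℝ | 0 ≤ d ∧
    |(V (s.sgn * d)).im| ^ 2 / bracket d ^ (4 * ν s + 2 * ε₁ + 2) = lam}

open Classical in
/-- The width `Δ_±` of the transition region of the cut-off. -/
def cutWidth (ν : Side → ℝ) (ε₁ : ℝ) (ε₂ : Side → ℝ) (V : ℝ → ℂ) (s : Side) (lam : ℝ) : ℝ :=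
  if BoundedAt V s then cutRadius ν ε₁ ε₂ V s lam / 4
  else cutRadius ν ε₁ ε₂ V s lam ^ (-ν s) / 4

/-- The half-intervals `J_± = {x ∈ ℝ_± : |x| < δ_±}`. -/
def cutInterval (ν : Side → ℝ) (ε₁ : ℝ) (ε₂ : Side → ℝ) (V : ℝ → ℂ) (s : Side) (lam : ℝ) :
    Set ℝ :=
  {x | x ∈ s.halfLine ∧ |x| < cutRadius ν ε₁ ε₂ V s lam}

/-- `ξ` is a smooth cut-off with plateau `(-δ₋ + Δ₋, δ₊ - Δ₊)`, which vanishes outside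
`(-δ₋, δ₊)` and whose `j`-th derivatives, `j = 1, 2`, are bounded by `C Δ_±^{-j}` on `ℝ_±`. -/
structure IsCutoff (δ Δ : Side → ℝ) (C : ℝ) (ξ : ℝ → ℝ) : Prop where
  contDiff : ContDiff ℝ ∞ ξ
  compact : HasCompactSupport ξ
  nonneg : ∀ x, 0 ≤ ξ x
  le_one : ∀ x, ξ x ≤ 1
  eq_one : ∀ x ∈ Ioo (-δ .minus + Δ .minus) (δ .plus - Δ .plus), ξ x = 1
  eq_zero : ∀ x, x ∉ Ioo (-δ .minus) (δ .plus) → ξ x = 0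
  deriv_le : ∀ s : Side, ∀ j : ℕ, 1 ≤ j → j ≤ 2 → ∀ x ∈ s.halfLine,
    |iteratedDeriv j ξ x| ≤ C * (Δ s ^ j)⁻¹

/-- The mollifying kernel `w`. -/
structure IsMollifier (w : ℝ → ℝ) : Prop where
  contDiff : ContDiff ℝ ∞ w
  nonneg : ∀ x, 0 ≤ w x
  le_one : ∀ x, w x ≤ 1
  support : tsupport w = Icc (-1) 1
  integral : ∫ x, w x = 1

/-- The mollification `φ^ε = w_ε * φ` with `w_ε(x) = ε⁻¹ w(x/ε)`. -/
def mollify (w : ℝ → ℝ) (ε : ℝ) (φ : ℝ → ℂ) : ℝ → ℂ :=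
  convolution (fun x => ε⁻¹ * w (x / ε)) φ (ContinuousLinearMap.lsmul ℝ ℝ) volume

/-- The `L^p` modulus of continuity of `φ` on `J`, possibly infinite. -/
def modulus (p : ℝ≥0∞) (ε : ℝ) (φ : ℝ → ℂ) (J : Set ℝ) : ℝ≥0∞ :=
  ⨆ t : ℝ, ⨆ _ : 0 < |t| ∧ |t| < ε,
    eLpNorm (fun x => φ (x + t) - φ x) p (volume.restrict J)

/-- The mollified rough potential
`(χ₋W₁)^{ε₋} + (χ₊W₁)^{ε₊} + W₂^{ε₀}` with `ε_ι = λ^{-α_ι}`. -/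
def mollifiedW (w : ℝ → ℝ) (α : Side → ℝ) (α₀ : ℝ) (W₁ W₂ : ℝ → ℂ) (lam : ℝ) (x : ℝ) : ℂ :=
  mollify w (lam ^ (-α .minus)) (Side.minus.halfLine.indicator W₁) x +
  mollify w (lam ^ (-α .plus)) (Side.plus.halfLine.indicator W₁) x +
  mollify w (lam ^ (-α₀)) W₂ x

/-- The derivatives of the functions in the expansion, shifted by one: the entry `j` is
`ψ_{j-1}'`, so that the first two entries are
`ψ_{-1}' = i λ^{-1/2} (λ - U)^{1/2}` (principal branch) and `ψ_0' = -U' / (4 (λ - U))`.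
Only these two are used. -/
def psiDeriv (U : ℝ → ℂ) (lam : ℝ) : ℕ → ℝ → ℂ
  | 0, x => Complex.I * ((lam ^ (-(1 / 2) : ℝ) : ℝ) : ℂ) * ((lam : ℂ) - U x) ^ (1 / 2 : ℂ)
  | 1, x => -(1 / 4) * (deriv U x / ((lam : ℂ) - U x))
  | _, _ => 0

/-- `g = exp (-∑_{k=-1}^{n-1} λ^{-k/2} ψ_k)` with `ψ_k(x) = ∫_0^x ψ_k'` and `k = j - 1`. -/
def jwkb (U : ℝ → ℂ) (n : ℕ) (lam : ℝ) (x : ℝ) : ℂ :=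
  Complex.exp (-∑ j ∈ Finset.range (n + 1),
    ((lam ^ (-((j : ℝ) - 1) / 2) : ℝ) : ℂ) * ∫ t in (0 : ℝ)..x, psiDeriv U lam j t)

/-- The pseudomode `f̃ = ξ g̃`, built for the potential `V` plus the mollification of `W`. -/
def pseudomode (w : ℝ → ℝ) (α : Side → ℝ) (α₀ : ℝ) (V W₁ W₂ : ℝ → ℂ) (ξ : ℝ → ℝ → ℝ) (n : ℕ)
    (lam : ℝ) (x : ℝ) : ℂ :=
  (ξ lam x : ℂ) * jwkb (fun y => V y + mollifiedW w α α₀ W₁ W₂ lam y) n lam x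

open Classical in
/-- The size of the cut-off error `κ_±`. -/
def kappaRate (ν : Side → ℝ) (ε₁ : ℝ) (ε₂ : Side → ℝ) (V : ℝ → ℂ) (c : ℝ) (s : Side)
    (lam : ℝ) : ℝ :=
  if BoundedAt V s then Real.exp (-c * lam ^ (ε₂ s / 2))
  else Real.exp (-c * cutRadius ν ε₁ ε₂ V s lam ^ (ν s + 1 + ε₁))

open Classical in
/-- The size of the remainder `σ_±^{(n)}` for the regular potential, in the case `ν_± < 0`. -/
def sigmaRate (ν : Side → ℝ) (ε₁ : ℝ) (ε₂ : Side → ℝ) (V : ℝ → ℂ) (n : ℕ) (s : Side)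
    (lam : ℝ) : ℝ :=
  if BoundedAt V s then lam ^ (-((n : ℝ) + 1) / 2)
  else lam ^ (-((n : ℝ) + 1) / 2) *
    sSup ((fun x => ‖V x‖ * bracket x ^ (((n : ℝ) + 1) * ν s)) '' cutInterval ν ε₁ ε₂ V s lam)

/-- The size of the mollification error `ζ^{(n)}`, `n ∈ {0, 1}`, of one piece `φ`. -/
def zetaRate (n : ℕ) (ε : ℝ) (φ : ℝ → ℂ) (J : Set ℝ) (lam : ℝ) : ℝ≥0∞ :=
  match n with
  | 0 => modulus 2 ε φ J * (1 + ENNReal.ofReal (ε⁻¹ * lam ^ (-(1 / 2) : ℝ)))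
  | _ => modulus 2 ε φ J * (1 + ENNReal.ofReal ((ε ^ 2)⁻¹ * lam⁻¹)) +
      modulus 4 ε φ J * ENNReal.ofReal ((ε ^ 2)⁻¹ * (lam ^ 2)⁻¹)

/-- `a(λ) = O(b(λ))` as `λ → +∞`, for a bound `b` that may be infinite. -/
def BigOTop (a : ℝ → ℝ) (b : ℝ → ℝ≥0∞) : Prop :=
  ∃ C : ℝ≥0, ∀ᶠ lam in atTop, ENNReal.ofReal |a lam| ≤ C * b lam

/-- `q(λ) = κ(λ) + σ^{(n)}(λ) + ζ^{(n)}(λ) / ‖f_λ‖` for all large `λ`, with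
`κ = κ₋ + κ₊`, `σ = σ₋ + σ₊`, `ζ = ζ₋ + ζ₊ + ζ₀` of the prescribed sizes, where the size of
`ζ_±` is expressed by the moduli of continuity of `Φ_±` on `J_±`. -/
def Decomposition (ν : Side → ℝ) (ε₁ : ℝ) (ε₂ : Side → ℝ) (V : ℝ → ℂ) (α : Side → ℝ) (α₀ : ℝ)
    (n : ℕ) (Φ : Side → ℝ → ℂ) (W₂ : ℝ → ℂ) (f : ℝ → ℝ → ℂ) (q : ℝ → ℝ) : Prop :=
  ∃ (κ σ ζ : Side → ℝ → ℝ) (ζ₀ : ℝ → ℝ),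
    (∀ᶠ lam in atTop, q lam =
      (κ .minus lam + κ .plus lam) + (σ .minus lam + σ .plus lam) +
        (ζ .minus lam + ζ .plus lam + ζ₀ lam) / norm2 (f lam)) ∧
    (∀ s, ∃ c : ℝ, 0 < c ∧ κ s =O[atTop] kappaRate ν ε₁ ε₂ V c s) ∧
    (∀ s, σ s =O[atTop] sigmaRate ν ε₁ ε₂ V n s) ∧
    (∀ s, BigOTop (ζ s) fun lam =>
      zetaRate n (lam ^ (-α s)) (Φ s) (cutInterval ν ε₁ ε₂ V s lam) lam) ∧
    BigOTop ζ₀ fun lam => zetaRate n (lam ^ (-α₀)) W₂ univ lam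

end Pseudomode

end

noncomputable section

namespace Pseudomode

/-! Write the approximate solution as `g = exp ∫₀ˣ m`. Then (H − λ)(ξg) = −(ξ'' + 2ξ'm) g + (V + W −
λ − m' − m²) ξg, and there are three sources of error: the cut-off, the WKB expansion, and the
replacement of W by its mollification.

WKB expansion. Let U be V plus the mollified W and let S = (λ − U)^{1/2}. With m = −iS the square m²
cancels U − λ. Adding U'/(4(λ − U)) cancels the next term as well (`norm_remainder_le`). What is
left is of order λ^{-1/2}|U'| for n = 0 and λ^{-1}|U''| + λ^{-2}|U'|² for n = 1, provided that Re(λ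
− U) ≥ λ/2 on the support of ξ. The radius δ is made for this: up to δ the function F = |Im
V|²⟨d⟩^{-(4ν+2ε₁+2)} is at most λ. Assumption (c) reads |Im V| ≲ F and |Re V| ≲ F⟨d⟩^{-2ε₁}
(`exists_le_levelFun`). Hence Im V = O(λ), while Re V and Re W₁ are o(λ) (`exists_spectral_bounds`).
The share of V in the remainder is σ; the share of the mollified W goes into ζ.

Cut-off. To leading order Re m = Im S = −Im U / (2 Re S), and Re S is of order λ^{1/2}. The signs of
Im V at the two ends and |Im W₁| ≤ (1 − ε)|Im V| make |g| decrease towards both ends outside a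
compact set. On the compact set the growth is bounded, because the mollification of W₂ is
O(λ^{α₀/2}) with α₀ < 1. Integration over a strip of width Δ just before the transition region gives
the factor exp(−c · `decayExponent`) (`exists_decay`, `exists_amplitude_bounds`). The same exponent
dominates log λ, by a Gronwall estimate for log |Im V| (`lam_le_exp`), so the powers of λ in ξ'' +
2ξ'm are absorbed and κ results.

Mollification. The error φ − φ^ε and the derivatives of φ^ε are averages of φ(x − t) − φ(x) over |t|
< ε, since the derivatives of the kernel have mean zero. Cauchy–Schwarz and Tonelli bound them by
ε^{-j} times the L² modulus (`eLpNorm_integral_smul_sub_le`). The quadratic term for n = 1 is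
handled by the pointwise bound |(φ^ε)'| ≲ λ/ε, so that the L² modulus alone suffices and the L⁴
terms are not needed (`exists_pieceError_mollify_le`). What a mollified half of W₁ spreads over the
origin is controlled by the modulus on its own side (`modulus_leak_le`).

Since |g| is bounded below on [0, 1], so is the norm of the pseudomode. The residual is then bounded
by seven nonnegative terms, and a number below such a sum splits into numbers below the individual
terms (`decomposition_of_le`). -/

/-! ### Calculus of locally Lipschitz functions. -/

/-- `f` is Lipschitz in a neighbourhood of `x`. -/
def LipAt {E : Type*} [NormedAddCommGroup E] (f : ℝ → E) (x : ℝ) : Prop :=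
  ∃ K : ℝ≥0, ∃ t ∈ 𝓝 x, LipschitzOnWith K f t

section LipAt

variable {E : Type*} [NormedAddCommGroup E]

theorem LipAt.congr {f g : ℝ → E} {x : ℝ} (hf : LipAt f x) (h : f =ᶠ[𝓝 x] g) : LipAt g x := by
  obtain ⟨K, t, ht, hK⟩ := hf
  refine ⟨K, t ∩ {y | f y = g y}, inter_mem ht h, fun y hy z hz => ?_⟩
  rw [← hy.2, ← hz.2]
  exact hK hy.1 hz.1

/-- Sums, products, quotients and complex roots all reduce to this by pairing functions into a
product space. -/
theorem LipAt.comp_contDiffAt [NormedSpace ℝ E] {E' : Type*} [NormedAddCommGroup E']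
    [NormedSpace ℝ E'] {f : ℝ → E} {F : E → E'} {x : ℝ} (hF : ContDiffAt ℝ 1 F (f x))
    (hf : LipAt f x) : LipAt (fun y => F (f y)) x := by
  obtain ⟨K, t, ht, hK⟩ := hf
  obtain ⟨K', t', ht', hK'⟩ := hF.exists_lipschitzOnWith
  have hc : ContinuousAt f x := hK.continuousOn.continuousAt ht
  refine ⟨K' * K, t ∩ f ⁻¹' t', inter_mem ht (hc ht'), ?_⟩
  exact LipschitzOnWith.comp hK' (hK.mono inter_subset_left) (fun y hy => hy.2)

theorem LipAt.prodMk {E' : Type*} [NormedAddCommGroup E'] {f : ℝ → E} {g : ℝ → E'} {x : ℝ}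
    (hf : LipAt f x) (hg : LipAt g x) : LipAt (fun y => (f y, g y)) x := by
  obtain ⟨K, t, ht, hK⟩ := hf
  obtain ⟨K', t', ht', hK'⟩ := hg
  exact ⟨max K K', t ∩ t', inter_mem ht ht',
    (hK.mono inter_subset_left).prodMk (hK'.mono inter_subset_right)⟩

theorem LipAt.add {f g : ℝ → ℂ} {x : ℝ} (hf : LipAt f x) (hg : LipAt g x) :
    LipAt (fun y => f y + g y) x := by
  have h : ContDiff ℝ 1 fun p : ℂ × ℂ => p.1 + p.2 := contDiff_fst.add contDiff_snd
  exact LipAt.comp_contDiffAt (f := fun y => (f y, g y)) h.contDiffAt (hf.prodMk hg)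

theorem LipAt.mul {f g : ℝ → ℂ} {x : ℝ} (hf : LipAt f x) (hg : LipAt g x) :
    LipAt (fun y => f y * g y) x := by
  have h : ContDiff ℝ 1 fun p : ℂ × ℂ => p.1 * p.2 := contDiff_fst.mul contDiff_snd
  exact LipAt.comp_contDiffAt (f := fun y => (f y, g y)) h.contDiffAt (hf.prodMk hg)

theorem lipAt_of_contDiffAt [NormedSpace ℝ E] {f : ℝ → E} {x : ℝ} (hf : ContDiffAt ℝ 1 f x) :
    LipAt f x := by
  obtain ⟨K, t, ht, h⟩ := hf.exists_lipschitzOnWith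
  exact ⟨K, t, ht, h⟩

theorem lipAt_const (c : E) (x : ℝ) : LipAt (fun _ => c) x :=
  ⟨0, univ, univ_mem, (LipschitzWith.const c).lipschitzOnWith⟩

end LipAt

theorem exists_lipschitzOnWith_uIcc {E : Type*} [NormedAddCommGroup E] {f : ℝ → E} {a b : ℝ}
    (hf : ∀ x ∈ uIcc a b, LipAt f x) : ∃ K : ℝ≥0, LipschitzOnWith K f (uIcc a b) := by
  apply LocallyLipschitzOn.exists_lipschitzOnWith_of_compact isCompact_uIcc
  intro x hx
  obtain ⟨K, t, ht, h⟩ := hf x hx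
  exact ⟨K, t, mem_nhdsWithin_of_mem_nhds ht, h⟩

/-- Rademacher's theorem applies on a neighbourhood of each point; the exceptional set is locally
null, hence null. -/
theorem ae_differentiableAt_of_lipAt {E : Type*} [NormedAddCommGroup E]
    [NormedSpace ℝ E] [FiniteDimensional ℝ E] {f : ℝ → E} {I : Set ℝ}
    (hf : ∀ x ∈ I, LipAt f x) : ∀ᵐ x ∂volume, x ∈ I → DifferentiableAt ℝ f x := by
  rw [ae_iff]
  refine measure_null_of_locally_null _ ?_
  intro x hx
  have hx' : x ∈ I := by
    by_contra h
    exact hx fun h' => absurd h' h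
  obtain ⟨K, t, ht, hK⟩ := hf x hx'
  obtain ⟨u, hut, huo, hxu⟩ := mem_nhds_iff.1 ht
  refine ⟨_, inter_mem_nhdsWithin _ (huo.mem_nhds hxu), ?_⟩
  have h1 := (hK.mono hut).ae_differentiableWithinAt_of_mem (μ := volume)
  rw [ae_iff] at h1
  refine measure_mono_null ?_ h1
  rintro y ⟨hy, hyu⟩ hyn
  exact hy fun _ => (hyn hyu).differentiableAt (huo.mem_nhds hyu)

/-- The fundamental theorem of calculus for Lipschitz functions. -/
theorem integral_eq_sub_of_lipAt {f f' : ℝ → ℂ} {a b : ℝ}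
    (hf : ∀ x ∈ uIcc a b, LipAt f x)
    (hf' : ∀ᵐ x ∂volume, x ∈ uIcc a b → HasDerivAt f (f' x) x) :
    ∫ x in a..b, f' x = f b - f a := by
  obtain ⟨K, hK⟩ := exists_lipschitzOnWith_uIcc hf
  -- The closed interval is not a neighbourhood of its endpoints, which are therefore removed as a
  -- null set.
  have h2 : ∀ᵐ x ∂volume, x ∈ uIcc a b → ‖deriv f x‖ ≤ K := by
    have : ∀ᵐ x ∂(volume : Measure ℝ), x ∉ ({a, b} : Set ℝ) :=
      (measure_eq_zero_iff_ae_notMem.1 ((Set.toFinite ({a, b} : Set ℝ)).measure_zero volume))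
    filter_upwards [this] with x hx hxI
    refine norm_deriv_le_of_lipschitzOn ?_ hK
    simp only [mem_insert_iff, mem_singleton_iff, not_or] at hx
    rw [uIcc] at hxI ⊢
    refine Icc_mem_nhds (lt_of_le_of_ne hxI.1 ?_) (lt_of_le_of_ne hxI.2 ?_)
    · rcases min_choice a b with h | h <;> rw [h] <;> tauto
    · rcases max_choice a b with h | h <;> rw [h] <;> tauto
  have h3 : ∀ᵐ x ∂volume, x ∈ uIoc a b → f' x = deriv f x := by
    filter_upwards [hf'] with x hx hxI
    exact (hx (uIoc_subset_uIcc hxI)).deriv.symm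
  have h4 : IntervalIntegrable (deriv f) volume a b := by
    refine (intervalIntegrable_const (c := (K : ℝ))).mono_fun
      (measurable_deriv f).aestronglyMeasurable ?_
    rw [EventuallyLE, ae_restrict_iff' measurableSet_uIoc]
    filter_upwards [h2] with x hx hxI
    simpa using hx (uIoc_subset_uIcc hxI)
  rw [intervalIntegral.integral_congr_ae h3]
  have hd : ∀ᵐ x ∂volume, x ∈ uIoc a b → DifferentiableAt ℝ f x := by
    filter_upwards [hf'] with x hx hxI
    exact (hx (uIoc_subset_uIcc hxI)).differentiableAt
  -- The fundamental theorem for absolutely continuous functions is applied to the real and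
  -- imaginary parts separately.
  have hre : LipschitzOnWith K (fun x => (f x).re) (uIcc a b) := by
    intro x hx y hy
    refine le_trans ?_ (hK hx hy)
    rw [edist_dist, edist_dist]
    refine ENNReal.ofReal_le_ofReal ?_
    rw [Real.dist_eq, Complex.dist_eq, ← Complex.sub_re]
    exact Complex.abs_re_le_norm _
  have him : LipschitzOnWith K (fun x => (f x).im) (uIcc a b) := by
    intro x hx y hy
    refine le_trans ?_ (hK hx hy)
    rw [edist_dist, edist_dist]
    refine ENNReal.ofReal_le_ofReal ?_
    rw [Real.dist_eq, Complex.dist_eq, ← Complex.sub_im]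
    exact Complex.abs_im_le_norm _
  have e1 := hre.absolutelyContinuousOnInterval.integral_deriv_eq_sub
  have e2 := him.absolutelyContinuousOnInterval.integral_deriv_eq_sub
  have c1 : ∫ x in a..b, deriv (fun x => (f x).re) x = ∫ x in a..b, (deriv f x).re := by
    refine intervalIntegral.integral_congr_ae ?_
    filter_upwards [hd] with x hx hxI
    exact ((Complex.reCLM.hasFDerivAt.comp_hasDerivAt x (hx hxI).hasDerivAt)).deriv
  have c2 : ∫ x in a..b, deriv (fun x => (f x).im) x = ∫ x in a..b, (deriv f x).im := by
    refine intervalIntegral.integral_congr_ae ?_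
    filter_upwards [hd] with x hx hxI
    exact ((Complex.imCLM.hasFDerivAt.comp_hasDerivAt x (hx hxI).hasDerivAt)).deriv
  have d1 := Complex.reCLM.intervalIntegral_comp_comm h4
  have d2 := Complex.imCLM.intervalIntegral_comp_comm h4
  simp only [Complex.reCLM_apply, Complex.imCLM_apply] at d1 d2
  apply Complex.ext
  · rw [← d1, ← c1, e1, Complex.sub_re]
  · rw [← d2, ← c2, e2, Complex.sub_im]

theorem hasDerivAt_ae_of_locallyLipschitz {f : ℝ → ℂ} (hf : LocallyLipschitz f) :
    ∀ᵐ x ∂volume, HasDerivAt f (deriv f x) x := by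
  filter_upwards [ae_differentiableAt_of_lipAt (I := univ) (fun x _ => hf x)] with x hx
  exact (hx trivial).hasDerivAt

theorem exists_norm_deriv_le_of_locallyLipschitz {f : ℝ → ℂ} (hf : LocallyLipschitz f) (R : ℝ) :
    ∃ C : ℝ, 0 ≤ C ∧ ∀ x, |x| ≤ R → ‖deriv f x‖ ≤ C := by
  obtain ⟨K, hK⟩ := exists_lipschitzOnWith_uIcc (a := -(|R| + 1)) (b := |R| + 1)
    (f := f) (fun x _ => hf x)
  refine ⟨K, K.2, fun x hx => norm_deriv_le_of_lipschitzOn ?_ hK⟩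
  have : |x| < |R| + 1 := by linarith [le_abs_self R]
  rw [uIcc_of_le (by linarith [abs_nonneg x])]
  exact Icc_mem_nhds (abs_lt.1 this).1 (abs_lt.1 this).2

theorem locallyIntegrable_deriv {f : ℝ → ℂ} (hf : LocallyLipschitz f) :
    LocallyIntegrable (deriv f) volume := by
  intro x
  obtain ⟨K, t, ht, hK⟩ := hf x
  obtain ⟨u, hu, huo, hxu⟩ := mem_nhds_iff.1 ht
  refine ⟨u ∩ Metric.ball x 1, inter_mem (huo.mem_nhds hxu) (Metric.ball_mem_nhds x one_pos), ?_⟩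
  refine Measure.integrableOn_of_bounded (M := K) ?_
    (measurable_deriv f).aestronglyMeasurable ?_
  · exact ne_of_lt (lt_of_le_of_lt (measure_mono inter_subset_right) measure_ball_lt_top)
  · refine ae_restrict_of_forall_mem (huo.measurableSet.inter measurableSet_ball) ?_
    intro y hy
    exact norm_deriv_le_of_lipschitzOn (huo.mem_nhds hy.1) (hK.mono hu)

theorem integral_deriv_eq_zero {F : ℝ → ℂ} (hF : LocallyLipschitz F) (hc : HasCompactSupport F) :
    ∫ x, deriv F x = 0 := by
  obtain ⟨R, hR⟩ := hc.isCompact.isBounded.subset_closedBall 0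
  have hz : ∀ x, R < |x| → F x = 0 ∧ deriv F x = 0 := by
    intro x hx
    have : x ∉ tsupport F := by
      intro h
      have := hR h
      simp only [Metric.mem_closedBall, dist_zero_right, Real.norm_eq_abs] at this
      linarith
    exact ⟨image_eq_zero_of_notMem_tsupport this,
      image_eq_zero_of_notMem_tsupport fun h => this (tsupport_deriv_subset h)⟩
  have h1 : ∫ x in (-(|R| + 1))..(|R| + 1), deriv F x = F (|R| + 1) - F (-(|R| + 1)) := by
    refine integral_eq_sub_of_lipAt (fun x _ => hF x) ?_
    filter_upwards [hasDerivAt_ae_of_locallyLipschitz hF] with x hx _ using hx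
  have hpos : R < |(|R| + 1)| := by
    rw [abs_of_pos (by positivity)]; linarith [le_abs_self R]
  rw [(hz _ hpos).1, (hz (-(|R| + 1)) (by rwa [abs_neg])).1, sub_zero,
    intervalIntegral.integral_of_le (by linarith [abs_nonneg R])] at h1
  rw [← h1, ← integral_indicator measurableSet_Ioc]
  refine integral_congr_ae (Eventually.of_forall fun x => ?_)
  by_cases hx : x ∈ Ioc (-(|R| + 1)) (|R| + 1)
  · simp only [indicator_of_mem hx]
  · simp only [indicator_of_notMem hx]
    refine (hz x ?_).2
    by_contra h
    push Not at h
    have := abs_le.1 h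
    exact hx ⟨by linarith [le_abs_self R], by linarith [le_abs_self R]⟩

/-! ### Weak derivatives, the du Bois-Reymond lemma and the regularity of V. -/

theorem locallyLipschitz_ofReal {φ : ℝ → ℝ} (hφ : ContDiff ℝ 1 φ) :
    LocallyLipschitz (fun x => (φ x : ℂ)) :=
  (Complex.ofRealCLM.contDiff.comp hφ).locallyLipschitz

/-- The product of u with a test function is Lipschitz with compact support, so its derivative
integrates to zero; the product rule holds almost everywhere. -/
theorem isWeakDeriv_one_of_locallyLipschitz {u v : ℝ → ℂ} (hu : LocallyLipschitz u)
    (hv : ∀ᵐ x ∂volume, HasDerivAt u (v x) x) : IsWeakDeriv 1 u v := by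
  have hd : deriv u =ᵐ[volume] v := by filter_upwards [hv] with x hx using hx.deriv
  refine ⟨hu.continuous.locallyIntegrable, (locallyIntegrable_deriv hu).congr hd, ?_⟩
  intro φ hφ hc
  have hφ' : ∀ x, HasDerivAt φ (deriv φ x) x := fun x =>
    (hφ.differentiable (by simp) x).hasDerivAt
  have hcont : Continuous (deriv φ) := hφ.continuous_deriv (by simp)
  have h0 := integral_deriv_eq_zero (F := fun x => (φ x : ℂ) * u x)
    (fun x => LipAt.mul (locallyLipschitz_ofReal (hφ.of_le (by simp)) x) (hu x))
    ((hc.comp_left (g := fun y : ℝ => (y : ℂ)) (by simp)).mul_right)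
  have h1 : deriv (fun x => (φ x : ℂ) * u x) =ᵐ[volume]
      fun x => deriv φ x • u x + φ x • v x := by
    filter_upwards [hv] with x hx
    simp only [Complex.real_smul]
    exact ((hφ' x).ofReal_comp.mul hx).deriv
  have hvl : LocallyIntegrable v volume := (locallyIntegrable_deriv hu).congr hd
  rw [integral_congr_ae h1, integral_add] at h0
  · simp only [iteratedDeriv_one, pow_one]
    rw [eq_neg_of_add_eq_zero_left h0]; ring
  · exact (hcont.smul hu.continuous).integrable_of_hasCompactSupport (hc.deriv.smul_right)
  · exact hvl.integrable_smul_left_of_hasCompactSupport hφ.continuous hc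

/-- This is exactly the regularity of the pseudomode: C¹ with a locally Lipschitz derivative. The
first-order result is used twice, once with the derivative of the test function as test function. -/
theorem isWeakDeriv_two_of_locallyLipschitz {u u₁ v : ℝ → ℂ} (hu : ∀ x, HasDerivAt u (u₁ x) x)
    (hu₁ : LocallyLipschitz u₁) (hv : ∀ᵐ x ∂volume, HasDerivAt u₁ (v x) x) :
    IsWeakDeriv 2 u v := by
  have h1 := isWeakDeriv_one_of_locallyLipschitz hu₁ hv
  have hd : deriv u = u₁ := funext fun x => (hu x).deriv
  have hul : LocallyLipschitz u := by
    refine ContDiff.locallyLipschitz (𝕂 := ℝ) ?_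
    rw [contDiff_one_iff_deriv, hd]
    exact ⟨fun x => (hu x).differentiableAt, hu₁.continuous⟩
  have h2 := isWeakDeriv_one_of_locallyLipschitz hul (Eventually.of_forall hu)
  refine ⟨h2.1, h1.2.1, fun φ hφ hc => ?_⟩
  have e1 := h1.2.2 φ hφ hc
  have e2 := h2.2.2 (deriv φ) (((contDiff_infty_iff_deriv).1 hφ).2) hc.deriv
  rw [iteratedDeriv_one] at e1 e2
  rw [iteratedDeriv_succ, iteratedDeriv_one, e2, e1]
  ring


/-- Mean zero is what makes the primitive vanish again to the right of the support. -/
theorem exists_primitive_hasCompactSupport {θ : ℝ → ℝ} (hθ : ContDiff ℝ ∞ θ)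
    (hc : HasCompactSupport θ) (h0 : ∫ x, θ x = 0) :
    ∃ ψ : ℝ → ℝ, ContDiff ℝ ∞ ψ ∧ HasCompactSupport ψ ∧ deriv ψ = θ := by
  obtain ⟨R, hR⟩ := hc.isCompact.isBounded.subset_closedBall 0
  have hz : ∀ x, |R| < |x| → θ x = 0 := by
    intro x hx
    refine image_eq_zero_of_notMem_tsupport fun h => ?_
    have := hR h
    simp only [Metric.mem_closedBall, dist_zero_right, Real.norm_eq_abs] at this
    linarith [le_abs_self R]
  have hder : ∀ x, HasDerivAt (fun y => ∫ t in (-(|R| + 1))..y, θ t) (θ x) x := fun x =>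
    intervalIntegral.integral_hasDerivAt_right (hθ.continuous.intervalIntegrable _ _)
      hθ.continuous.aestronglyMeasurable.stronglyMeasurableAtFilter hθ.continuous.continuousAt
  have hd : deriv (fun y => ∫ t in (-(|R| + 1))..y, θ t) = θ := funext fun x => (hder x).deriv
  refine ⟨fun y => ∫ t in (-(|R| + 1))..y, θ t, ?_, ?_, hd⟩
  · rw [contDiff_infty_iff_deriv, hd]
    exact ⟨fun x => (hder x).differentiableAt, hθ⟩
  · refine HasCompactSupport.intro (isCompact_Icc (a := -(|R| + 1)) (b := |R| + 1)) ?_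
    intro x hx
    rw [mem_Icc, not_and_or, not_le, not_le] at hx
    have hR0 := abs_nonneg R
    have hsupp : Function.support θ ⊆ Ioc (-(|R| + 1)) (|R| + 1) := by
      intro y hy
      have : |y| ≤ |R| := by
        by_contra h
        exact hy (hz y (not_le.1 h))
      have := abs_le.1 this
      exact ⟨by linarith, by linarith⟩
    rcases hx with hx | hx
    · rw [intervalIntegral.integral_symm, intervalIntegral.integral_of_le hx.le, neg_eq_zero]
      refine setIntegral_eq_zero_of_forall_eq_zero fun t ht => hz t ?_
      rw [abs_of_neg (a := t) (by linarith [ht.2])]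
      linarith [ht.2]
    · rw [intervalIntegral.integral_eq_integral_of_support_subset
        (hsupp.trans (Ioc_subset_Ioc_right hx.le)), h0]

/-- Du Bois-Reymond: if ρ has integral one, then φ − (∫φ)ρ has mean zero and is the derivative of a
test function. Hence h pairs with φ as the constant ∫ρh does. -/
theorem ae_eq_const_of_isWeakDeriv_zero {h : ℝ → ℂ} (hl : LocallyIntegrable h volume)
    (hw : ∀ φ : ℝ → ℝ, ContDiff ℝ ∞ φ → HasCompactSupport φ → ∫ x, deriv φ x • h x = 0) :
    ∃ c : ℂ, h =ᵐ[volume] fun _ => c := by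
  let b : ContDiffBump (0 : ℝ) := ⟨1, 2, one_pos, by norm_num⟩
  let ρ := b.normed volume
  have hρ : ContDiff ℝ ∞ ρ := b.contDiff_normed
  have hρc : HasCompactSupport ρ := b.hasCompactSupport_normed
  have hρ1 : ∫ x, ρ x = 1 := b.integral_normed
  refine ⟨∫ x, ρ x • h x, ?_⟩
  have key : ∀ᵐ x ∂volume, h x - (∫ x, ρ x • h x) = 0 := by
    refine ae_eq_zero_of_integral_contDiff_smul_eq_zero
      (hl.sub (locallyIntegrable_const _)) ?_
    intro φ hφ hc
    have iφ : Integrable φ volume := hφ.continuous.integrable_of_hasCompactSupport hc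
    have iρ : Integrable ρ volume := hρ.continuous.integrable_of_hasCompactSupport hρc
    obtain ⟨ψ, hψ, hψc, hψd⟩ := exists_primitive_hasCompactSupport
      (θ := fun x => φ x - (∫ y, φ y) * ρ x) (hφ.sub (contDiff_const.mul hρ))
      (hc.sub hρc.mul_left) (by
        rw [integral_sub iφ (iρ.const_mul _), integral_const_mul, hρ1]; ring)
    have h0 := hw ψ hψ hψc
    rw [hψd] at h0
    have i1 : Integrable (fun x => φ x • h x) volume :=
      hl.integrable_smul_left_of_hasCompactSupport hφ.continuous hc
    have i2 : Integrable (fun x => ρ x • h x) volume :=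
      hl.integrable_smul_left_of_hasCompactSupport hρ.continuous hρc
    have e1 : ∫ x, (φ x - (∫ y, φ y) * ρ x) • h x =
        (∫ x, φ x • h x) - (∫ y, φ y) • ∫ x, ρ x • h x := by
      rw [← integral_smul]
      refine Eq.trans ?_ (integral_sub i1 (i2.smul (∫ y, φ y)))
      congr 1; ext x
      rw [sub_smul, mul_smul]
    rw [e1] at h0
    simp only [smul_sub]
    rw [integral_sub i1 (iφ.smul_const _), integral_smul_const]
    exact h0
  filter_upwards [key] with x hx using sub_eq_zero.1 hx

/-- A function with a locally bounded weak derivative agrees almost everywhere with a locally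
Lipschitz function. -/
theorem exists_locallyLipschitz_of_isWeakDeriv {u v : ℝ → ℂ} (h : IsWeakDeriv 1 u v)
    (hv : ∀ K : Set ℝ, IsCompact K → MemLp v ∞ (volume.restrict K)) :
    ∃ p : ℝ → ℂ, LocallyLipschitz p ∧ u =ᵐ[volume] p ∧ ∀ᵐ x ∂volume, HasDerivAt p (v x) x := by
  obtain ⟨hu, hvl, hw⟩ := h
  have hii : ∀ a b : ℝ, IntervalIntegrable v volume a b := fun a b =>
    (hvl.integrableOn_isCompact isCompact_uIcc).intervalIntegrable
  have hPl : LocallyLipschitz fun x => ∫ t in (0 : ℝ)..x, v t := by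
    intro x
    have hm := hv (Icc (x - 1) (x + 1)) isCompact_Icc
    have hC := ae_le_eLpNormEssSup (f := v) (μ := volume.restrict (Icc (x - 1) (x + 1)))
    rw [ae_restrict_iff' measurableSet_Icc] at hC
    have hfin := hm.eLpNorm_lt_top
    rw [eLpNorm_exponent_top] at hfin
    lift eLpNormEssSup v (volume.restrict (Icc (x - 1) (x + 1))) to ℝ≥0 using hfin.ne with C
    refine ⟨C, Icc (x - 1) (x + 1), Icc_mem_nhds (by linarith) (by linarith), ?_⟩
    refine LipschitzOnWith.of_dist_le_mul fun y hy z hz => ?_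
    rw [dist_eq_norm, intervalIntegral.integral_interval_sub_left (hii _ _) (hii _ _),
      Real.dist_eq]
    refine intervalIntegral.norm_integral_le_of_norm_le_const_ae ?_
    filter_upwards [hC] with t ht htI
    have := ht (uIcc_subset_Icc hz hy (uIoc_subset_uIcc htI))
    rw [← ofReal_norm, ← ENNReal.ofReal_coe_nnreal] at this
    exact (ENNReal.ofReal_le_ofReal_iff C.2).1 this
  have hPd : ∀ᵐ x ∂volume, HasDerivAt (fun x => ∫ t in (0 : ℝ)..x, v t) (v x) x := by
    filter_upwards [LocallyIntegrable.ae_hasDerivAt_integral hvl] with x hx using hx 0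
  have hPw := isWeakDeriv_one_of_locallyLipschitz hPl hPd
  -- The given function and the primitive of v have the same weak derivative, so they differ by a
  -- constant.
  obtain ⟨c, hc⟩ := ae_eq_const_of_isWeakDeriv_zero (hu.sub hPw.1) (fun φ hφ hφc => by
    have e1 := hw φ hφ hφc
    have e2 := hPw.2.2 φ hφ hφc
    simp only [iteratedDeriv_one] at e1 e2
    have hcd : Continuous (deriv φ) := hφ.continuous_deriv (by simp)
    simp only [Pi.sub_apply, smul_sub]
    rw [integral_sub (hu.integrable_smul_left_of_hasCompactSupport hcd hφc.deriv)
      (hPw.1.integrable_smul_left_of_hasCompactSupport hcd hφc.deriv), e1, e2, sub_self])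
  refine ⟨fun x => (∫ t in (0 : ℝ)..x, v t) + c,
    fun x => LipAt.add (hPl x) (lipAt_const c x), ?_, ?_⟩
  · filter_upwards [hc] with x hx
    rw [Pi.sub_apply] at hx
    rw [← hx]; ring
  · filter_upwards [hPd] with x hx using hx.add_const c

section Regularity

variable {N : ℕ} {ν : Side → ℝ} {ε₁ : ℝ} {V : ℝ → ℂ}

/-- V is continuous and almost everywhere equal to a locally Lipschitz function, hence equal to it.
The bounds on the weak derivative pass to the classical one, which exists almost everywhere. -/
theorem RegularPotential.lipschitz_and_bounds (hV : RegularPotential N ν ε₁ V) (hN : 1 ≤ N) :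
    LocallyLipschitz V ∧ ∀ s : Side,
      (fun x => (deriv V x).im) =O[s.atEnd ⊓ ae volume]
        (fun x => (V x).im * bracket x ^ (ν s)) ∧
      deriv V =O[s.atEnd ⊓ ae volume] (fun x => ‖V x‖ * bracket x ^ (ν s)) := by
  obtain ⟨v, hw, hb, hs⟩ := hV.derivs 1 le_rfl hN
  obtain ⟨p, hp, hVp, hpd⟩ := exists_locallyLipschitz_of_isWeakDeriv hw hb
  obtain rfl : V = p := (hV.continuous.ae_eq_iff_eq volume hp.continuous).1 hVp
  refine ⟨hp, fun s => ?_⟩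
  have hd : ∀ᶠ x in s.atEnd ⊓ ae volume, v x = deriv V x :=
    mem_inf_of_right (by filter_upwards [hpd] with x hx using hx.deriv.symm)
  obtain ⟨h1, h2⟩ := hs s
  simp only [Nat.cast_one, one_mul] at h1 h2
  exact ⟨h1.congr' (hd.mono fun x hx => by simp only [hx]) EventuallyEq.rfl,
    h2.congr' hd EventuallyEq.rfl⟩

/-- The second weak derivative of V is the weak derivative of the first, so the first agrees almost
everywhere with a locally Lipschitz q. Then V is a primitive of a continuous function and therefore
C¹ with derivative q. -/
theorem RegularPotential.contDiff_and_bounds (hV : RegularPotential N ν ε₁ V) (hN : 2 ≤ N) :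
    Differentiable ℝ V ∧ LocallyLipschitz (deriv V) ∧ ∀ s : Side,
      deriv (deriv V) =O[s.atEnd ⊓ ae volume] (fun x => ‖V x‖ * bracket x ^ (2 * ν s)) := by
  obtain ⟨v, hw, hb, -⟩ := hV.derivs 1 le_rfl (by omega)
  obtain ⟨v₂, hw₂, hb₂, hs⟩ := hV.derivs 2 (by norm_num) hN
  have hw21 : IsWeakDeriv 1 v v₂ := by
    refine ⟨hw.2.1, hw₂.2.1, fun φ hφ hc => ?_⟩
    have e1 := hw.2.2 (deriv φ) ((contDiff_infty_iff_deriv).1 hφ).2 hc.deriv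
    have e2 := hw₂.2.2 φ hφ hc
    rw [iteratedDeriv_succ, iteratedDeriv_one] at e2
    rw [iteratedDeriv_one] at e1 ⊢
    rw [e1] at e2
    linear_combination -e2
  obtain ⟨p, hp, hVp, hpd⟩ := exists_locallyLipschitz_of_isWeakDeriv hw hb
  obtain rfl : V = p := (hV.continuous.ae_eq_iff_eq volume hp.continuous).1 hVp
  obtain ⟨q, hq, hvq, hqd⟩ := exists_locallyLipschitz_of_isWeakDeriv hw21 hb₂
  have hVd : ∀ x, HasDerivAt V (q x) x := by
    have hrep : ∀ x, V x = V 0 + ∫ t in (0 : ℝ)..x, q t := by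
      intro x
      rw [integral_eq_sub_of_lipAt (f := V) (f' := q) (fun y _ => hp y)]
      · ring
      · filter_upwards [hpd, hvq] with y h1 h2 _
        rwa [← h2]
    intro x
    have : HasDerivAt (fun x => V 0 + ∫ t in (0 : ℝ)..x, q t) (q x) x :=
      (intervalIntegral.integral_hasDerivAt_right (hq.continuous.intervalIntegrable _ _)
        hq.continuous.aestronglyMeasurable.stronglyMeasurableAtFilter
        hq.continuous.continuousAt).const_add _
    rwa [← funext hrep] at this
  have hdV : deriv V = q := funext fun x => (hVd x).deriv
  refine ⟨fun x => (hVd x).differentiableAt, hdV ▸ hq, fun s => ?_⟩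
  have hd : ∀ᶠ x in s.atEnd ⊓ ae volume, v₂ x = deriv (deriv V) x :=
    mem_inf_of_right (by filter_upwards [hqd] with x hx; rw [hdV]; exact hx.deriv.symm)
  have h2 := (hs s).2
  simp only [Nat.cast_ofNat] at h2
  exact h2.congr' hd EventuallyEq.rfl

end Regularity

/-- `schrodinger` is defined by a choice; uniqueness up to null sets is what allows it to be
computed. -/
theorem isSchrodingerImage_ae_unique {U f h₁ h₂ : ℝ → ℂ} (h : IsSchrodingerImage U f h₁)
    (h' : IsSchrodingerImage U f h₂) : h₁ =ᵐ[volume] h₂ := by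
  obtain ⟨-, -, -, l1, w1⟩ := h
  obtain ⟨-, -, -, l2, w2⟩ := h'
  have : ∀ᵐ x ∂volume, (U x * f x - h₁ x) - (U x * f x - h₂ x) = 0 := by
    refine ae_eq_zero_of_integral_contDiff_smul_eq_zero (l1.sub l2) fun φ hφ hc => ?_
    simp only [smul_sub _ (U _ * f _ - h₁ _)]
    rw [integral_sub (l1.integrable_smul_left_of_hasCompactSupport hφ.continuous hc)
      (l2.integrable_smul_left_of_hasCompactSupport hφ.continuous hc)]
    have e1 := w1 φ hφ hc
    have e2 := w2 φ hφ hc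
    rw [e1] at e2
    simpa [sub_eq_zero] using e2
  filter_upwards [this] with x hx
  linear_combination -hx

theorem schrodinger_ae_eq {U f h : ℝ → ℂ} (hh : IsSchrodingerImage U f h) :
    schrodinger U f =ᵐ[volume] h := by
  have hex : ∃ h, IsSchrodingerImage U f h := ⟨h, hh⟩
  rw [schrodinger, dif_pos hex]
  exact isSchrodingerImage_ae_unique hex.choose_spec hh


/-! ### Averaged differences and the L² modulus of continuity. -/

theorem sq_lintegral_le {α : Type*} [MeasurableSpace α] (μ : Measure α) {D : α → ℝ≥0∞}
    (hD : AEMeasurable D μ) : (∫⁻ a, D a ∂μ) ^ 2 ≤ μ univ * ∫⁻ a, D a ^ 2 ∂μ := by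
  have h := ENNReal.lintegral_mul_le_Lp_mul_Lq μ Real.HolderConjugate.two_two
    (f := fun _ => 1) (g := D) aemeasurable_const hD
  simp only [Pi.mul_apply, one_mul, ENNReal.one_rpow, lintegral_const] at h
  calc (∫⁻ a, D a ∂μ) ^ 2
      ≤ (μ univ ^ (1 / 2 : ℝ) * (∫⁻ a, D a ^ (2 : ℝ) ∂μ) ^ (1 / 2 : ℝ)) ^ 2 := by gcongr
    _ = μ univ * ∫⁻ a, D a ^ 2 ∂μ := by
        rw [mul_pow, ← ENNReal.rpow_natCast, ← ENNReal.rpow_natCast, ← ENNReal.rpow_mul,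
          ← ENNReal.rpow_mul]
        norm_num

theorem eLpNorm_two_sq {α : Type*} [MeasurableSpace α] {μ : Measure α} {E : Type*}
    [NormedAddCommGroup E] (f : α → E) : eLpNorm f 2 μ ^ 2 = ∫⁻ a, ‖f a‖ₑ ^ 2 ∂μ := by
  have := eLpNorm_nnreal_pow_eq_lintegral (f := f) (μ := μ) (p := 2) two_ne_zero
  simpa using this

theorem eLpNorm_two_le_of_sq_le {α : Type*} [MeasurableSpace α] {μ : Measure α} {E : Type*}
    [NormedAddCommGroup E] {f : α → E} {c : ℝ≥0∞} (h : ∫⁻ a, ‖f a‖ₑ ^ 2 ∂μ ≤ c ^ 2) :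
    eLpNorm f 2 μ ≤ c := by
  rw [← eLpNorm_two_sq] at h
  exact (ENNReal.pow_le_pow_left_iff two_ne_zero).1 h

/-- The averaged difference of `φ` against a kernel supported in `(-ε, ε)` is controlled by the
`L²` modulus of continuity. -/
theorem eLpNorm_integral_smul_sub_le {k : ℝ → ℝ} {ε B : ℝ} (hsupp : ∀ t, ε ≤ |t| → k t = 0)
    (hB : ∀ t, |k t| ≤ B) {φ : ℝ → ℂ} (hφ : AEStronglyMeasurable φ volume) (J : Set ℝ) :
    eLpNorm (fun x => ∫ t, k t • (φ (x - t) - φ x)) 2 (volume.restrict J) ≤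
      ENNReal.ofReal (2 * B * ε) * modulus 2 ε φ J := by
  have hB0 : 0 ≤ B := (abs_nonneg _).trans (hB 0)
  let I : Set ℝ := Ioo (-ε) ε
  let D : ℝ → ℝ → ℝ≥0∞ := fun x t => ‖φ (x - t) - φ x‖ₑ
  have hvol : volume I = ENNReal.ofReal (2 * ε) := by
    rw [Real.volume_Ioo]; congr 1; ring
  have hmeas2 : AEStronglyMeasurable (fun p : ℝ × ℝ => φ (p.1 - p.2) - φ p.1)
      ((volume.restrict J).prod (volume.restrict I)) := by
    rw [Measure.prod_restrict]
    refine AEStronglyMeasurable.restrict ?_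
    refine AEStronglyMeasurable.sub ?_ ?_
    · exact hφ.comp_quasiMeasurePreserving (quasiMeasurePreserving_sub_of_right_invariant _ _)
    · exact hφ.comp_quasiMeasurePreserving Measure.quasiMeasurePreserving_fst
  have hDm : AEMeasurable (Function.uncurry D)
      ((volume.restrict J).prod (volume.restrict I)) := hmeas2.enorm
  have hDx : ∀ x, AEMeasurable (D x) (volume.restrict I) := by
    intro x
    have : AEStronglyMeasurable (fun t => φ (x - t) - φ x) volume :=
      (hφ.comp_quasiMeasurePreserving
        (quasiMeasurePreserving_sub_left_of_right_invariant _ x)).sub aestronglyMeasurable_const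
    exact this.restrict.enorm
  -- Cauchy–Schwarz in t over an interval of length 2ε, pointwise in x. After Tonelli the integral
  -- over x is taken for each fixed shift and is at most the squared modulus.
  have h1 : ∀ x, ‖∫ t, k t • (φ (x - t) - φ x)‖ₑ ^ 2 ≤
      ENNReal.ofReal B ^ 2 * (volume I * ∫⁻ t in I, D x t ^ 2) := by
    intro x
    have hle : ‖∫ t, k t • (φ (x - t) - φ x)‖ₑ ≤ ENNReal.ofReal B * ∫⁻ t in I, D x t := by
      refine (enorm_integral_le_lintegral_enorm _).trans ?_
      rw [← lintegral_const_mul'' _ (hDx x), ← lintegral_indicator measurableSet_Ioo]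
      refine lintegral_mono fun t => ?_
      by_cases ht : t ∈ I
      · rw [indicator_of_mem ht, enorm_smul]
        gcongr
        rw [Real.enorm_eq_ofReal_abs]
        exact ENNReal.ofReal_le_ofReal (hB t)
      · rw [indicator_of_notMem ht, hsupp t, zero_smul, enorm_zero]
        by_contra h
        exact ht (abs_lt.1 (not_le.1 h))
    calc _ ≤ (ENNReal.ofReal B * ∫⁻ t in I, D x t) ^ 2 := by gcongr
      _ ≤ _ := by
        rw [mul_pow]
        gcongr
        simpa using sq_lintegral_le (volume.restrict I) (hDx x)
  refine eLpNorm_two_le_of_sq_le ?_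
  calc ∫⁻ x in J, ‖∫ t, k t • (φ (x - t) - φ x)‖ₑ ^ 2
      ≤ ∫⁻ x in J, ENNReal.ofReal B ^ 2 * (volume I * ∫⁻ t in I, D x t ^ 2) :=
        lintegral_mono h1
    _ = ENNReal.ofReal B ^ 2 * (volume I * ∫⁻ t in I, ∫⁻ x in J, D x t ^ 2) := by
        rw [lintegral_const_mul' _ _ (by finiteness), lintegral_const_mul' _ _
          (by rw [hvol]; finiteness), lintegral_lintegral_swap (hDm.pow_const 2)]
    _ ≤ ENNReal.ofReal B ^ 2 * (volume I * ∫⁻ t in I, modulus 2 ε φ J ^ 2) := by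
        gcongr ENNReal.ofReal B ^ 2 * (volume I * ?_)
        refine lintegral_mono_ae ?_
        rw [ae_restrict_iff' measurableSet_Ioo]
        -- The supremum in `modulus` excludes the zero shift, which is a null set here.
        have h0 : ∀ᵐ t ∂(volume : Measure ℝ), t ≠ 0 := by
          simp [ae_iff, measure_singleton]
        filter_upwards [h0] with t ht htI
        have : ∫⁻ x in J, D x t ^ 2 =
            eLpNorm (fun x => φ (x + -t) - φ x) 2 (volume.restrict J) ^ 2 := by
          rw [eLpNorm_two_sq]; rfl
        rw [this]
        gcongr
        exact le_iSup₂_of_le (-t) ⟨by simpa using ht, by rw [abs_neg]; exact abs_lt.2 htI⟩ le_rfl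
    _ = (ENNReal.ofReal (2 * B * ε) * modulus 2 ε φ J) ^ 2 := by
        rw [lintegral_const, Measure.restrict_apply_univ, hvol,
          show 2 * B * ε = B * (2 * ε) by ring, ENNReal.ofReal_mul hB0]
        ring

/-! ### Mollification and its derivatives. -/

section Kernel

variable {w : ℝ → ℝ}

/-- The kernel of the `j`-th derivative of the mollification. -/
def molKernel (w : ℝ → ℝ) (ε : ℝ) (j : ℕ) (x : ℝ) : ℝ :=
  (ε ^ (j + 1))⁻¹ * iteratedDeriv j w (x / ε)

/-- The `j`-th derivative of the mollification. -/
def mollifyDeriv (w : ℝ → ℝ) (ε : ℝ) (j : ℕ) (φ : ℝ → ℂ) : ℝ → ℂ :=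
  convolution (molKernel w ε j) φ (ContinuousLinearMap.lsmul ℝ ℝ) volume

theorem mollify_eq_mollifyDeriv_zero (w : ℝ → ℝ) (ε : ℝ) (φ : ℝ → ℂ) :
    mollify w ε φ = mollifyDeriv w ε 0 φ := by
  unfold mollify mollifyDeriv molKernel
  simp

theorem mollifyDeriv_apply (w : ℝ → ℝ) (ε : ℝ) (j : ℕ) (φ : ℝ → ℂ) (x : ℝ) :
    mollifyDeriv w ε j φ x = ∫ t, molKernel w ε j t • φ (x - t) := rfl

theorem IsMollifier.contDiff_iteratedDeriv (hw : IsMollifier w) (j : ℕ) :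
    ContDiff ℝ ∞ (iteratedDeriv j w) := by
  induction j with
  | zero => rw [iteratedDeriv_zero]; exact hw.contDiff
  | succ j ih => rw [iteratedDeriv_succ]; exact (contDiff_infty_iff_deriv.1 ih).2

theorem IsMollifier.tsupport_iteratedDeriv (hw : IsMollifier w) (j : ℕ) :
    tsupport (iteratedDeriv j w) ⊆ Icc (-1) 1 := by
  induction j with
  | zero => rw [iteratedDeriv_zero, hw.support]
  | succ j ih => rw [iteratedDeriv_succ]; exact (tsupport_deriv_subset).trans ih

theorem IsMollifier.hasCompactSupport_iteratedDeriv (hw : IsMollifier w) (j : ℕ) :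
    HasCompactSupport (iteratedDeriv j w) :=
  isCompact_Icc.of_isClosed_subset (isClosed_tsupport _) (hw.tsupport_iteratedDeriv j)

/-- The endpoints |t| = 1 are included by continuity. Thus the rescaled kernel only sees shifts with
|t| < ε, the range allowed in `modulus`. -/
theorem IsMollifier.iteratedDeriv_eq_zero (hw : IsMollifier w) (j : ℕ) {t : ℝ} (ht : 1 ≤ |t|) :
    iteratedDeriv j w t = 0 := by
  have hc := (hw.contDiff_iteratedDeriv j).continuous
  have hout : ∀ t, 1 < |t| → iteratedDeriv j w t = 0 := fun t ht =>
    image_eq_zero_of_notMem_tsupport fun h =>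
      absurd (abs_le.2 (hw.tsupport_iteratedDeriv j h)) (not_le.2 ht)
  have hcl : IsClosed {t | iteratedDeriv j w t = 0} := isClosed_eq hc continuous_const
  rcases ht.lt_or_eq with h | h
  · exact hout t h
  · have hmem : t ∈ closure {t : ℝ | 1 < |t|} := by
      rw [Metric.mem_closure_iff]
      intro e he
      refine ⟨t * (1 + e / 2), ?_, ?_⟩
      · rw [mem_ofPred_eq, abs_mul, ← h, abs_of_pos (by positivity)]; linarith
      · rw [dist_comm, Real.dist_eq, show t * (1 + e / 2) - t = t * (e / 2) by ring, abs_mul, ← h,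
          abs_of_pos (by positivity)]
        linarith
    exact hcl.closure_subset_iff.2 (fun t ht => hout t ht) hmem

theorem IsMollifier.exists_bound (hw : IsMollifier w) :
    ∃ B : ℝ, 0 < B ∧ ∀ j ≤ 2, ∀ t, |iteratedDeriv j w t| ≤ B := by
  choose b hb using fun j : ℕ => (hw.hasCompactSupport_iteratedDeriv j).exists_bound_of_continuous
    (hw.contDiff_iteratedDeriv j).continuous
  refine ⟨|b 0| + |b 1| + |b 2| + 1, by positivity, fun j hj t => ?_⟩
  have h := hb j t
  rw [Real.norm_eq_abs] at h
  have h0 := abs_nonneg (b 0)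
  have h1 := abs_nonneg (b 1)
  have h2 := abs_nonneg (b 2)
  have := le_abs_self (b j)
  interval_cases j <;> linarith

variable {ε : ℝ}

theorem contDiff_molKernel (hw : IsMollifier w) (ε : ℝ) (j : ℕ) :
    ContDiff ℝ ∞ (molKernel w ε j) :=
  contDiff_const.mul ((hw.contDiff_iteratedDeriv j).comp (contDiff_id.div_const ε))

theorem molKernel_eq_zero (hw : IsMollifier w) (hε : 0 < ε) (j : ℕ) {t : ℝ} (ht : ε ≤ |t|) :
    molKernel w ε j t = 0 := by
  rw [molKernel, hw.iteratedDeriv_eq_zero, mul_zero]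
  rwa [abs_div, abs_of_pos hε, le_div_iff₀ hε, one_mul]

theorem hasCompactSupport_molKernel (hw : IsMollifier w) (hε : 0 < ε) (j : ℕ) :
    HasCompactSupport (molKernel w ε j) := by
  refine HasCompactSupport.intro (isCompact_Icc (a := -ε) (b := ε)) fun t ht => ?_
  refine molKernel_eq_zero hw hε j ?_
  by_contra h
  exact ht (abs_le.1 (not_le.1 h).le)

theorem abs_molKernel_le (hε : 0 < ε) {B : ℝ} {j : ℕ}
    (hB : ∀ t, |iteratedDeriv j w t| ≤ B) (t : ℝ) :
    |molKernel w ε j t| ≤ (ε ^ (j + 1))⁻¹ * B := by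
  rw [molKernel, abs_mul, abs_of_pos (by positivity)]
  exact mul_le_mul_of_nonneg_left (hB _) (by positivity)

theorem hasDerivAt_molKernel (hw : IsMollifier w) (hε : 0 < ε) (j : ℕ) (t : ℝ) :
    HasDerivAt (molKernel w ε j) (molKernel w ε (j + 1) t) t := by
  have h1 : HasDerivAt (iteratedDeriv j w) (iteratedDeriv (j + 1) w (t / ε)) (t / ε) := by
    rw [iteratedDeriv_succ]
    exact ((hw.contDiff_iteratedDeriv j).differentiable (by simp) _).hasDerivAt
  have h2 : HasDerivAt (fun x : ℝ => x / ε) (1 / ε) t := (hasDerivAt_id t).div_const ε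
  have := (h1.comp t h2).const_mul ((ε ^ (j + 1))⁻¹)
  refine this.congr_deriv ?_
  rw [molKernel]
  field_simp
  ring

theorem integral_molKernel_zero (hw : IsMollifier w) (hε : 0 < ε) :
    ∫ t, molKernel w ε 0 t = 1 := by
  simp only [molKernel, iteratedDeriv_zero, integral_const_mul]
  rw [Measure.integral_comp_div, hw.integral, abs_of_pos hε]
  simp [hε.ne']

theorem integral_molKernel_succ (hw : IsMollifier w) (hε : 0 < ε) (j : ℕ) :
    ∫ t, molKernel w ε (j + 1) t = 0 :=
  integral_eq_zero_of_hasDerivAt_of_integrable (fun t => hasDerivAt_molKernel hw hε j t)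
    ((contDiff_molKernel hw ε _).continuous.integrable_of_hasCompactSupport
      (hasCompactSupport_molKernel hw hε _))
    ((contDiff_molKernel hw ε _).continuous.integrable_of_hasCompactSupport
      (hasCompactSupport_molKernel hw hε _))

theorem hasDerivAt_mollifyDeriv (hw : IsMollifier w) (hε : 0 < ε) (j : ℕ) {φ : ℝ → ℂ}
    (hφ : LocallyIntegrable φ volume) (x : ℝ) :
    HasDerivAt (mollifyDeriv w ε j φ) (mollifyDeriv w ε (j + 1) φ x) x := by
  have h := (hasCompactSupport_molKernel hw hε j).hasDerivAt_convolution_left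
    (ContinuousLinearMap.lsmul ℝ ℝ : ℝ →L[ℝ] ℂ →L[ℝ] ℂ) (μ := volume)
    ((contDiff_molKernel hw ε j).of_le (by simp)) hφ x
  have hd : deriv (molKernel w ε j) = molKernel w ε (j + 1) :=
    funext fun t => (hasDerivAt_molKernel hw hε j t).deriv
  rw [hd] at h
  exact h

theorem deriv_mollify (hw : IsMollifier w) (hε : 0 < ε) {φ : ℝ → ℂ}
    (hφ : LocallyIntegrable φ volume) : deriv (mollify w ε φ) = mollifyDeriv w ε 1 φ := by
  rw [mollify_eq_mollifyDeriv_zero]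
  exact funext fun x => (hasDerivAt_mollifyDeriv hw hε 0 hφ x).deriv

theorem deriv_deriv_mollify (hw : IsMollifier w) (hε : 0 < ε) {φ : ℝ → ℂ}
    (hφ : LocallyIntegrable φ volume) :
    deriv (deriv (mollify w ε φ)) = mollifyDeriv w ε 2 φ := by
  rw [deriv_mollify hw hε hφ]
  exact funext fun x => (hasDerivAt_mollifyDeriv hw hε 1 hφ x).deriv

theorem contDiff_mollify (hw : IsMollifier w) (hε : 0 < ε) {φ : ℝ → ℂ}
    (hφ : LocallyIntegrable φ volume) : ContDiff ℝ ∞ (mollify w ε φ) := by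
  rw [mollify_eq_mollifyDeriv_zero]
  exact (hasCompactSupport_molKernel hw hε 0).contDiff_convolution_left _ (n := ⊤)
    (contDiff_molKernel hw ε 0) hφ

theorem integrable_molKernel_smul (hw : IsMollifier w) (hε : 0 < ε) (j : ℕ) {φ : ℝ → ℂ}
    (hφ : LocallyIntegrable φ volume) (x : ℝ) :
    Integrable (fun t => molKernel w ε j t • φ (x - t)) volume :=
  ((hasCompactSupport_molKernel hw hε j).convolutionExists_left
    (ContinuousLinearMap.lsmul ℝ ℝ : ℝ →L[ℝ] ℂ →L[ℝ] ℂ)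
    (contDiff_molKernel hw ε j).continuous hφ x).integrable

theorem integrable_molKernel (hw : IsMollifier w) (hε : 0 < ε) (j : ℕ) :
    Integrable (molKernel w ε j) volume :=
  (contDiff_molKernel hw ε j).continuous.integrable_of_hasCompactSupport
      (hasCompactSupport_molKernel hw hε j)

/-- The kernel has integral one for j = 0 and zero for j ≥ 1. So the left side is the mollification
error in the first case and the j-th derivative of the mollification in the second. -/
theorem integral_molKernel_smul_sub (hw : IsMollifier w) (hε : 0 < ε) (j : ℕ) {φ : ℝ → ℂ}
    (hφ : LocallyIntegrable φ volume) (x : ℝ) :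
    ∫ t, molKernel w ε j t • (φ (x - t) - φ x) =
      mollifyDeriv w ε j φ x - (∫ t, molKernel w ε j t) • φ x := by
  simp only [smul_sub]
  rw [integral_sub (integrable_molKernel_smul hw hε j hφ x)
    ((integrable_molKernel hw hε j).smul_const _), integral_smul_const, mollifyDeriv_apply]

/-- The `L²` error of the mollification. -/
theorem eLpNorm_sub_mollify_le (hw : IsMollifier w) {B : ℝ}
    (hB : ∀ j ≤ 2, ∀ t, |iteratedDeriv j w t| ≤ B) (hε : 0 < ε) {φ : ℝ → ℂ}
    (hφ : LocallyIntegrable φ volume) (J : Set ℝ) :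
    eLpNorm (fun x => φ x - mollify w ε φ x) 2 (volume.restrict J) ≤
      ENNReal.ofReal (2 * B) * modulus 2 ε φ J := by
  have h := eLpNorm_integral_smul_sub_le (fun t ht => molKernel_eq_zero hw hε 0 ht) (abs_molKernel_le hε (hB 0 (by norm_num)))
    hφ.aestronglyMeasurable J
  simp only [integral_molKernel_smul_sub hw hε 0 hφ, integral_molKernel_zero hw hε, one_smul,
    ← mollify_eq_mollifyDeriv_zero] at h
  rw [← eLpNorm_neg]
  convert h using 2
  · ext x; simp
  · congr 1; field_simp; simp

/-- The `L²` norm of the derivatives of the mollification. -/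
theorem eLpNorm_mollifyDeriv_succ_le (hw : IsMollifier w) {B : ℝ}
    (hB : ∀ j ≤ 2, ∀ t, |iteratedDeriv j w t| ≤ B) (hε : 0 < ε) {φ : ℝ → ℂ}
    (hφ : LocallyIntegrable φ volume) (J : Set ℝ) {j : ℕ} (hj : j + 1 ≤ 2) :
    eLpNorm (mollifyDeriv w ε (j + 1) φ) 2 (volume.restrict J) ≤
      ENNReal.ofReal (2 * B * (ε ^ (j + 1))⁻¹) * modulus 2 ε φ J := by
  have h := eLpNorm_integral_smul_sub_le (fun t ht => molKernel_eq_zero hw hε (j + 1) ht) (abs_molKernel_le hε (hB (j + 1) hj))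
    hφ.aestronglyMeasurable J
  simp only [integral_molKernel_smul_sub hw hε (j + 1) hφ, integral_molKernel_succ hw hε j,
    zero_smul, sub_zero] at h
  convert h using 3
  field_simp
  ring

theorem norm_mollifyDeriv_le_of_bound (hw : IsMollifier w) {B : ℝ}
    (hB : ∀ j ≤ 2, ∀ t, |iteratedDeriv j w t| ≤ B) (hε : 0 < ε) {φ : ℝ → ℂ} {x M : ℝ}
    (hM : ∀ᵐ y ∂volume, |y - x| ≤ ε → ‖φ y‖ ≤ M) {j : ℕ} (hj : j ≤ 2) :
    ‖mollifyDeriv w ε j φ x‖ ≤ 2 * B * (ε ^ j)⁻¹ * M := by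
  have hM' : ∀ᵐ t ∂volume, |x - t - x| ≤ ε → ‖φ (x - t)‖ ≤ M :=
    (quasiMeasurePreserving_sub_left_of_right_invariant volume x).ae hM
  have hI : mollifyDeriv w ε j φ x = ∫ t in Icc (-ε) ε, molKernel w ε j t • φ (x - t) := by
    rw [mollifyDeriv_apply, setIntegral_eq_integral_of_forall_compl_eq_zero]
    intro t ht
    rw [molKernel_eq_zero hw hε, zero_smul]
    by_contra h
    exact ht (abs_le.1 (not_le.1 h).le)
  rw [hI]
  have := norm_setIntegral_le_of_norm_le_const_ae (μ := volume) (s := Icc (-ε) ε)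
    (f := fun t => molKernel w ε j t • φ (x - t)) (C := (ε ^ (j + 1))⁻¹ * B * M)
    measure_Icc_lt_top ?_
  · refine this.trans (le_of_eq ?_)
    rw [measureReal_def, Real.volume_Icc, ENNReal.toReal_ofReal (by linarith)]
    field_simp
    ring
  · rw [ae_restrict_iff' measurableSet_Icc]
    filter_upwards [hM'] with t ht htI
    rw [norm_smul, Real.norm_eq_abs]
    have h1 := abs_molKernel_le hε (hB j hj) t
    have h2 := ht (by rw [sub_sub_cancel_left, abs_neg]; exact abs_le.2 htI)
    exact mul_le_mul h1 h2 (norm_nonneg _) ((abs_nonneg _).trans h1)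

/-- Convex averages preserve linear bounds. -/
theorem abs_clm_mollify_le (hw : IsMollifier w) (hε : 0 < ε) {φ : ℝ → ℂ}
    (hφ : LocallyIntegrable φ volume) (ℓ : ℂ →L[ℝ] ℝ) {x M : ℝ}
    (hM : ∀ᵐ y ∂volume, |y - x| ≤ ε → |ℓ (φ y)| ≤ M) :
    |ℓ (mollify w ε φ x)| ≤ M := by
  have hM' : ∀ᵐ t ∂volume, |x - t - x| ≤ ε → |ℓ (φ (x - t))| ≤ M :=
    (quasiMeasurePreserving_sub_left_of_right_invariant volume x).ae hM
  have hk0 : ∀ t, 0 ≤ molKernel w ε 0 t := fun t => by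
    rw [molKernel, iteratedDeriv_zero]
    exact mul_nonneg (by positivity) (hw.nonneg _)
  rw [mollify_eq_mollifyDeriv_zero, mollifyDeriv_apply,
    ← ContinuousLinearMap.integral_comp_comm _ (integrable_molKernel_smul hw hε 0 hφ x),
    ← Real.norm_eq_abs]
  calc _ ≤ ∫ t, M * molKernel w ε 0 t := by
        refine norm_integral_le_of_norm_le ((integrable_molKernel hw hε 0).const_mul _) ?_
        filter_upwards [hM'] with t ht
        rw [map_smul, norm_smul, Real.norm_of_nonneg (hk0 t), mul_comm, Real.norm_eq_abs]
        by_cases h : |t| ≤ ε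
        · exact mul_le_mul_of_nonneg_right (ht (by rwa [sub_sub_cancel_left, abs_neg])) (hk0 t)
        · rw [molKernel_eq_zero hw hε 0 (not_le.1 h).le, mul_zero, mul_zero]
    _ = M := by rw [integral_const_mul, integral_molKernel_zero hw hε, mul_one]

/-- Cauchy–Schwarz, with the L² norm of the kernel estimated by its maximum on an interval of length
2ε. It serves W₂, for which no pointwise bound is available. -/
theorem norm_mollifyDeriv_le_of_memLp (hw : IsMollifier w) {B : ℝ}
    (hB : ∀ j ≤ 2, ∀ t, |iteratedDeriv j w t| ≤ B) (hε : 0 < ε) {φ : ℝ → ℂ}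
    (hφ : MemLp φ 2 volume) {j : ℕ} (hj : j ≤ 2) (x : ℝ) :
    ‖mollifyDeriv w ε j φ x‖ ≤ (ε ^ (j + 1))⁻¹ * B * Real.sqrt (2 * ε) * norm2 φ := by
  have hB0 : 0 ≤ B := (abs_nonneg _).trans (hB 0 (by norm_num) 0)
  have hφx : AEStronglyMeasurable (fun t => φ (x - t)) volume :=
    hφ.1.comp_quasiMeasurePreserving (quasiMeasurePreserving_sub_left_of_right_invariant _ x)
  have hmp : MeasurePreserving (fun t : ℝ => x - t) volume volume :=
    Measure.measurePreserving_sub_left volume x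
  have hk : eLpNorm (molKernel w ε j) 2 volume ≤
      ENNReal.ofReal ((ε ^ (j + 1))⁻¹ * B * Real.sqrt (2 * ε)) := by
    refine eLpNorm_two_le_of_sq_le ?_
    calc ∫⁻ t, ‖molKernel w ε j t‖ₑ ^ 2
        ≤ ∫⁻ t, (Icc (-ε) ε).indicator (fun _ => ENNReal.ofReal ((ε ^ (j + 1))⁻¹ * B) ^ 2) t := by
          refine lintegral_mono fun t => ?_
          by_cases ht : t ∈ Icc (-ε) ε
          · rw [indicator_of_mem ht, Real.enorm_eq_ofReal_abs]
            gcongr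
            exact abs_molKernel_le hε (hB j hj) t
          · rw [indicator_of_notMem ht, molKernel_eq_zero hw hε]
            · simp
            by_contra h
            exact ht (abs_le.1 (not_le.1 h).le)
      _ = _ := by
          rw [lintegral_indicator measurableSet_Icc, lintegral_const,
            Measure.restrict_apply_univ, Real.volume_Icc,
            ENNReal.ofReal_mul (p := (ε ^ (j + 1))⁻¹ * B) (by positivity),
            mul_pow, ← ENNReal.ofReal_pow (Real.sqrt_nonneg _), Real.sq_sqrt (by positivity)]
          congr 2; ring
  have h1 : ‖mollifyDeriv w ε j φ x‖ₑ ≤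
      ENNReal.ofReal ((ε ^ (j + 1))⁻¹ * B * Real.sqrt (2 * ε)) * eLpNorm φ 2 volume := by
    rw [mollifyDeriv_apply]
    refine (enorm_integral_le_lintegral_enorm _).trans ?_
    rw [← eLpNorm_one_eq_lintegral_enorm]
    refine (eLpNorm_smul_le_mul_eLpNorm (p := 2) (q := 2) (r := 1) (μ := volume) hφx
      (contDiff_molKernel hw ε j).continuous.aestronglyMeasurable).trans ?_
    have := eLpNorm_comp_measurePreserving (p := 2) hφ.1 hmp
    rw [show (fun t => φ (x - t)) = φ ∘ (fun t => x - t) from rfl, this]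
    gcongr
  rw [← ofReal_norm, ← ENNReal.ofReal_toReal hφ.2.ne, ← ENNReal.ofReal_mul (by positivity)] at h1
  exact (ENNReal.ofReal_le_ofReal_iff (by unfold norm2 at *; positivity)).1 h1

end Kernel


/-! ### Mollification errors in terms of the modulus of continuity. -/

/-- The contribution of a rough function `φ` and its regularization `φ'` to the remainder. -/
def pieceError (n : ℕ) (φ φ' : ℝ → ℂ) (J : Set ℝ) (lam : ℝ) : ℝ≥0∞ :=
  match n with
  | 0 => eLpNorm (fun x => φ x - φ' x) 2 (volume.restrict J) +
      ENNReal.ofReal (lam ^ (-(1 / 2) : ℝ)) * eLpNorm (deriv φ') 2 (volume.restrict J)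
  | _ => eLpNorm (fun x => φ x - φ' x) 2 (volume.restrict J) +
      ENNReal.ofReal lam⁻¹ * eLpNorm (deriv (deriv φ')) 2 (volume.restrict J) +
      ENNReal.ofReal (lam ^ 2)⁻¹ * eLpNorm (fun x => ‖deriv φ' x‖ ^ 2) 2 (volume.restrict J)

/-- The part of `zetaRate` which involves the `L²` modulus of continuity only. -/
def zetaTwo (n : ℕ) (ε : ℝ) (φ : ℝ → ℂ) (J : Set ℝ) (lam : ℝ) : ℝ≥0∞ :=
  match n with
  | 0 => modulus 2 ε φ J * (1 + ENNReal.ofReal (ε⁻¹ * lam ^ (-(1 / 2) : ℝ)))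
  | _ => modulus 2 ε φ J * (1 + ENNReal.ofReal ((ε ^ 2)⁻¹ * lam⁻¹))

theorem zetaTwo_le_zetaRate (n : ℕ) (ε : ℝ) (φ : ℝ → ℂ) (J : Set ℝ) (lam : ℝ) :
    zetaTwo n ε φ J lam ≤ zetaRate n ε φ J lam := by
  rcases n with _ | n
  · exact le_rfl
  · exact le_self_add

theorem modulus_union_le (ε : ℝ) {φ : ℝ → ℂ} (J J' : Set ℝ) :
    modulus 2 ε φ (J ∪ J') ≤ modulus 2 ε φ J + modulus 2 ε φ J' := by
  refine iSup₂_le fun t ht => ?_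
  have h1 : eLpNorm (fun x => φ (x + t) - φ x) 2 (volume.restrict J) ≤ modulus 2 ε φ J :=
    le_iSup₂_of_le (f := fun t (_ : 0 < |t| ∧ |t| < ε) =>
      eLpNorm (fun x => φ (x + t) - φ x) 2 (volume.restrict J)) t ht le_rfl
  have h2 : eLpNorm (fun x => φ (x + t) - φ x) 2 (volume.restrict J') ≤ modulus 2 ε φ J' :=
    le_iSup₂_of_le (f := fun t (_ : 0 < |t| ∧ |t| < ε) =>
      eLpNorm (fun x => φ (x + t) - φ x) 2 (volume.restrict J')) t ht le_rfl
  refine le_trans ?_ (add_le_add h1 h2)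
  refine eLpNorm_two_le_of_sq_le ?_
  refine (lintegral_union_le _ _ _).trans ?_
  rw [← eLpNorm_two_sq, ← eLpNorm_two_sq, add_sq]
  gcongr
  exact le_self_add

theorem modulus_mono_set (ε : ℝ) {φ : ℝ → ℂ} {J J' : Set ℝ} (h : J ⊆ J') :
    modulus 2 ε φ J ≤ modulus 2 ε φ J' :=
  iSup₂_mono fun _ _ => eLpNorm_mono_measure _ (Measure.restrict_mono_set _ h)

theorem zetaTwo_le_of_modulus_le {n : ℕ} {ε lam : ℝ} {φ φ' : ℝ → ℂ} {J J' : Set ℝ} {c : ℝ≥0∞}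
    (h : modulus 2 ε φ J ≤ c * modulus 2 ε φ' J') :
    zetaTwo n ε φ J lam ≤ c * zetaTwo n ε φ' J' lam := by
  rcases n with _ | n
  · simp only [zetaTwo]
    rw [← mul_assoc]
    gcongr
  · simp only [zetaTwo]
    rw [← mul_assoc]
    gcongr

theorem zetaTwo_union_le (n : ℕ) (ε lam : ℝ) (φ : ℝ → ℂ) (J J' : Set ℝ) :
    zetaTwo n ε φ (J ∪ J') lam ≤ zetaTwo n ε φ J lam + zetaTwo n ε φ J' lam := by
  have := modulus_union_le ε (φ := φ) J J'
  rcases n with _ | n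
  · simp only [zetaTwo]
    rw [← add_mul]
    gcongr
  · simp only [zetaTwo]
    rw [← add_mul]
    gcongr

/-- A function supported on the right of `0` varies on the left of `0` no more than on the
right. -/
theorem modulus_leak_le {ε : ℝ} {φ : ℝ → ℂ} (σ : ℝ)
    (hσ : σ = 1 ∨ σ = -1) (h0 : ∀ x, σ * x ≤ 0 → φ x = 0) {J J' : Set ℝ}
    (hJ : ∀ x, 0 < σ * x → σ * x < ε → x ∈ J) (hJ' : ∀ x ∈ J', σ * x ≤ 0)
    (hJm : MeasurableSet J) (hJm' : MeasurableSet J') :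
    modulus 2 ε φ J' ≤ modulus 2 ε φ J := by
  refine iSup₂_le fun t ht => ?_
  refine le_trans ?_ (le_iSup₂_of_le (f := fun t (_ : 0 < |t| ∧ |t| < ε) =>
      eLpNorm (fun x => φ (x + t) - φ x) 2 (volume.restrict J)) (-t) (by rwa [abs_neg]) le_rfl)
  refine eLpNorm_two_le_of_sq_le ?_
  rw [eLpNorm_two_sq]
  have htσ : σ * t ≤ |t| := by
    rcases hσ with rfl | rfl
    · simpa using le_abs_self t
    · simpa using neg_le_abs t
  -- On J' only the shifted value survives. Substitute y = x + t: points with σy ≤ 0 contribute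
  -- nothing, the others satisfy σy < ε and lie in J. There φ(y − t) = 0, so that the integrand is
  -- the squared difference for the shift −t.
  have e1 : ∫⁻ x in J', ‖φ (x + t) - φ x‖ₑ ^ 2 =
      ∫⁻ x, J'.indicator (fun x => ‖φ (x + t)‖ₑ ^ 2) x := by
    rw [lintegral_indicator hJm']
    refine setLIntegral_congr_fun hJm' fun x hx => ?_
    simp only [h0 x (hJ' x hx), sub_zero]
  have e2 : ∫⁻ x, J'.indicator (fun x => ‖φ (x + t)‖ₑ ^ 2) x =
      ∫⁻ y, J'.indicator (fun x => ‖φ (x + t)‖ₑ ^ 2) (y - t) :=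
    (lintegral_sub_right_eq_self (fun x => J'.indicator (fun x => ‖φ (x + t)‖ₑ ^ 2) x) t).symm
  rw [e1, e2, ← lintegral_indicator hJm]
  refine lintegral_mono fun y => ?_
  by_cases hy : y - t ∈ J'
  · rw [indicator_of_mem hy, sub_add_cancel]
    by_cases hy0 : 0 < σ * y
    · have h1 := hJ' _ hy
      rw [mul_sub] at h1
      rw [indicator_of_mem (hJ y hy0 (by linarith [ht.2])), ← sub_eq_add_neg,
        h0 (y - t) (by rw [mul_sub]; linarith), zero_sub, enorm_neg]
    · rw [h0 y (not_lt.1 hy0)]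
      simp
  · rw [indicator_of_notMem hy]
    exact zero_le

/-- Nothing is lost by cutting a function off at `0` if it vanishes there. -/
theorem modulus_indicator_le {ε r : ℝ} {φ : ℝ → ℂ} (σ : ℝ)
    (hσ : σ = 1 ∨ σ = -1) {A : Set ℝ} (hA : ∀ x, x ∈ A ↔ 0 < σ * x) (hε : ε ≤ r)
    (h0 : ∀ᵐ x ∂volume, |x| < r → φ x = 0) {J : Set ℝ} (hJ : ∀ x ∈ J, 0 < σ * x)
    (hJm : MeasurableSet J) :
    modulus 2 ε (A.indicator φ) J ≤ modulus 2 ε φ J := by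
  refine iSup₂_mono fun t ht => ?_
  refine eLpNorm_mono_ae ?_
  rw [ae_restrict_iff' hJm]
  have h0' : ∀ᵐ x ∂volume, |x + t| < r → φ (x + t) = 0 :=
    (quasiMeasurePreserving_add_right volume t).ae h0
  filter_upwards [h0'] with x hx hxJ
  rw [indicator_of_mem ((hA x).2 (hJ x hxJ))]
  by_cases h : x + t ∈ A
  · rw [indicator_of_mem h]
  -- If the shift carries x over the origin, then |x + t| ≤ |t| < ε ≤ r, where φ vanishes.
  · rw [indicator_of_notMem h, hx]
    rw [hA, mul_add, not_lt] at h
    have h2 := hJ x hxJ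
    have h3 := ht.2
    rcases hσ with rfl | rfl
    · rw [abs_lt] at h3 ⊢
      constructor <;> linarith
    · rw [abs_lt] at h3 ⊢
      constructor <;> linarith

/-- The factor 2 is needed only for the squared derivative, where |a + b|² ≤ 2(|a|² + |b|²). -/
theorem pieceError_add_le (n : ℕ) {φ₁ φ₂ ψ₁ ψ₂ : ℝ → ℂ}
    (h1 : AEStronglyMeasurable φ₁ volume) (h2 : AEStronglyMeasurable φ₂ volume)
    (h1' : ContDiff ℝ ∞ ψ₁) (h2' : ContDiff ℝ ∞ ψ₂) {J : Set ℝ} (lam : ℝ) :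
    pieceError n (fun x => φ₁ x + φ₂ x) (fun x => ψ₁ x + ψ₂ x) J lam ≤
      2 * (pieceError n φ₁ ψ₁ J lam + pieceError n φ₂ ψ₂ J lam) := by
  have c1 : ContDiff ℝ ∞ (deriv ψ₁) := (contDiff_infty_iff_deriv.1 h1').2
  have c2 : ContDiff ℝ ∞ (deriv ψ₂) := (contDiff_infty_iff_deriv.1 h2').2
  have c3 : ContDiff ℝ ∞ (deriv (deriv ψ₁)) := (contDiff_infty_iff_deriv.1 c1).2
  have c4 : ContDiff ℝ ∞ (deriv (deriv ψ₂)) := (contDiff_infty_iff_deriv.1 c2).2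
  have d1 : deriv (fun x => ψ₁ x + ψ₂ x) = deriv ψ₁ + deriv ψ₂ := funext fun x =>
    deriv_add (h1'.differentiable (by simp) x) (h2'.differentiable (by simp) x)
  have d2 : deriv (deriv ψ₁ + deriv ψ₂) = deriv (deriv ψ₁) + deriv (deriv ψ₂) :=
    funext fun x => deriv_add (c1.differentiable (by simp) x) (c2.differentiable (by simp) x)
  have e0 : eLpNorm (fun x => φ₁ x + φ₂ x - (ψ₁ x + ψ₂ x)) 2 (volume.restrict J) ≤
      eLpNorm (fun x => φ₁ x - ψ₁ x) 2 (volume.restrict J) +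
      eLpNorm (fun x => φ₂ x - ψ₂ x) 2 (volume.restrict J) := by
    refine le_of_eq_of_le ?_ (eLpNorm_add_le (h1.sub h1'.continuous.aestronglyMeasurable).restrict
      (h2.sub h2'.continuous.aestronglyMeasurable).restrict (by norm_num))
    congr 1; ext x; simp only [Pi.add_apply]; ring
  have e1 := eLpNorm_add_le (μ := volume.restrict J) (p := 2) c1.continuous.aestronglyMeasurable
    c2.continuous.aestronglyMeasurable (by norm_num)
  have e2 := eLpNorm_add_le (μ := volume.restrict J) (p := 2) c3.continuous.aestronglyMeasurable
    c4.continuous.aestronglyMeasurable (by norm_num)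
  have e3 : eLpNorm (fun x => ‖(deriv ψ₁ + deriv ψ₂) x‖ ^ 2) 2 (volume.restrict J) ≤
      2 * (eLpNorm (fun x => ‖deriv ψ₁ x‖ ^ 2) 2 (volume.restrict J) +
      eLpNorm (fun x => ‖deriv ψ₂ x‖ ^ 2) 2 (volume.restrict J)) := by
    have := eLpNorm_add_le (μ := volume.restrict J) (p := 2)
      (f := fun x => ‖deriv ψ₁ x‖ ^ 2) (g := fun x => ‖deriv ψ₂ x‖ ^ 2)
      (c1.continuous.norm.pow 2).aestronglyMeasurable
      (c2.continuous.norm.pow 2).aestronglyMeasurable (by norm_num)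
    refine le_trans ?_ (mul_le_mul_right this 2)
    have h := eLpNorm_const_smul (2 : ℝ)
      ((fun x => ‖deriv ψ₁ x‖ ^ 2) + fun x => ‖deriv ψ₂ x‖ ^ 2) 2 (volume.restrict J)
    rw [show ‖(2 : ℝ)‖ₑ = 2 by simp [enorm_eq_nnnorm]] at h
    rw [← h]
    refine eLpNorm_mono fun x => ?_
    simp only [Pi.smul_apply, Pi.add_apply, smul_eq_mul]
    rw [Real.norm_of_nonneg (by positivity), Real.norm_of_nonneg (by positivity)]
    have := norm_add_le (deriv ψ₁ x) (deriv ψ₂ x)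
    nlinarith [sq_nonneg (‖deriv ψ₁ x‖ - ‖deriv ψ₂ x‖), norm_nonneg (deriv ψ₁ x + deriv ψ₂ x)]
  rcases n with _ | n
  · simp only [pieceError, d1]
    generalize ENNReal.ofReal (lam ^ (-(1 / 2) : ℝ)) = c
    calc _ ≤ (eLpNorm (fun x => φ₁ x - ψ₁ x) 2 (volume.restrict J) +
          eLpNorm (fun x => φ₂ x - ψ₂ x) 2 (volume.restrict J)) + c *
          (eLpNorm (deriv ψ₁) 2 (volume.restrict J) + eLpNorm (deriv ψ₂) 2 (volume.restrict J)) := by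
          gcongr
      _ = 1 * ((eLpNorm (fun x => φ₁ x - ψ₁ x) 2 (volume.restrict J) +
          c * eLpNorm (deriv ψ₁) 2 (volume.restrict J)) +
          (eLpNorm (fun x => φ₂ x - ψ₂ x) 2 (volume.restrict J) +
          c * eLpNorm (deriv ψ₂) 2 (volume.restrict J))) := by ring
      _ ≤ _ := by
          gcongr
          norm_num
  · simp only [pieceError, d1, d2]
    generalize ENNReal.ofReal lam⁻¹ = c
    generalize ENNReal.ofReal (lam ^ 2)⁻¹ = c'
    have two : (1 : ℝ≥0∞) ≤ 2 := by norm_num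
    calc _ ≤ 1 * (eLpNorm (fun x => φ₁ x - ψ₁ x) 2 (volume.restrict J) +
          eLpNorm (fun x => φ₂ x - ψ₂ x) 2 (volume.restrict J)) + 1 * (c *
          (eLpNorm (deriv (deriv ψ₁)) 2 (volume.restrict J) +
            eLpNorm (deriv (deriv ψ₂)) 2 (volume.restrict J))) + c' *
          (2 * (eLpNorm (fun x => ‖deriv ψ₁ x‖ ^ 2) 2 (volume.restrict J) +
            eLpNorm (fun x => ‖deriv ψ₂ x‖ ^ 2) 2 (volume.restrict J))) := by
          rw [one_mul, one_mul]
          gcongr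
      _ ≤ 2 * (eLpNorm (fun x => φ₁ x - ψ₁ x) 2 (volume.restrict J) +
          eLpNorm (fun x => φ₂ x - ψ₂ x) 2 (volume.restrict J)) + 2 * (c *
          (eLpNorm (deriv (deriv ψ₁)) 2 (volume.restrict J) +
            eLpNorm (deriv (deriv ψ₂)) 2 (volume.restrict J))) + c' *
          (2 * (eLpNorm (fun x => ‖deriv ψ₁ x‖ ^ 2) 2 (volume.restrict J) +
            eLpNorm (fun x => ‖deriv ψ₂ x‖ ^ 2) 2 (volume.restrict J))) := by gcongr
      _ = _ := by ring

theorem pieceError_congr (n : ℕ) {φ₁ φ₂ ψ₁ ψ₂ : ℝ → ℂ} (h : φ₁ =ᵐ[volume] φ₂) (h' : ψ₁ = ψ₂)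
    {J : Set ℝ} {lam : ℝ} : pieceError n φ₁ ψ₁ J lam = pieceError n φ₂ ψ₂ J lam := by
  subst h'
  have : eLpNorm (fun x => φ₁ x - ψ₁ x) 2 (volume.restrict J) =
      eLpNorm (fun x => φ₂ x - ψ₁ x) 2 (volume.restrict J) := by
    refine eLpNorm_congr_ae (ae_restrict_of_ae ?_)
    filter_upwards [h] with x hx
    rw [hx]
  rcases n with _ | n <;> simp only [pieceError, this]

/-- The pointwise bound trades one of the two factors in λ^{-2}|(φ^ε)'|² for Mλ/ε. The remaining
factor is at most a constant times ε^{-1} times the L² modulus, so the quadratic term is no larger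
than the term with the second derivative and no L⁴ modulus is needed. The constant does not depend
on the scale, the function or the set. -/
theorem exists_pieceError_mollify_le {w : ℝ → ℝ} (hw : IsMollifier w) (n : ℕ) {M : ℝ}
    (hM : 0 ≤ M) : ∃ C : ℝ≥0, ∀ (ε lam : ℝ) (φ : ℝ → ℂ) (J : Set ℝ), 0 < ε → 0 < lam →
      LocallyIntegrable φ volume → MeasurableSet J →
      (∀ x ∈ J, ‖deriv (mollify w ε φ) x‖ ≤ M * lam / ε) →
      pieceError n φ (mollify w ε φ) J lam ≤ C * zetaTwo n ε φ J lam := by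
  obtain ⟨B, hB0, hB⟩ := hw.exists_bound
  refine ⟨(2 * B * (1 + M)).toNNReal, fun ε lam φ J hε hlam hφ hJ hbd => ?_⟩
  rw [ENNReal.ofNNReal_toNNReal]
  have h0 := eLpNorm_sub_mollify_le hw hB hε hφ J
  have h1 := eLpNorm_mollifyDeriv_succ_le hw hB hε hφ J (j := 0) (by norm_num)
  have h2 := eLpNorm_mollifyDeriv_succ_le hw hB hε hφ J (j := 1) (by norm_num)
  rw [zero_add] at h1
  rw [one_add_one_eq_two] at h2
  have hd1 := deriv_mollify hw hε hφ
  have hd2 := deriv_deriv_mollify hw hε hφ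
  set m := modulus 2 ε φ J
  rcases n with _ | n
  · simp only [pieceError, zetaTwo, hd1]
    have hl : 0 ≤ lam ^ (-(1 / 2) : ℝ) := Real.rpow_nonneg hlam.le _
    calc _ ≤ ENNReal.ofReal (2 * B) * m + ENNReal.ofReal (lam ^ (-(1 / 2) : ℝ)) *
          (ENNReal.ofReal (2 * B * (ε ^ 1)⁻¹) * m) := by gcongr
      _ = ENNReal.ofReal (2 * B) * (m * (1 + ENNReal.ofReal (ε⁻¹ * lam ^ (-(1 / 2) : ℝ)))) := by
          rw [ENNReal.ofReal_mul (p := 2 * B) (by positivity), pow_one,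
            ENNReal.ofReal_mul (p := ε⁻¹) (by positivity)]
          ring
      _ ≤ _ := by
          gcongr ENNReal.ofReal ?_ * _
          nlinarith
  · simp only [pieceError, zetaTwo, hd2]
    have h3 : eLpNorm (fun x => ‖deriv (mollify w ε φ) x‖ ^ 2) 2 (volume.restrict J) ≤
        ENNReal.ofReal (M * lam / ε) * eLpNorm (mollifyDeriv w ε 1 φ) 2 (volume.restrict J) := by
      have h := eLpNorm_const_smul (M * lam / ε) (mollifyDeriv w ε 1 φ) 2 (volume.restrict J)
      rw [Real.enorm_eq_ofReal (by positivity)] at h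
      rw [← h]
      refine eLpNorm_mono_ae ?_
      rw [ae_restrict_iff' hJ]
      refine Eventually.of_forall fun x hx => ?_
      rw [Pi.smul_apply, norm_smul, Real.norm_of_nonneg (by positivity),
        Real.norm_of_nonneg (by positivity), ← hd1, sq]
      exact mul_le_mul_of_nonneg_right (hbd x hx) (norm_nonneg _)
    calc _ ≤ ENNReal.ofReal (2 * B) * m + ENNReal.ofReal lam⁻¹ *
          (ENNReal.ofReal (2 * B * (ε ^ 2)⁻¹) * m) + ENNReal.ofReal (lam ^ 2)⁻¹ *
          (ENNReal.ofReal (M * lam / ε) * (ENNReal.ofReal (2 * B * (ε ^ 1)⁻¹) * m)) := by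
          gcongr
          exact h3.trans (by gcongr)
      _ = ENNReal.ofReal (2 * B) * m + ENNReal.ofReal (2 * B) * m *
          ENNReal.ofReal ((ε ^ 2)⁻¹ * lam⁻¹) * (1 + ENNReal.ofReal M) := by
          rw [ENNReal.ofReal_mul (p := 2 * B) (by positivity),
            ENNReal.ofReal_mul (p := 2 * B) (by positivity),
            ENNReal.ofReal_mul (p := (ε ^ 2)⁻¹) (by positivity)]
          have : ENNReal.ofReal (lam ^ 2)⁻¹ * (ENNReal.ofReal (M * lam / ε) *
              (ENNReal.ofReal (2 * B) * ENNReal.ofReal (ε ^ 1)⁻¹ * m)) =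
              (ENNReal.ofReal (lam ^ 2)⁻¹ * ENNReal.ofReal (M * lam / ε) *
                ENNReal.ofReal (ε ^ 1)⁻¹) * (ENNReal.ofReal (2 * B) * m) := by ring
          have h4 : ENNReal.ofReal (lam ^ 2)⁻¹ * ENNReal.ofReal (M * lam / ε) *
              ENNReal.ofReal (ε ^ 1)⁻¹ =
              ENNReal.ofReal (ε ^ 2)⁻¹ * ENNReal.ofReal lam⁻¹ * ENNReal.ofReal M := by
            have p1 : 0 ≤ (lam ^ 2)⁻¹ := by positivity
            have p2 : 0 ≤ (lam ^ 2)⁻¹ * (M * lam / ε) := by positivity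
            have p3 : 0 ≤ (ε ^ 2)⁻¹ := by positivity
            have p4 : 0 ≤ (ε ^ 2)⁻¹ * lam⁻¹ := by positivity
            rw [← ENNReal.ofReal_mul p1, ← ENNReal.ofReal_mul p2, ← ENNReal.ofReal_mul p3,
              ← ENNReal.ofReal_mul p4]
            congr 1
            field_simp
          rw [this, h4]
          ring
      _ ≤ ENNReal.ofReal (2 * B) * (1 + ENNReal.ofReal M) * m + ENNReal.ofReal (2 * B) * m *
          ENNReal.ofReal ((ε ^ 2)⁻¹ * lam⁻¹) * (1 + ENNReal.ofReal M) := by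
          gcongr
          exact le_mul_of_one_le_right zero_le le_self_add
      _ = _ := by
          rw [ENNReal.ofReal_mul (p := 2 * B) (by positivity),
            ENNReal.ofReal_add zero_le_one hM, ENNReal.ofReal_one]
          ring


/-! ### The bracket and the two ends of the line. -/

theorem one_le_bracket (x : ℝ) : 1 ≤ bracket x :=
  Real.one_le_sqrt.2 (by nlinarith [sq_nonneg x])

theorem bracket_pos (x : ℝ) : 0 < bracket x := one_pos.trans_le (one_le_bracket x)

theorem continuous_bracket : Continuous bracket := by
  unfold bracket; fun_prop

theorem abs_le_bracket (x : ℝ) : |x| ≤ bracket x := by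
  rw [bracket, ← Real.sqrt_sq_eq_abs]
  exact Real.sqrt_le_sqrt (by linarith)

theorem bracket_le_two_mul {x : ℝ} (hx : 1 ≤ x) : bracket x ≤ 2 * x := by
  rw [bracket, Real.sqrt_le_left (by linarith)]
  nlinarith

theorem bracket_le_two_mul_bracket {x y : ℝ} (h : |x - y| ≤ 1) : bracket x ≤ 2 * bracket y := by
  rw [bracket, Real.sqrt_le_left (by linarith [bracket_pos y]), mul_pow, bracket,
    Real.sq_sqrt (by positivity)]
  have := (sq_le_one_iff_abs_le_one _).2 h
  nlinarith [sq_nonneg (x - y - y)]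

theorem rpow_le_two_rpow_mul_rpow {a b : ℝ} (ha : 0 < a) (hb : 0 < b) (h1 : a ≤ 2 * b)
    (h2 : b ≤ 2 * a) (q : ℝ) : a ^ q ≤ 2 ^ |q| * b ^ q := by
  rcases le_total 0 q with hq | hq
  · rw [abs_of_nonneg hq, ← Real.mul_rpow zero_le_two hb.le]
    exact Real.rpow_le_rpow ha.le h1 hq
  · rw [abs_of_nonpos hq, Real.rpow_neg zero_le_two, ← Real.inv_rpow zero_le_two,
      ← Real.mul_rpow (by norm_num) hb.le]
    exact Real.rpow_le_rpow_of_nonpos (by positivity) (by linarith) hq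

theorem bracket_neg (x : ℝ) : bracket (-x) = bracket x := by simp [bracket]

theorem Side.sgn_mul_sgn (s : Side) : s.sgn * s.sgn = 1 := by cases s <;> norm_num [Side.sgn]

theorem Side.sgn_eq (s : Side) : s.sgn = 1 ∨ s.sgn = -1 := by cases s <;> simp [Side.sgn]

theorem Side.abs_sgn (s : Side) : |s.sgn| = 1 := by cases s <;> simp [Side.sgn]

theorem Side.sgn_mul_sgn_mul (s : Side) (x : ℝ) : s.sgn * (s.sgn * x) = x := by
  rw [← mul_assoc, s.sgn_mul_sgn, one_mul]

theorem bracket_sgn_mul (s : Side) (x : ℝ) : bracket (s.sgn * x) = bracket x := by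
  cases s <;> simp [Side.sgn, bracket_neg]

theorem Side.mem_halfLine (s : Side) {x : ℝ} : x ∈ s.halfLine ↔ 0 < s.sgn * x := by
  cases s <;> simp [Side.sgn, Side.halfLine]

theorem Side.abs_eq_of_mem (s : Side) {x : ℝ} (h : 0 ≤ s.sgn * x) : |x| = s.sgn * x := by
  rw [← abs_of_nonneg h, abs_mul, s.abs_sgn, one_mul]

theorem Side.measurableSet_halfLine (s : Side) : MeasurableSet s.halfLine := by
  cases s
  · exact measurableSet_Iio
  · exact measurableSet_Ioi

theorem Side.eventually_atEnd (s : Side) {P : ℝ → Prop} (h : ∀ᶠ x in s.atEnd, P x) :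
    ∃ R : ℝ, 1 ≤ R ∧ ∀ d, R ≤ d → P (s.sgn * d) := by
  cases s
  · obtain ⟨a, ha⟩ := (eventually_atBot.1 h)
    refine ⟨max 1 (-a), le_max_left _ _, fun d hd => ha _ ?_⟩
    simp only [Side.sgn]
    linarith [(le_max_right 1 (-a)).trans hd]
  · obtain ⟨a, ha⟩ := (eventually_atTop.1 h)
    refine ⟨max 1 a, le_max_left _ _, fun d hd => ha _ ?_⟩
    simp only [Side.sgn]
    linarith [(le_max_right 1 a).trans hd]

theorem Side.eventually_atEnd_ae (s : Side) {P : ℝ → Prop}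
    (h : ∀ᶠ x in s.atEnd ⊓ ae volume, P x) :
    ∃ R : ℝ, 1 ≤ R ∧ ∀ᵐ x ∂volume, R ≤ s.sgn * x → P x := by
  obtain ⟨p, hp, q, hq, hpq⟩ := eventually_inf.1 h
  obtain ⟨R, hR, hR'⟩ := s.eventually_atEnd (P := fun x => x ∈ p) hp
  refine ⟨R, hR, ?_⟩
  filter_upwards [hq] with x hx hRx
  refine hpq x ⟨?_, hx⟩
  have := hR' _ hRx
  rwa [s.sgn_mul_sgn_mul] at this

theorem Side.ae_sgn_mul (s : Side) {P : ℝ → Prop} (h : ∀ᵐ x ∂volume, P x) :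
    ∀ᵐ x ∂volume, P (s.sgn * x) := by
  cases s
  · simp only [Side.sgn, neg_mul, one_mul]
    exact (Measure.measurePreserving_neg volume).quasiMeasurePreserving.ae h
  · simpa [Side.sgn] using h

/-! ### Slow variation of V at the ends. -/

/-- A function whose logarithmic derivative is controlled by `C ⟨x⟩^ν`. -/
theorem abs_log_norm_sub_le {y : ℝ → ℂ} (hy : LocallyLipschitz y) {R C ν : ℝ}
    (h0 : ∀ d, R ≤ d → y d ≠ 0)
    (hd : ∀ᵐ d ∂volume, R ≤ d → ‖deriv y d‖ ≤ C * (‖y d‖ * bracket d ^ ν)) {a b : ℝ}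
    (ha : R ≤ a) (hab : a ≤ b) :
    |Real.log ‖y b‖ - Real.log ‖y a‖| ≤ C * ∫ t in a..b, bracket t ^ ν := by
  have hRx : ∀ x ∈ uIcc a b, R ≤ x := fun x hx => by
    rw [uIcc_of_le hab] at hx; exact ha.trans hx.1
  -- The squared norm is used because it is smooth and its derivative is an inner product; the
  -- factors 2 cancel at the end.
  have hcl : ∀ x ∈ uIcc a b, LipAt (fun d => ((Real.log (‖y d‖ ^ 2) : ℝ) : ℂ)) x := by
    intro x hx
    refine LipAt.comp_contDiffAt (f := y) (F := fun z : ℂ => ((Real.log (‖z‖ ^ 2) : ℝ) : ℂ)) ?_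
      (hy x)
    refine Complex.ofRealCLM.contDiff.contDiffAt.comp _ (ContDiffAt.log ?_ ?_)
    · exact (contDiff_norm_sq ℝ).contDiffAt
    · exact pow_ne_zero _ (norm_ne_zero_iff.2 (h0 x (hRx x hx)))
  have hder : ∀ᵐ x ∂volume, x ∈ uIcc a b →
      HasDerivAt (fun d => ((Real.log (‖y d‖ ^ 2) : ℝ) : ℂ))
        (((2 * inner ℝ (y x) (deriv y x) / ‖y x‖ ^ 2 : ℝ)) : ℂ) x := by
    filter_upwards [hasDerivAt_ae_of_locallyLipschitz hy] with x hx hxI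
    exact ((hx.norm_sq).log (pow_ne_zero _ (norm_ne_zero_iff.2 (h0 x (hRx x hxI))))).ofReal_comp
  have hI := integral_eq_sub_of_lipAt hcl hder
  have hb : ‖∫ x in a..b, (((2 * inner ℝ (y x) (deriv y x) / ‖y x‖ ^ 2 : ℝ)) : ℂ)‖ ≤
      ∫ t in a..b, 2 * (C * bracket t ^ ν) := by
    refine intervalIntegral.norm_integral_le_of_norm_le hab ?_ ?_
    · filter_upwards [hd] with x hx hxI
      have hRx' : R ≤ x := ha.trans hxI.1.le
      have hpos : 0 < ‖y x‖ := norm_pos_iff.2 (h0 x hRx')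
      rw [Complex.norm_real, Real.norm_eq_abs, abs_div, abs_mul, abs_two, abs_of_pos (pow_pos hpos 2),
        div_le_iff₀ (pow_pos hpos 2)]
      have h1 := abs_real_inner_le_norm (y x) (deriv y x)
      have h2 := hx hRx'
      calc 2 * |inner ℝ (y x) (deriv y x)| ≤ 2 * (‖y x‖ * (C * (‖y x‖ * bracket x ^ ν))) := by
            gcongr
            exact h1.trans (mul_le_mul_of_nonneg_left h2 hpos.le)
        _ = _ := by ring
    · refine Continuous.intervalIntegrable ?_ _ _
      exact continuous_const.mul (continuous_const.mul
        (continuous_bracket.rpow_const fun x => Or.inl (bracket_pos x).ne'))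
  rw [hI, ← Complex.ofReal_sub, Complex.norm_real, Real.norm_eq_abs, Real.log_pow, Real.log_pow,
    ← mul_sub, abs_mul, intervalIntegral.integral_const_mul,
    intervalIntegral.integral_const_mul] at hb
  norm_num at hb
  exact hb

theorem intervalIntegrable_bracket_rpow (ν a b : ℝ) :
    IntervalIntegrable (fun t => bracket t ^ ν) volume a b :=
  (continuous_bracket.rpow_const fun x => Or.inl (bracket_pos x).ne').intervalIntegrable _ _

theorem bracket_rpow_le_one {ν : ℝ} (hν : ν ≤ 0) (x : ℝ) : bracket x ^ ν ≤ 1 :=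
  Real.rpow_le_one_of_one_le_of_nonpos (one_le_bracket x) hν

theorem bracket_rpow_le_rpow {ν x : ℝ} (hν : ν ≤ 0) (hx : 0 < x) : bracket x ^ ν ≤ x ^ ν :=
  Real.rpow_le_rpow_of_nonpos hx ((le_abs_self x).trans (abs_le_bracket x)) hν

theorem integral_bracket_rpow_le {ν a b K : ℝ} (hab : a ≤ b)
    (h : ∀ x, a ≤ x → x ≤ b → bracket x ^ ν ≤ K) :
    ∫ t in a..b, bracket t ^ ν ≤ K * (b - a) := by
  have := intervalIntegral.integral_mono_on hab (intervalIntegrable_bracket_rpow ν a b)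
    (intervalIntegrable_const (c := K)) (fun x hx => h x hx.1 hx.2)
  rw [intervalIntegral.integral_const, smul_eq_mul] at this
  linarith

/-- The auxiliary exponent μ > −1 covers the borderline ν = −1, where the integral itself grows
logarithmically. -/
theorem integral_bracket_rpow_le_rpow {ν μ a b : ℝ} (hν : ν ≤ 0) (hμ : ν ≤ μ) (hμ1 : -1 < μ)
    (ha : 1 ≤ a) (hab : a ≤ b) : ∫ t in a..b, bracket t ^ ν ≤ b ^ (μ + 1) / (μ + 1) := by
  have h0 : (0 : ℝ) ∉ uIcc a b := by
    rw [uIcc_of_le hab]; intro h; linarith [h.1]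
  have h1 := intervalIntegral.integral_mono_on hab (intervalIntegrable_bracket_rpow ν a b)
    (intervalIntegral.intervalIntegrable_rpow (Or.inr h0) (r := μ)) (fun x hx =>
      (bracket_rpow_le_rpow hν (by linarith [hx.1])).trans
        (Real.rpow_le_rpow_of_exponent_le (by linarith [hx.1]) hμ))
  rw [integral_rpow (Or.inl hμ1)] at h1
  refine h1.trans ?_
  have : 0 ≤ a ^ (μ + 1) := by positivity
  have h2 : 0 < μ + 1 := by linarith
  gcongr
  linarith

theorem integral_bracket_rpow_le_const {ν a b : ℝ} (hν : ν < -1)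
    (ha : 1 ≤ a) (hab : a ≤ b) : ∫ t in a..b, bracket t ^ ν ≤ 1 / (-ν - 1) := by
  have h0 : (0 : ℝ) ∉ uIcc a b := by
    rw [uIcc_of_le hab]; intro h; linarith [h.1]
  have h1 := intervalIntegral.integral_mono_on hab (intervalIntegrable_bracket_rpow ν a b)
    (intervalIntegral.intervalIntegrable_rpow (Or.inr h0) (r := ν)) (fun x hx =>
      (bracket_rpow_le_rpow (by linarith) (by linarith [hx.1])))
  rw [integral_rpow (Or.inr ⟨by linarith, h0⟩)] at h1
  refine h1.trans ?_
  have hb : 0 ≤ b ^ (ν + 1) := Real.rpow_nonneg (by linarith) _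
  have ha' : a ^ (ν + 1) ≤ 1 := Real.rpow_le_one_of_one_le_of_nonpos ha (by linarith)
  rw [← neg_div_neg_eq, show -(ν + 1) = -ν - 1 by ring]
  have h2 : 0 < -ν - 1 := by linarith
  gcongr
  linarith


section Ends

variable {N : ℕ} {ν : Side → ℝ} {ε₁ : ℝ} {V : ℝ → ℂ}

theorem RegularPotential.exists_im_ge (hV : RegularPotential N ν ε₁ V) (s : Side) :
    ∃ R c : ℝ, 1 ≤ R ∧ 0 < c ∧ ∀ d, R ≤ d → c ≤ s.sgn * (V (s.sgn * d)).im := by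
  cases s
  · obtain ⟨r, h1, h2⟩ := EReal.lt_iff_exists_real_btwn.1 hV.limsup_neg
    obtain ⟨R, hR, h⟩ := Side.minus.eventually_atEnd (eventually_lt_of_limsup_lt h1)
    refine ⟨R, -r, hR, ?_, fun d hd => ?_⟩
    · have : r < 0 := by exact_mod_cast h2
      linarith
    · have : (V (Side.minus.sgn * d)).im < r := by exact_mod_cast h d hd
      simp only [Side.sgn] at this ⊢
      linarith
  · obtain ⟨r, h1, h2⟩ := EReal.lt_iff_exists_real_btwn.1 hV.liminf_pos
    obtain ⟨R, hR, h⟩ := Side.plus.eventually_atEnd (eventually_lt_of_lt_liminf h2)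
    refine ⟨R, r, hR, by exact_mod_cast h1, fun d hd => ?_⟩
    have : r < (V (Side.plus.sgn * d)).im := by exact_mod_cast h d hd
    simp only [Side.sgn, one_mul] at this ⊢
    linarith

theorem deriv_comp_sgn (f : ℝ → ℂ) (s : Side) (d : ℝ) :
    deriv (fun d => f (s.sgn * d)) d = s.sgn • deriv f (s.sgn * d) :=
  deriv_comp_mul_left s.sgn f d

theorem locallyLipschitz_comp_sgn {f : ℝ → ℂ} (hf : LocallyLipschitz f) (s : Side) :
    LocallyLipschitz fun d => f (s.sgn * d) :=
  LocallyLipschitz.comp (f := f) (g := fun d => s.sgn * d) hf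
    (ContDiff.locallyLipschitz (𝕂 := ℝ) (contDiff_const.mul contDiff_id))

theorem deriv_im_ofReal {f : ℝ → ℂ} {x : ℝ} (hf : DifferentiableAt ℝ f x) :
    deriv (fun y => (((f y).im : ℝ) : ℂ)) x = ((deriv f x).im : ℝ) :=
  ((Complex.imCLM.hasFDerivAt.comp_hasDerivAt x hf.hasDerivAt).ofReal_comp).deriv

/-- The assumptions on V' say that the logarithmic derivatives of Im V and of V are O(⟨x⟩^ν); they
are integrated here. Beyond R neither function vanishes, by the sign condition on Im V. -/
theorem RegularPotential.exists_log_lipschitz (hV : RegularPotential N ν ε₁ V) (hN : 1 ≤ N)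
    (s : Side) : ∃ R C : ℝ, 1 ≤ R ∧ 0 ≤ C ∧ ∀ a b, R ≤ a → a ≤ b →
      |Real.log |(V (s.sgn * b)).im| - Real.log (|(V (s.sgn * a)).im|)| ≤
        C * ∫ t in a..b, bracket t ^ ν s ∧
      |Real.log ‖V (s.sgn * b)‖ - Real.log ‖V (s.sgn * a)‖| ≤
        C * ∫ t in a..b, bracket t ^ ν s := by
  obtain ⟨hL, hb⟩ := hV.lipschitz_and_bounds hN
  obtain ⟨h1, h2⟩ := hb s
  obtain ⟨C1, hC1⟩ := h1.bound
  obtain ⟨C2, hC2⟩ := h2.bound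
  obtain ⟨R1, hR1, hR1'⟩ := s.eventually_atEnd_ae hC1
  obtain ⟨R2, hR2, hR2'⟩ := s.eventually_atEnd_ae hC2
  obtain ⟨R3, c, hR3, hc, hR3'⟩ := hV.exists_im_ge s
  have him0 : ∀ d, R3 ≤ d → (V (s.sgn * d)).im ≠ 0 := fun d hd h => by
    have := hR3' d hd
    rw [h] at this; simp at this; linarith
  set R := max R1 (max R2 R3)
  have hRR1 : R1 ≤ R := le_max_left _ _
  have hRR2 : R2 ≤ R := (le_max_left _ _).trans (le_max_right _ _)
  have hRR3 : R3 ≤ R := (le_max_right _ _).trans (le_max_right _ _)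
  have hbr : ∀ x, ‖bracket x ^ ν s‖ = bracket x ^ ν s := fun x =>
    Real.norm_of_nonneg (Real.rpow_nonneg (bracket_pos x).le _)
  refine ⟨R, max 0 (max C1 C2), hR1.trans hRR1, le_max_left _ _, fun a b ha hab => ⟨?_, ?_⟩⟩
  · have hl : LocallyLipschitz fun d => (((V (s.sgn * d)).im : ℝ) : ℂ) := by
      refine LocallyLipschitz.comp (f := fun z : ℂ => ((z.im : ℝ) : ℂ))
        (ContDiff.locallyLipschitz (𝕂 := ℝ) ?_) (locallyLipschitz_comp_sgn hL s)
      exact Complex.ofRealCLM.contDiff.comp Complex.imCLM.contDiff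
    have := abs_log_norm_sub_le hl (R := R) (C := C1) (ν := ν s)
      (fun d hd => Complex.ofReal_ne_zero.2 (him0 d (hRR3.trans hd))) ?_ ha hab
    · simp only [Complex.norm_real, Real.norm_eq_abs] at this
      refine this.trans ?_
      gcongr
      · exact intervalIntegral.integral_nonneg hab fun x _ => Real.rpow_nonneg (bracket_pos x).le _
      · exact (le_max_left _ _).trans (le_max_right _ _)
    · have hdiff := s.ae_sgn_mul (hasDerivAt_ae_of_locallyLipschitz hL)
      filter_upwards [s.ae_sgn_mul hR1', hdiff] with d hd hdd hRd
      have h3 := hd (by rw [s.sgn_mul_sgn_mul]; exact hRR1.trans hRd)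
      have e : deriv (fun d => (((V (s.sgn * d)).im : ℝ) : ℂ)) d =
          s.sgn • (((deriv V (s.sgn * d)).im : ℝ) : ℂ) := by
        rw [← deriv_im_ofReal hdd.differentiableAt]
        exact deriv_comp_sgn (fun x => (((V x).im : ℝ) : ℂ)) s d
      rw [e, norm_smul, Real.norm_eq_abs, s.abs_sgn, one_mul, Complex.norm_real,
        Complex.norm_real]
      rwa [norm_mul, hbr, bracket_sgn_mul] at h3
  · have := abs_log_norm_sub_le (locallyLipschitz_comp_sgn hL s) (R := R) (C := C2) (ν := ν s)
      (fun d hd h => him0 d (hRR3.trans hd) (by rw [h]; rfl)) ?_ ha hab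
    · refine this.trans ?_
      gcongr
      · exact intervalIntegral.integral_nonneg hab fun x _ => Real.rpow_nonneg (bracket_pos x).le _
      · exact (le_max_right _ _).trans (le_max_right _ _)
    · filter_upwards [s.ae_sgn_mul hR2'] with d hd hRd
      have h3 := hd (by rw [s.sgn_mul_sgn_mul]; exact hRR2.trans hRd)
      rw [deriv_comp_sgn, norm_smul, Real.norm_eq_abs, s.abs_sgn, one_mul]
      rwa [norm_mul, hbr, bracket_sgn_mul, norm_norm] at h3

theorem le_exp_mul_of_abs_log_sub_le {x y t : ℝ} (hx : 0 < x) (hy : 0 < y)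
    (h : |Real.log x - Real.log y| ≤ t) : x ≤ Real.exp t * y := by
  have h1 : Real.log x ≤ t + Real.log y := by linarith [le_abs_self (Real.log x - Real.log y)]
  calc x = Real.exp (Real.log x) := (Real.exp_log hx).symm
    _ ≤ Real.exp (t + Real.log y) := Real.exp_le_exp.2 h1
    _ = _ := by rw [Real.exp_add, Real.exp_log hy]

/-- `Im V` varies slowly near the end `s`. -/
theorem RegularPotential.exists_im_le (hV : RegularPotential N ν ε₁ V) (hN : 1 ≤ N)
    (hν : ∀ s, ν s < 0) (s : Side) : ∃ R C c : ℝ, 1 ≤ R ∧ 0 ≤ C ∧ 0 < c ∧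
      (∀ d, R ≤ d → c ≤ s.sgn * (V (s.sgn * d)).im) ∧
      (∀ a b K, R ≤ a → R ≤ b → (∀ x, min a b ≤ x → x ≤ max a b → bracket x ^ ν s ≤ K) →
        |(V (s.sgn * b)).im| ≤ Real.exp (C * (K * |b - a|)) * |(V (s.sgn * a)).im|) ∧
      (∀ a b, R ≤ a → R ≤ b →
        |(V (s.sgn * b)).im| ≤ Real.exp (C * |b - a|) * |(V (s.sgn * a)).im|) ∧
      (∀ μ a b, ν s ≤ μ → -1 < μ → R ≤ a → a ≤ b →
        |(V (s.sgn * b)).im| ≤ Real.exp (C * (b ^ (μ + 1) / (μ + 1))) * |(V (s.sgn * a)).im|) ∧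
      (ν s < -1 → ∀ a b, R ≤ a → a ≤ b →
        ‖V (s.sgn * b)‖ ≤ Real.exp (C * (1 / (-ν s - 1))) * ‖V (s.sgn * a)‖) := by
  obtain ⟨R1, c, hR1, hc, hR1'⟩ := hV.exists_im_ge s
  obtain ⟨R2, C, hR2, hC, hR2'⟩ := hV.exists_log_lipschitz hN s
  set R := max R1 R2
  have hRR1 : R1 ≤ R := le_max_left _ _
  have hRR2 : R2 ≤ R := le_max_right _ _
  have hpos : ∀ d, R ≤ d → 0 < |(V (s.sgn * d)).im| := fun d hd => by
    rw [abs_pos]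
    intro h
    have := hR1' d (hRR1.trans hd)
    rw [h] at this; simp at this; linarith
  have hposn : ∀ d, R ≤ d → 0 < ‖V (s.sgn * d)‖ := fun d hd =>
    (hpos d hd).trans_le (Complex.abs_im_le_norm _)
  have key : ∀ a b K, R ≤ a → R ≤ b →
      (∀ x, min a b ≤ x → x ≤ max a b → bracket x ^ ν s ≤ K) →
      |(V (s.sgn * b)).im| ≤ Real.exp (C * (K * |b - a|)) * |(V (s.sgn * a)).im| := by
    intro a b K ha hb hK
    refine le_exp_mul_of_abs_log_sub_le (hpos b hb) (hpos a ha) ?_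
    rcases le_total a b with hab | hab
    · refine ((hR2' a b (hRR2.trans ha) hab).1).trans ?_
      rw [min_eq_left hab, max_eq_right hab] at hK
      gcongr
      rw [abs_of_nonneg (by linarith)]
      exact integral_bracket_rpow_le hab hK
    · rw [abs_sub_comm (Real.log _)]
      refine ((hR2' b a (hRR2.trans hb) hab).1).trans ?_
      rw [min_eq_right hab, max_eq_left hab] at hK
      gcongr
      rw [abs_sub_comm, abs_of_nonneg (by linarith)]
      exact integral_bracket_rpow_le hab hK
  -- The further forms come from three estimates of the weight integral: by the length of the
  -- interval, by the primitive of t^μ, and by a constant when ν < −1.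
  refine ⟨R, C, c, hR1.trans hRR1, hC, hc, fun d hd => hR1' d (hRR1.trans hd), key, ?_, ?_, ?_⟩
  · intro a b ha hb
    have := key a b 1 ha hb fun x _ _ => bracket_rpow_le_one (hν s).le x
    rwa [one_mul] at this
  · intro μ a b h1 h2 ha hab
    refine le_exp_mul_of_abs_log_sub_le (hpos b (ha.trans hab)) (hpos a ha)
      (((hR2' a b (hRR2.trans ha) hab).1).trans ?_)
    gcongr
    exact integral_bracket_rpow_le_rpow (hν s).le h1 h2 ((hR1.trans hRR1).trans ha) hab
  · intro h1 a b ha hab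
    refine le_exp_mul_of_abs_log_sub_le (hposn b (ha.trans hab)) (hposn a ha)
      (((hR2' a b (hRR2.trans ha) hab).2).trans ?_)
    gcongr
    exact integral_bracket_rpow_le_const h1 ((hR1.trans hRR1).trans ha) hab

/-- For ν < −1 the weight is integrable at infinity, so log |V| stays bounded. Consequently an
unbounded end has ν ≥ −1, which is what keeps the cut-off width below a quarter of the radius. -/
theorem RegularPotential.boundedAt_of_lt (hV : RegularPotential N ν ε₁ V) (hN : 1 ≤ N)
    (hν : ∀ s, ν s < 0) {s : Side} (h : ν s < -1) : BoundedAt V s := by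
  obtain ⟨R, C, c, hR, hC, hc, -, -, -, -, hb⟩ := hV.exists_im_le hN hν s
  refine ⟨Real.exp (C * (1 / (-ν s - 1))) * ‖V (s.sgn * R)‖, ?_⟩
  · have h1 := hb h R
    cases s
    · filter_upwards [eventually_le_atBot (-R)] with x hx
      have := h1 (-x) le_rfl (by linarith)
      simpa [Side.sgn] using this
    · filter_upwards [eventually_ge_atTop R] with x hx
      have := h1 x le_rfl hx
      simpa [Side.sgn] using this

/-- The function whose level set defines the radius of the cut-off at an unbounded end. -/
def levelFun (ν : Side → ℝ) (ε₁ : ℝ) (V : ℝ → ℂ) (s : Side) (d : ℝ) : ℝ :=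
  |(V (s.sgn * d)).im| ^ 2 / bracket d ^ (4 * ν s + 2 * ε₁ + 2)

theorem continuous_levelFun (hV : Continuous V) (s : Side) :
    Continuous (levelFun ν ε₁ V s) := by
  refine Continuous.div ?_ ?_ fun x => (Real.rpow_pos_of_pos (bracket_pos x) _).ne'
  · have : Continuous fun d : ℝ => (V (s.sgn * d)).im :=
      Complex.continuous_im.comp (hV.comp (continuous_const.mul continuous_id))
    exact this.abs.pow 2
  · exact continuous_bracket.rpow_const fun x => Or.inl (bracket_pos x).ne'

theorem levelFun_nonneg (s : Side) (d : ℝ) : 0 ≤ levelFun ν ε₁ V s d :=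
  div_nonneg (by positivity) (Real.rpow_nonneg (bracket_pos d).le _)

theorem sq_im_eq_levelFun (s : Side) (d : ℝ) :
    (V (s.sgn * d)).im ^ 2 = levelFun ν ε₁ V s d * bracket d ^ (4 * ν s + 2 * ε₁ + 2) := by
  rw [levelFun, div_mul_cancel₀ _ (Real.rpow_pos_of_pos (bracket_pos d) _).ne', sq_abs]

/-- With F the level function and p its exponent, (Im V)² = F⟨d⟩^p. In assumption (c) the first term
has exponent 2p, so ⟨d⟩^p ≤ CF and |Im V|² ≤ CF². The second has exponent p + 2ε₁, so |Re V| gains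
the weight ⟨d⟩^{-2ε₁}. -/
theorem RegularPotential.exists_le_levelFun (hV : RegularPotential N ν ε₁ V) {s : Side}
    (hs : ¬ BoundedAt V s) : ∃ R C : ℝ, 1 ≤ R ∧ 1 ≤ C ∧ ∀ d, R ≤ d →
      |(V (s.sgn * d)).im| ≤ C * levelFun ν ε₁ V s d ∧
      |(V (s.sgn * d)).re| ≤ C * (levelFun ν ε₁ V s d * bracket d ^ (-(2 * ε₁))) := by
  obtain ⟨K, hK⟩ := (hV.unbounded_end s hs).bound
  obtain ⟨R, hR, hR'⟩ := s.eventually_atEnd hK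
  obtain ⟨R', c, hR1, hc, him⟩ := hV.exists_im_ge s
  refine ⟨max R R', max 1 (max K 0), hR.trans (le_max_left _ _), le_max_left _ _, fun d hd => ?_⟩
  have h := hR' d ((le_max_left _ _).trans hd)
  have hb := bracket_pos d
  have hbp : ∀ q : ℝ, 0 < bracket d ^ q := fun q => Real.rpow_pos_of_pos hb q
  have him' : 0 < |(V (s.sgn * d)).im| := by
    rw [abs_pos]
    intro h0
    have := him d ((le_max_right _ _).trans hd)
    rw [h0] at this; simp at this; linarith
  set F := levelFun ν ε₁ V s d
  have hF : 0 ≤ F := levelFun_nonneg s d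
  set p := 4 * ν s + 2 * ε₁ + 2
  rw [bracket_sgn_mul, Real.norm_of_nonneg (by have := hbp; positivity),
    Real.norm_of_nonneg (by positivity), sq_im_eq_levelFun (ν := ν) (ε₁ := ε₁)] at h
  have hKC : K ≤ max 1 (max K 0) := (le_max_left _ _).trans (le_max_right _ _)
  set C := max 1 (max K 0)
  have hC1 : 1 ≤ C := le_max_left _ _
  have h' : bracket d ^ (4 * (ν s + ε₁) + 2) * (bracket d ^ (4 * ν s + 2) + |(V (s.sgn * d)).re|)
      ≤ C * (F * bracket d ^ p) :=
    h.trans (mul_le_mul_of_nonneg_right hKC (mul_nonneg hF (hbp p).le))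
  rw [mul_add] at h'
  constructor
  · have h1 : bracket d ^ p * bracket d ^ p ≤ C * (F * bracket d ^ p) := by
      refine le_trans ?_ h'
      rw [← Real.rpow_add hb, ← Real.rpow_add hb]
      have : 0 ≤ bracket d ^ (4 * (ν s + ε₁) + 2) * |(V (s.sgn * d)).re| :=
        mul_nonneg (hbp _).le (abs_nonneg _)
      rw [show 4 * (ν s + ε₁) + 2 + (4 * ν s + 2) = p + p by simp only [p]; ring]
      linarith
    have h2 : bracket d ^ p ≤ C * F := by
      rw [← mul_assoc] at h1
      exact le_of_mul_le_mul_right h1 (hbp p)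
    have h3 : |(V (s.sgn * d)).im| ^ 2 ≤ (C * F) ^ 2 := by
      rw [sq_abs, sq_im_eq_levelFun (ν := ν) (ε₁ := ε₁)]
      calc F * bracket d ^ p ≤ F * (C * F) := mul_le_mul_of_nonneg_left h2 hF
        _ ≤ (C * F) ^ 2 := by
            have h5 : F ≤ C * F := le_mul_of_one_le_left hF hC1
            nlinarith [mul_nonneg (hF.trans h5) (sub_nonneg.2 h5)]
    exact abs_le_of_sq_le_sq' h3 (by positivity) |>.2
  · have h1 : bracket d ^ (4 * (ν s + ε₁) + 2) * |(V (s.sgn * d)).re| ≤ C * (F * bracket d ^ p) := by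
      have : 0 ≤ bracket d ^ (4 * (ν s + ε₁) + 2) * bracket d ^ (4 * ν s + 2) :=
        mul_nonneg (hbp _).le (hbp _).le
      linarith
    have h2 : bracket d ^ p = bracket d ^ (4 * (ν s + ε₁) + 2) * bracket d ^ (-(2 * ε₁)) := by
      rw [← Real.rpow_add hb]; congr 1; simp only [p]; ring
    rw [h2] at h1
    refine le_of_mul_le_mul_left (h1.trans (le_of_eq ?_)) (hbp (4 * (ν s + ε₁) + 2))
    ring

end Ends


/-! ### The cut-off radius and the size of V up to it. -/

section Radius

variable {N : ℕ} {ν : Side → ℝ} {ε₁ : ℝ} {ε₂ : Side → ℝ} {V : ℝ → ℂ}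

theorem boundedAt_of_forall {s : Side} {R C : ℝ} (h : ∀ d, R ≤ d → ‖V (s.sgn * d)‖ ≤ C) :
    BoundedAt V s := by
  refine ⟨C, ?_⟩
  cases s
  · filter_upwards [eventually_le_atBot (-R)] with x hx
    simpa [Side.sgn] using h (-x) (by linarith)
  · filter_upwards [eventually_ge_atTop R] with x hx
    simpa [Side.sgn] using h x hx

theorem BoundedAt.exists_forall {s : Side} (h : BoundedAt V s) :
    ∃ R C : ℝ, 1 ≤ R ∧ 0 ≤ C ∧ ∀ d, R ≤ d → ‖V (s.sgn * d)‖ ≤ C := by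
  obtain ⟨C, hC⟩ := h
  obtain ⟨R, hR, h⟩ := s.eventually_atEnd hC
  exact ⟨R, C, hR, (norm_nonneg _).trans (h R le_rfl), h⟩

theorem exists_bound_on_interval (hV : Continuous V) (s : Side) (R : ℝ) :
    ∃ C : ℝ, 0 ≤ C ∧ ∀ d, 0 ≤ d → d ≤ R → ‖V (s.sgn * d)‖ ≤ C := by
  have hc : Continuous fun d : ℝ => V (s.sgn * d) :=
    hV.comp (continuous_const.mul continuous_id)
  obtain ⟨C, hC⟩ := (isCompact_Icc (a := 0) (b := R)).exists_bound_of_continuousOn hc.continuousOn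
  refine ⟨max C 0, le_max_right _ _, fun d h0 h1 => (hC d ⟨h0, h1⟩).trans (le_max_left _ _)⟩

theorem RegularPotential.exists_levelFun_gt (hV : RegularPotential N ν ε₁ V) {s : Side}
    (hs : ¬ BoundedAt V s) (M : ℝ) : ∃ d, 0 ≤ d ∧ M < levelFun ν ε₁ V s d := by
  by_contra h
  push Not at h
  apply hs
  obtain ⟨R, C, hR, hC, hb⟩ := hV.exists_le_levelFun hs
  refine boundedAt_of_forall (R := R) (C := C * M + C * M) fun d hd => ?_
  have hd0 : 0 ≤ d := by linarith
  obtain ⟨h1, h2⟩ := hb d hd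
  have hF := levelFun_nonneg (ν := ν) (ε₁ := ε₁) (V := V) s d
  have hbr := bracket_rpow_le_one (ν := -(2 * ε₁)) (by linarith [hV.eps_pos]) d
  have h3 : levelFun ν ε₁ V s d * bracket d ^ (-(2 * ε₁)) ≤ levelFun ν ε₁ V s d :=
    mul_le_of_le_one_right hF hbr
  have h4 := h d hd0
  refine (Complex.norm_le_abs_re_add_abs_im _).trans ?_
  refine add_le_add (h2.trans ?_) (h1.trans ?_) <;> gcongr
  exact h3.trans h4

/-- The level function is continuous, starts below λ and, at an unbounded end, exceeds every level.
The infimum is therefore attained and is the first crossing. -/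
theorem RegularPotential.cutRadius_spec (hV : RegularPotential N ν ε₁ V) {s : Side}
    (hs : ¬ BoundedAt V s) {lam : ℝ} (hlam : levelFun ν ε₁ V s 0 < lam) :
    0 ≤ cutRadius ν ε₁ ε₂ V s lam ∧ levelFun ν ε₁ V s (cutRadius ν ε₁ ε₂ V s lam) = lam ∧
      ∀ d, 0 ≤ d → d ≤ cutRadius ν ε₁ ε₂ V s lam → levelFun ν ε₁ V s d ≤ lam := by
  set S : Set ℝ := {d : ℝ | 0 ≤ d ∧ levelFun ν ε₁ V s d = lam} with hS
  have hδ : cutRadius ν ε₁ ε₂ V s lam = sInf S := by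
    rw [cutRadius, if_neg hs]
    rfl
  have hF := continuous_levelFun (ν := ν) (ε₁ := ε₁) hV.continuous s
  have ivt : ∀ d, 0 ≤ d → lam ≤ levelFun ν ε₁ V s d → ∃ e ∈ S, e ≤ d := by
    intro d hd h
    obtain ⟨e, he, he'⟩ := intermediate_value_Icc hd hF.continuousOn ⟨hlam.le, h⟩
    exact ⟨e, ⟨he.1, he'⟩, he.2⟩
  have hne : S.Nonempty := by
    obtain ⟨d, hd, h⟩ := hV.exists_levelFun_gt hs lam
    obtain ⟨e, he, -⟩ := ivt d hd h.le
    exact ⟨e, he⟩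
  have hbdd : BddBelow S := ⟨0, fun d hd => hd.1⟩
  have hcl : IsClosed S := isClosed_Ici.inter (isClosed_eq hF continuous_const)
  have hmem := hcl.csInf_mem hne hbdd
  rw [hδ]
  refine ⟨hmem.1, hmem.2, fun d hd hd' => ?_⟩
  by_contra h
  push Not at h
  obtain ⟨e, he, hed⟩ := ivt d hd h.le
  have h1 := csInf_le hbdd he
  have h2 : d = sInf S := le_antisymm hd' (h1.trans hed)
  rw [h2, hmem.2] at h
  exact lt_irrefl _ h

/-- On a compact interval the level function is bounded, so for large λ the first crossing lies
beyond it. -/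
theorem RegularPotential.tendsto_cutRadius (hV : RegularPotential N ν ε₁ V)
    (hε₂ : ∀ s, 0 < ε₂ s) (s : Side) : Tendsto (cutRadius ν ε₁ ε₂ V s) atTop atTop := by
  by_cases hs : BoundedAt V s
  · have : cutRadius ν ε₁ ε₂ V s = fun lam => lam ^ ((1 + ε₂ s) / 2) := by
      ext lam; rw [cutRadius, if_pos hs]
    rw [this]
    exact tendsto_rpow_atTop (by linarith [hε₂ s])
  · rw [tendsto_atTop]
    intro K
    obtain ⟨M, hM⟩ := (isCompact_Icc (a := 0) (b := K)).exists_bound_of_continuousOn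
      (continuous_levelFun (ν := ν) (ε₁ := ε₁) hV.continuous s).continuousOn
    filter_upwards [eventually_gt_atTop (max M (levelFun ν ε₁ V s 0))] with lam hlam
    obtain ⟨h1, h2, -⟩ := hV.cutRadius_spec (ε₂ := ε₂) hs ((le_max_right _ _).trans_lt hlam)
    by_contra h
    push Not at h
    have := hM _ ⟨h1, h.le⟩
    rw [h2] at this
    linarith [le_abs_self lam, Real.norm_eq_abs lam, (le_max_left M (levelFun ν ε₁ V s 0))]

/-- The size of the exponent in the decay of the pseudomode. -/
def decayExponent (ν : Side → ℝ) (ε₁ : ℝ) (ε₂ : Side → ℝ) (V : ℝ → ℂ) (s : Side)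
    (lam : ℝ) : ℝ :=
  open Classical in if BoundedAt V s then lam ^ (ε₂ s / 2)
  else cutRadius ν ε₁ ε₂ V s lam ^ (ν s + 1 + ε₁)

theorem kappaRate_eq (c : ℝ) (s : Side) (lam : ℝ) :
    kappaRate ν ε₁ ε₂ V c s lam = Real.exp (-c * decayExponent ν ε₁ ε₂ V s lam) := by
  unfold kappaRate decayExponent
  split_ifs <;> rfl

/-- At an unbounded end −1 ≤ ν < 0, hence 1 ≤ δ^{-ν} ≤ δ once δ ≥ 1. -/
theorem RegularPotential.cutWidth_bounds (hV : RegularPotential N ν ε₁ V) (hN : 1 ≤ N)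
    (hν : ∀ s, ν s < 0) (hε₂ : ∀ s, 0 < ε₂ s) (s : Side) :
    ∀ᶠ lam in atTop, 1 / 4 ≤ cutWidth ν ε₁ ε₂ V s lam ∧
      cutWidth ν ε₁ ε₂ V s lam ≤ cutRadius ν ε₁ ε₂ V s lam / 4 := by
  filter_upwards [(hV.tendsto_cutRadius hε₂ s).eventually_ge_atTop 1] with lam hlam
  rw [cutWidth]
  split_ifs with hs
  · exact ⟨by linarith, le_rfl⟩
  · have hν1 : -1 ≤ ν s := by
      by_contra h
      exact hs (hV.boundedAt_of_lt hN hν (not_le.1 h))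
    have h1 : 1 ≤ cutRadius ν ε₁ ε₂ V s lam ^ (-ν s) :=
      Real.one_le_rpow hlam (by linarith [hν s])
    have h2 : cutRadius ν ε₁ ε₂ V s lam ^ (-ν s) ≤ cutRadius ν ε₁ ε₂ V s lam := by
      conv_rhs => rw [← Real.rpow_one (cutRadius ν ε₁ ε₂ V s lam)]
      exact Real.rpow_le_rpow_of_exponent_le hlam (by linarith)
    exact ⟨by linarith, by linarith⟩

/-- Slightly beyond the cut-off, the level function is still of order `λ`. -/
theorem RegularPotential.exists_levelFun_le (hV : RegularPotential N ν ε₁ V) (hN : 1 ≤ N)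
    (hν : ∀ s, ν s < 0) (hε₂ : ∀ s, 0 < ε₂ s) {s : Side} (hs : ¬ BoundedAt V s) :
    ∃ K : ℝ, 1 ≤ K ∧ ∀ᶠ lam in atTop, ∀ d, 0 ≤ d → d ≤ cutRadius ν ε₁ ε₂ V s lam + 1 →
      levelFun ν ε₁ V s d ≤ K * lam := by
  obtain ⟨R, C, c, hR, hC, hc, -, -, hL, -, -⟩ := hV.exists_im_le hN hν s
  set p := 4 * ν s + 2 * ε₁ + 2 with hp
  -- Over a distance of at most 1, the reach of the mollifiers, |Im V| changes by at most the factor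
  -- exp C and the bracket by at most 2.
  refine ⟨Real.exp C ^ 2 * 2 ^ |-p|, ?_, ?_⟩
  · have h1 : 1 ≤ Real.exp C := Real.one_le_exp hC
    have h2 : (1 : ℝ) ≤ 2 ^ |-p| := Real.one_le_rpow one_le_two (abs_nonneg _)
    nlinarith [one_le_pow₀ h1 (n := 2)]
  have hK1 : 1 ≤ Real.exp C ^ 2 * 2 ^ |-p| := by
    have h1 : 1 ≤ Real.exp C := Real.one_le_exp hC
    have h2 : (1 : ℝ) ≤ 2 ^ |-p| := Real.one_le_rpow one_le_two (abs_nonneg _)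
    nlinarith [one_le_pow₀ h1 (n := 2)]
  filter_upwards [(hV.tendsto_cutRadius hε₂ s).eventually_ge_atTop R,
    eventually_gt_atTop (levelFun ν ε₁ V s 0), eventually_gt_atTop 0] with lam h1 h2 h3 d hd0 hd
  obtain ⟨-, h4, h5⟩ := hV.cutRadius_spec (ε₂ := ε₂) hs h2
  set δ := cutRadius ν ε₁ ε₂ V s lam
  rcases le_total d δ with h | h
  · exact (h5 d hd0 h).trans (le_mul_of_one_le_left h3.le hK1)
  · have hdδ : |d - δ| ≤ 1 := by rw [abs_of_nonneg (by linarith)]; linarith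
    have h6 : |(V (s.sgn * d)).im| ≤ Real.exp C * |(V (s.sgn * δ)).im| := by
      refine (hL δ d h1 (h1.trans h)).trans ?_
      gcongr
      exact mul_le_of_le_one_right hC hdδ
    have h7 := rpow_le_two_rpow_mul_rpow (bracket_pos d) (bracket_pos δ)
      (bracket_le_two_mul_bracket hdδ)
      (bracket_le_two_mul_bracket (by rwa [abs_sub_comm])) (-p)
    rw [Real.rpow_neg (bracket_pos d).le, Real.rpow_neg (bracket_pos δ).le] at h7
    calc levelFun ν ε₁ V s d = |(V (s.sgn * d)).im| ^ 2 * (bracket d ^ p)⁻¹ := rfl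
      _ ≤ (Real.exp C * |(V (s.sgn * δ)).im|) ^ 2 * (2 ^ |-p| * (bracket δ ^ p)⁻¹) := by
          gcongr
          exact inv_nonneg.2 (Real.rpow_nonneg (bracket_pos d).le _)
      _ = Real.exp C ^ 2 * 2 ^ |-p| * (|(V (s.sgn * δ)).im| ^ 2 * (bracket δ ^ p)⁻¹) := by ring
      _ = Real.exp C ^ 2 * 2 ^ |-p| * levelFun ν ε₁ V s δ := rfl
      _ = _ := by rw [h4]

/-- The part of the potentials controlled by the level function with an additional decaying
weight is negligible. -/
theorem RegularPotential.levelFun_mul_le (hV : RegularPotential N ν ε₁ V) (hN : 1 ≤ N)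
    (hν : ∀ s, ν s < 0) (hε₂ : ∀ s, 0 < ε₂ s) {s : Side} (hs : ¬ BoundedAt V s) {η : ℝ}
    (hη : 0 < η) : ∀ᶠ lam in atTop, ∀ d, 0 ≤ d → d ≤ cutRadius ν ε₁ ε₂ V s lam + 1 →
      levelFun ν ε₁ V s d * bracket d ^ (-(2 * ε₁)) ≤ η * lam := by
  obtain ⟨K, hK, hb⟩ := hV.exists_levelFun_le (ε₂ := ε₂) hN hν hε₂ hs
  have ht : Tendsto (fun d : ℝ => d ^ (-(2 * ε₁))) atTop (𝓝 0) :=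
    tendsto_rpow_neg_atTop (by linarith [hV.eps_pos])
  obtain ⟨R, hR⟩ := eventually_atTop.1 ((ht.eventually_lt_const (div_pos hη (one_pos.trans_le hK))).and
    (eventually_ge_atTop 1))
  obtain ⟨M, hM⟩ := (isCompact_Icc (a := 0) (b := R)).exists_bound_of_continuousOn
      (continuous_levelFun (ν := ν) (ε₁ := ε₁) hV.continuous s).continuousOn
  filter_upwards [hb, eventually_gt_atTop 0, eventually_ge_atTop (M / η)] with lam h1 h2 h3 d hd0 hd
  have hF := levelFun_nonneg (ν := ν) (ε₁ := ε₁) (V := V) s d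
  have hbr := bracket_rpow_le_one (ν := -(2 * ε₁)) (by linarith [hV.eps_pos]) d
  -- On the compact part the level function is bounded independently of λ; beyond it the weight is
  -- at most η/K.
  rcases le_total d R with h | h
  · have h4 := hM d ⟨hd0, h⟩
    rw [Real.norm_of_nonneg hF] at h4
    rw [div_le_iff₀ hη] at h3
    calc _ ≤ levelFun ν ε₁ V s d := mul_le_of_le_one_right hF hbr
      _ ≤ _ := by linarith
  · obtain ⟨h4, h5⟩ := hR d h
    have h6 : bracket d ^ (-(2 * ε₁)) ≤ η / K :=
      (bracket_rpow_le_rpow (by linarith [hV.eps_pos]) (by linarith)).trans h4.le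
    calc _ ≤ (K * lam) * (η / K) := by
          gcongr
          · exact Real.rpow_nonneg (bracket_pos d).le _
          · exact h1 d hd0 hd
      _ = _ := by field_simp

theorem RegularPotential.exists_im_le_lam (hV : RegularPotential N ν ε₁ V) (hN : 1 ≤ N)
    (hν : ∀ s, ν s < 0) (hε₂ : ∀ s, 0 < ε₂ s) (s : Side) :
    ∃ C : ℝ, 1 ≤ C ∧ ∀ᶠ lam in atTop, ∀ d, 0 ≤ d → d ≤ cutRadius ν ε₁ ε₂ V s lam + 1 →
      |(V (s.sgn * d)).im| ≤ C * lam := by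
  by_cases hs : BoundedAt V s
  · obtain ⟨R, C, hR, hC0, hC⟩ := hs.exists_forall
    obtain ⟨C', hC0', hC'⟩ := exists_bound_on_interval hV.continuous s R
    refine ⟨1, le_rfl, ?_⟩
    filter_upwards [eventually_ge_atTop C, eventually_ge_atTop C'] with lam h1 h2 d hd0 _
    rw [one_mul]
    refine (Complex.abs_im_le_norm _).trans ?_
    rcases le_total d R with h | h
    · exact (hC' d hd0 h).trans h2
    · exact (hC d h).trans h1
  · obtain ⟨K, hK, hb⟩ := hV.exists_levelFun_le (ε₂ := ε₂) hN hν hε₂ hs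
    obtain ⟨R, C, hR, hC, hC'⟩ := hV.exists_le_levelFun hs
    obtain ⟨C₁, hC₁, hC₁'⟩ := exists_bound_on_interval hV.continuous s R
    refine ⟨C * K, by nlinarith, ?_⟩
    filter_upwards [hb, eventually_ge_atTop C₁, eventually_gt_atTop 0] with lam h1 h2 h3 d hd0 hd
    rcases le_total d R with h | h
    · refine ((Complex.abs_im_le_norm _).trans (hC₁' d hd0 h)).trans (h2.trans ?_)
      exact le_mul_of_one_le_left h3.le (by nlinarith)
    · refine ((hC' d h).1).trans ?_
      rw [mul_assoc]
      gcongr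
      exact h1 d hd0 hd

/-- The weight ⟨d⟩^{-2ε₁} carried by the bound on the real part makes it o(λ), whereas the imaginary
part is only O(λ). -/
theorem RegularPotential.re_le_lam (hV : RegularPotential N ν ε₁ V) (hN : 1 ≤ N)
    (hν : ∀ s, ν s < 0) (hε₂ : ∀ s, 0 < ε₂ s) (s : Side) {η : ℝ} (hη : 0 < η) :
    ∀ᶠ lam in atTop, ∀ d, 0 ≤ d → d ≤ cutRadius ν ε₁ ε₂ V s lam + 1 →
      |(V (s.sgn * d)).re| ≤ η * lam := by
  by_cases hs : BoundedAt V s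
  · obtain ⟨R, C, hR, hC0, hC⟩ := hs.exists_forall
    obtain ⟨C', hC0', hC'⟩ := exists_bound_on_interval hV.continuous s R
    filter_upwards [eventually_ge_atTop (C / η), eventually_ge_atTop (C' / η)]
      with lam h1 h2 d hd0 _
    rw [div_le_iff₀ hη] at h1 h2
    refine (Complex.abs_re_le_norm _).trans ?_
    rcases le_total d R with h | h
    · exact (hC' d hd0 h).trans (by linarith)
    · exact (hC d h).trans (by linarith)
  · obtain ⟨R, C, hR, hC, hC'⟩ := hV.exists_le_levelFun hs
    obtain ⟨C₁, hC₁, hC₁'⟩ := exists_bound_on_interval hV.continuous s R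
    have hC0 : 0 < C := by linarith
    filter_upwards [hV.levelFun_mul_le (ε₂ := ε₂) hN hν hε₂ hs (div_pos hη hC0),
      eventually_ge_atTop (C₁ / η)] with lam h1 h2 d hd0 hd
    rw [div_le_iff₀ hη] at h2
    rcases le_total d R with h | h
    · exact ((Complex.abs_re_le_norm _).trans (hC₁' d hd0 h)).trans (by linarith)
    · refine ((hC' d h).2).trans ?_
      calc _ ≤ C * (η / C * lam) := mul_le_mul_of_nonneg_left (h1 d hd0 hd) hC0.le
        _ = _ := by field_simp

end Radius

/-! ### Local size of W₁. -/

section Rough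

variable {N : ℕ} {ν : Side → ℝ} {ε₁ : ℝ} {ε₂ : Side → ℝ} {V W₁ W₂ : ℝ → ℂ}

theorem RoughPotential.re_le_lam (hW : RoughPotential ν ε₁ ε₂ V W₁ W₂)
    (hV : RegularPotential N ν ε₁ V) (hN : 1 ≤ N)
    (hν : ∀ s, ν s < 0) (hε₂ : ∀ s, 0 < ε₂ s) (s : Side) {η : ℝ} (hη : 0 < η) :
    ∀ᶠ lam in atTop, ∀ᵐ x ∂volume, x ∈ s.halfLine → |x| ≤ cutRadius ν ε₁ ε₂ V s lam + 1 →
      |(W₁ x).re| ≤ η * lam := by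
  obtain ⟨C, hC⟩ := hW.re_le s
  by_cases hs : BoundedAt V s
  -- Within distance 1 of the cut-off |x| ≤ 2λ^{(1+ε₂)/2}, so that |x|^{2/(1+ε₂)} ≤ 2²λ because the
  -- exponent is at most 2. The quarter compensates this factor 4.
  · have hη4 : 0 < η / 4 := by linarith
    obtain ⟨R, hR, hR'⟩ := s.eventually_atEnd_ae ((hW.re_bounded_end s hs).bound hη4)
    obtain ⟨M, hM⟩ := (isCompact_Icc (a := -R) (b := R)).exists_bound_of_continuousOn
      (f := fun x => |C| * ((V x).im ^ 2 * bracket x ^ (-4 * (ν s + ε₁) - 2))) (by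
        refine Continuous.continuousOn (continuous_const.mul (Continuous.mul ?_ ?_))
        · exact (Complex.continuous_im.comp hV.continuous).pow 2
        · exact continuous_bracket.rpow_const fun x => Or.inl (bracket_pos x).ne')
    filter_upwards [eventually_ge_atTop (M / η), eventually_gt_atTop 0,
      (hV.tendsto_cutRadius hε₂ s).eventually_ge_atTop 1] with lam h1 h2 h3
    rw [div_le_iff₀ hη] at h1
    filter_upwards [hC, hR'] with x hx hx' hxs hxδ
    have habs := s.abs_eq_of_mem (s.mem_halfLine.1 hxs).le
    rcases le_total |x| R with h | h
    · have h4 := hM x (abs_le.1 h)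
      have h5 : |(W₁ x).re| ≤ |C| * ((V x).im ^ 2 * bracket x ^ (-4 * (ν s + ε₁) - 2)) := by
        refine (hx hxs).trans ?_
        gcongr
        · exact mul_nonneg (sq_nonneg _) (Real.rpow_nonneg (bracket_pos x).le _)
        · exact le_abs_self C
      linarith [(le_abs_self _).trans h4]
    · have h4 := hx' (by rwa [← habs])
      rw [Real.norm_eq_abs, Real.norm_of_nonneg (by positivity)] at h4
      have hδ : cutRadius ν ε₁ ε₂ V s lam = lam ^ ((1 + ε₂ s) / 2) := by
        rw [cutRadius, if_pos hs]
      have hε := hε₂ s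
      have h5 : |x| ^ (2 / (1 + ε₂ s)) ≤ 4 * lam := by
        calc |x| ^ (2 / (1 + ε₂ s)) ≤ (2 * lam ^ ((1 + ε₂ s) / 2)) ^ (2 / (1 + ε₂ s)) := by
              refine Real.rpow_le_rpow (abs_nonneg _) ?_ (by positivity)
              rw [← hδ]; linarith
          _ = 2 ^ (2 / (1 + ε₂ s)) * lam := by
              rw [Real.mul_rpow zero_le_two (by positivity), ← Real.rpow_mul h2.le]
              congr 1
              rw [show (1 + ε₂ s) / 2 * (2 / (1 + ε₂ s)) = 1 by field_simp, Real.rpow_one]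
          _ ≤ 2 ^ (2 : ℝ) * lam := by
              gcongr
              · exact one_le_two
              · rw [div_le_iff₀ (by linarith)]; linarith
          _ = 4 * lam := by norm_num
      calc _ ≤ η / 4 * (4 * lam) := h4.trans (by gcongr)
        _ = _ := by ring
  · have hC1 : 0 < |C| + 1 := by positivity
    filter_upwards [hV.levelFun_mul_le (ε₂ := ε₂) hN hν hε₂ hs (div_pos hη hC1),
      eventually_gt_atTop 0] with lam h1 h2
    filter_upwards [hC] with x hx hxs hxδ
    have habs := s.abs_eq_of_mem (s.mem_halfLine.1 hxs).le
    have h3 := h1 |x| (abs_nonneg x) hxδ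
    have hxx : s.sgn * |x| = x := by rw [habs, s.sgn_mul_sgn_mul]
    -- The hypothesis on Re W₁ is the bound already met for Re V: a constant times the level
    -- function with weight ⟨x⟩^{-2ε₁}.
    have h4 : (V x).im ^ 2 * bracket x ^ (-4 * (ν s + ε₁) - 2) =
        levelFun ν ε₁ V s |x| * bracket |x| ^ (-(2 * ε₁)) := by
      have := sq_im_eq_levelFun (ν := ν) (ε₁ := ε₁) (V := V) s |x|
      rw [hxx] at this
      rw [this, mul_assoc, ← hxx, bracket_sgn_mul, hxx, ← Real.rpow_add (bracket_pos _)]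
      congr 2; ring
    rw [h4] at hx
    have hF : 0 ≤ levelFun ν ε₁ V s |x| * bracket |x| ^ (-(2 * ε₁)) :=
      mul_nonneg (levelFun_nonneg s _) (Real.rpow_nonneg (bracket_pos _).le _)
    calc |(W₁ x).re| ≤ C * (levelFun ν ε₁ V s |x| * bracket |x| ^ (-(2 * ε₁))) := hx hxs
      _ ≤ (|C| + 1) * (η / (|C| + 1) * lam) := by
          gcongr
          linarith [le_abs_self C]
      _ = η * lam := by field_simp

/-- `W₁` is locally bounded. -/
theorem RoughPotential.exists_bound (hW : RoughPotential ν ε₁ ε₂ V W₁ W₂)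
    (hV : Continuous V) (R : ℝ) : ∃ C : ℝ, 0 ≤ C ∧ ∀ᵐ x ∂volume, |x| ≤ R → ‖W₁ x‖ ≤ C := by
  have key : ∀ s : Side, ∃ C : ℝ, 0 ≤ C ∧ ∀ᵐ x ∂volume, x ∈ s.halfLine → |x| ≤ R →
      |(W₁ x).re| ≤ C := by
    intro s
    obtain ⟨C, hC⟩ := hW.re_le s
    obtain ⟨M, hM⟩ := (isCompact_Icc (a := -R) (b := R)).exists_bound_of_continuousOn
      (f := fun x => C * ((V x).im ^ 2 * bracket x ^ (-4 * (ν s + ε₁) - 2))) (by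
        refine Continuous.continuousOn (continuous_const.mul (Continuous.mul ?_ ?_))
        · exact (Complex.continuous_im.comp hV).pow 2
        · exact continuous_bracket.rpow_const fun x => Or.inl (bracket_pos x).ne')
    refine ⟨max M 0, le_max_right _ _, ?_⟩
    filter_upwards [hC] with x hx hxs hxR
    exact (hx hxs).trans (((le_abs_self _).trans (hM x (abs_le.1 hxR))).trans (le_max_left _ _))
  obtain ⟨C1, h1, h1'⟩ := key .minus
  obtain ⟨C2, h2, h2'⟩ := key .plus
  obtain ⟨ε, hε0, hε1, hε⟩ := hW.im_le
  obtain ⟨M, hM⟩ := (isCompact_Icc (a := -R) (b := R)).exists_bound_of_continuousOn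
    hV.continuousOn
  refine ⟨C1 + C2 + max M 0, by positivity, ?_⟩
  have h0 : ∀ᵐ x ∂(volume : Measure ℝ), x ≠ 0 := by simp [ae_iff, measure_singleton]
  filter_upwards [h1', h2', hε, h0] with x hx1 hx2 hx3 hx0 hxR
  refine (Complex.norm_le_abs_re_add_abs_im _).trans (add_le_add ?_ ?_)
  · rcases lt_or_gt_of_ne hx0 with h | h
    · linarith [hx1 h hxR]
    · linarith [hx2 h hxR]
  · refine (hx3.trans ?_).trans (le_max_left _ _)
    refine le_trans ?_ (hM x (abs_le.1 hxR))
    refine le_trans ?_ (Complex.abs_im_le_norm _)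
    exact mul_le_of_le_one_left (abs_nonneg _) (by linarith)

theorem RoughPotential.locallyIntegrable₁ (hW : RoughPotential ν ε₁ ε₂ V W₁ W₂)
    (hV : Continuous V) : LocallyIntegrable W₁ volume := by
  intro x
  obtain ⟨C, -, hC⟩ := hW.exists_bound hV (|x| + 1)
  refine ⟨Metric.ball x 1, Metric.ball_mem_nhds x one_pos, ?_⟩
  refine Measure.integrableOn_of_bounded (M := C) measure_ball_lt_top.ne hW.measurable₁ ?_
  rw [ae_restrict_iff' measurableSet_ball]
  filter_upwards [hC] with y hy hyx
  refine hy ?_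
  rw [Metric.mem_ball, Real.dist_eq] at hyx
  have := abs_add_le (y - x) x
  rw [sub_add_cancel] at this
  linarith

end Rough


/-! ### The decay exponent and the bounds on the derivatives of V. -/

section Decay

variable {N : ℕ} {ν : Side → ℝ} {ε₁ : ℝ} {ε₂ : Side → ℝ} {V : ℝ → ℂ}

/-- At a bounded end |Im V| ≥ c and Δ = λ^{(1+ε₂)/2}/4. At an unbounded end |Im V(δ)| =
λ^{1/2}⟨δ⟩^{2ν+ε₁+1} by the choice of the radius; multiplication by Δ = δ^{-ν}/4 gives
λ^{1/2}δ^{ν+1+ε₁} up to a constant, and |Im V| is comparable to its value at δ on the whole strip.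
-/
theorem RegularPotential.exists_decay (hV : RegularPotential N ν ε₁ V) (hN : 1 ≤ N)
    (hν : ∀ s, ν s < 0) (hε₂ : ∀ s, 0 < ε₂ s) (s : Side) :
    ∃ c : ℝ, 0 < c ∧ ∀ᶠ lam in atTop, ∀ d,
      cutRadius ν ε₁ ε₂ V s lam - 2 * cutWidth ν ε₁ ε₂ V s lam ≤ d →
      d ≤ cutRadius ν ε₁ ε₂ V s lam →
      c * decayExponent ν ε₁ ε₂ V s lam * lam ^ (1 / 2 : ℝ) ≤
        cutWidth ν ε₁ ε₂ V s lam * |(V (s.sgn * d)).im| := by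
  obtain ⟨R, C, c, hR, hC, hc, him, hK, -, -, -⟩ := hV.exists_im_le hN hν s
  by_cases hs : BoundedAt V s
  · refine ⟨c / 4, by positivity, ?_⟩
    filter_upwards [(hV.tendsto_cutRadius hε₂ s).eventually_ge_atTop (2 * R),
      hV.cutWidth_bounds hN hν hε₂ s, eventually_gt_atTop 0] with lam h1 h2 h3 d hd1 hd2
    have h4 : R ≤ d := by linarith
    have h5 : c ≤ |(V (s.sgn * d)).im| := by
      have := him d h4
      rw [← one_mul |(V (s.sgn * d)).im|, ← s.abs_sgn, ← abs_mul]
      exact this.trans (le_abs_self _)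
    rw [cutWidth, if_pos hs, decayExponent, if_pos hs, cutRadius, if_pos hs]
    calc c / 4 * lam ^ (ε₂ s / 2) * lam ^ (1 / 2 : ℝ) = lam ^ ((1 + ε₂ s) / 2) / 4 * c := by
          rw [mul_assoc, ← Real.rpow_add h3, show ε₂ s / 2 + 1 / 2 = (1 + ε₂ s) / 2 by ring]
          ring
      _ ≤ _ := by gcongr
  · have hν1 : -1 ≤ ν s := by
      by_contra h
      exact hs (hV.boundedAt_of_lt hN hν (not_le.1 h))
    set q := 2 * ν s + ε₁ + 1 with hq
    refine ⟨(Real.exp C * 2 ^ |q| * 4)⁻¹, by positivity, ?_⟩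
    filter_upwards [(hV.tendsto_cutRadius hε₂ s).eventually_ge_atTop (2 * R),
      hV.cutWidth_bounds hN hν hε₂ s, eventually_gt_atTop 0,
      eventually_gt_atTop (levelFun ν ε₁ V s 0)] with lam h1 h2 h3 h4 d hd1 hd2
    obtain ⟨h5, h6, -⟩ := hV.cutRadius_spec (ε₂ := ε₂) hs h4
    have hdef : cutWidth ν ε₁ ε₂ V s lam = cutRadius ν ε₁ ε₂ V s lam ^ (-ν s) / 4 := by
      rw [cutWidth, if_neg hs]
    rw [decayExponent, if_neg hs]
    set δ := cutRadius ν ε₁ ε₂ V s lam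
    set Δ := cutWidth ν ε₁ ε₂ V s lam
    have hδ : 0 < δ := by linarith
    -- The strip lies in [δ/2, δ] and has length at most 2Δ = δ^{-ν}/2. The exponent is therefore at
    -- most C(δ/2)^ν δ^{-ν}/2 = C 2^{-ν}/2 ≤ C, using −ν ≤ 1.
    have h7 : |(V (s.sgn * δ)).im| ≤ Real.exp C * |(V (s.sgn * d)).im| := by
      refine (hK d δ ((δ / 2) ^ ν s) (by linarith) (by linarith) ?_).trans ?_
      · intro x hx _
        rw [min_eq_left hd2] at hx
        refine (bracket_rpow_le_rpow (hν s).le (by linarith)).trans ?_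
        exact Real.rpow_le_rpow_of_nonpos (by linarith) (by linarith) (hν s).le
      · gcongr
        refine mul_le_of_le_one_right hC ?_
        rw [abs_of_nonneg (by linarith)]
        calc (δ / 2) ^ ν s * (δ - d) ≤ (δ / 2) ^ ν s * (δ ^ (-ν s) / 2) := by
              gcongr
              linarith
          _ = 2 ^ (-ν s) / 2 := by
              rw [Real.div_rpow hδ.le zero_le_two, Real.rpow_neg hδ.le, Real.rpow_neg zero_le_two]
              have := (Real.rpow_pos_of_pos hδ (ν s)).ne'
              have := (Real.rpow_pos_of_pos two_pos (ν s)).ne'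
              field_simp
          _ ≤ 2 ^ (1 : ℝ) / 2 := by
              gcongr
              · exact one_le_two
              · linarith
          _ = 1 := by norm_num
    have h8 : |(V (s.sgn * δ)).im| = lam ^ (1 / 2 : ℝ) * bracket δ ^ q := by
      have := sq_im_eq_levelFun (ν := ν) (ε₁ := ε₁) (V := V) s δ
      rw [h6] at this
      rw [← Real.sqrt_sq_eq_abs, this, Real.sqrt_mul h3.le, ← Real.sqrt_eq_rpow]
      congr 1
      rw [Real.sqrt_eq_rpow, ← Real.rpow_mul (bracket_pos _).le]
      congr 1
      rw [hq]; ring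
    have hδ1 : 1 ≤ δ := by linarith
    have h9 : δ ^ q ≤ 2 ^ |q| * bracket δ ^ q :=
      rpow_le_two_rpow_mul_rpow hδ (bracket_pos δ)
        (by linarith [(le_abs_self δ).trans (abs_le_bracket δ), bracket_pos δ])
        (bracket_le_two_mul hδ1) q
    have h10 : δ ^ (ν s + 1 + ε₁) = δ ^ (-ν s) * δ ^ q := by
      rw [← Real.rpow_add hδ]; congr 1; rw [hq]; ring
    have hδν : 0 < δ ^ (-ν s) := Real.rpow_pos_of_pos hδ _
    have hl : 0 < lam ^ (1 / 2 : ℝ) := Real.rpow_pos_of_pos h3 _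
    calc (Real.exp C * 2 ^ |q| * 4)⁻¹ * δ ^ (ν s + 1 + ε₁) * lam ^ (1 / 2 : ℝ)
        ≤ (Real.exp C * 2 ^ |q| * 4)⁻¹ * (δ ^ (-ν s) * (2 ^ |q| * bracket δ ^ q)) *
          lam ^ (1 / 2 : ℝ) := by
          rw [h10]; gcongr
      _ = δ ^ (-ν s) / 4 * ((Real.exp C)⁻¹ * (lam ^ (1 / 2 : ℝ) * bracket δ ^ q)) := by
          have : (2 : ℝ) ^ |q| ≠ 0 := by positivity
          have := (Real.exp_pos C).ne'
          field_simp
      _ ≤ Δ * |(V (s.sgn * d)).im| := by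
          rw [hdef, ← h8]
          gcongr
          rw [inv_mul_le_iff₀ (Real.exp_pos C)]
          exact h7

/-- At an unbounded end log λ = 2 log |Im V(δ)| − p log⟨δ⟩, and the growth estimate for Im V bounds
log |Im V(δ)| by a power of δ smaller than the one in the decay exponent. At a bounded end a
logarithm is compared with a power of λ. Exponential smallness thus absorbs every power of λ. -/
theorem RegularPotential.lam_le_exp (hV : RegularPotential N ν ε₁ V) (hN : 1 ≤ N)
    (hν : ∀ s, ν s < 0) (hε₂ : ∀ s, 0 < ε₂ s) (s : Side) {c : ℝ} (hc : 0 < c) :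
    ∀ᶠ lam in atTop, lam ≤ Real.exp (c * decayExponent ν ε₁ ε₂ V s lam) := by
  by_cases hs : BoundedAt V s
  · have h := (isLittleO_log_rpow_atTop (r := ε₂ s / 2) (by linarith [hε₂ s])).bound hc
    filter_upwards [h, eventually_gt_atTop 0] with lam h1 h2
    rw [decayExponent, if_pos hs, ← Real.log_le_iff_le_exp h2]
    rw [Real.norm_of_nonneg (Real.rpow_nonneg h2.le _)] at h1
    exact (le_abs_self _).trans h1
  · have hν1 : -1 ≤ ν s := by
      by_contra h
      exact hs (hV.boundedAt_of_lt hN hν (not_le.1 h))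
    have hε := hV.eps_pos
    obtain ⟨R, C, c', hR, hC, hc', him, -, -, hgrow, -⟩ := hV.exists_im_le hN hν s
    -- This exponent exceeds −1 even if ν = −1, while μ + 1 stays strictly below θ.
    set μ := ν s + ε₁ / 2 with hμ
    set θ := ν s + 1 + ε₁ with hθ
    set p := 4 * ν s + 2 * ε₁ + 2 with hp
    have hA : 0 < |(V (s.sgn * R)).im| := by
      rw [abs_pos]; intro h
      have := him R le_rfl
      rw [h] at this; simp at this; linarith
    set A := |(V (s.sgn * R)).im|
    -- the logarithm of the level is dominated
    have key : ∀ᶠ d : ℝ in atTop, 2 * Real.log A + 2 * (C * (d ^ (μ + 1) / (μ + 1))) +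
        |p| * (Real.log 2 + Real.log d) ≤ c * d ^ θ := by
      have o1 : (fun d : ℝ => 2 * Real.log A) =o[atTop] fun d : ℝ => d ^ θ :=
        isLittleO_const_left.2 (Or.inr
          (tendsto_norm_atTop_atTop.comp (tendsto_rpow_atTop (by linarith))))
      have o2 : (fun d : ℝ => 2 * (C * (d ^ (μ + 1) / (μ + 1)))) =o[atTop] fun d : ℝ => d ^ θ := by
        have : (fun d : ℝ => d ^ (μ + 1)) =o[atTop] fun d : ℝ => d ^ θ := by
          refine isLittleO_of_tendsto' ?_ ?_
          · filter_upwards [eventually_gt_atTop 0] with d hd h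
            exact absurd h (Real.rpow_pos_of_pos hd _).ne'
          · refine (tendsto_rpow_neg_atTop (y := ε₁ / 2) (by linarith)).congr' ?_
            filter_upwards [eventually_gt_atTop 0] with d hd
            rw [← Real.rpow_sub hd]
            congr 1
            rw [hμ, hθ]; ring
        refine (this.const_mul_left (2 * C / (μ + 1))).congr_left fun d => ?_
        ring
      have o3 : (fun d : ℝ => |p| * (Real.log 2 + Real.log d)) =o[atTop] fun d : ℝ => d ^ θ := by
        refine IsLittleO.const_mul_left (IsLittleO.add ?_
          (isLittleO_log_rpow_atTop (by linarith))) _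
        exact isLittleO_const_left.2 (Or.inr
          (tendsto_norm_atTop_atTop.comp (tendsto_rpow_atTop (by linarith))))
      filter_upwards [((o1.add o2).add o3).bound hc, eventually_gt_atTop 0] with d hd hd0
      rw [Real.norm_of_nonneg (Real.rpow_nonneg hd0.le _)] at hd
      exact (le_abs_self _).trans hd
    filter_upwards [(hV.tendsto_cutRadius hε₂ s).eventually key,
      (hV.tendsto_cutRadius hε₂ s).eventually_ge_atTop R, eventually_gt_atTop 0,
      eventually_gt_atTop (levelFun ν ε₁ V s 0)] with lam h1 h2 h3 h4
    obtain ⟨h5, h6, -⟩ := hV.cutRadius_spec (ε₂ := ε₂) hs h4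
    rw [decayExponent, if_neg hs, ← Real.log_le_iff_le_exp h3]
    refine le_trans ?_ h1
    set δ := cutRadius ν ε₁ ε₂ V s lam
    have hδ1 : 1 ≤ δ := hR.trans h2
    have h7 := hgrow μ R δ (by linarith) (by linarith) le_rfl h2
    have h8 : 0 < |(V (s.sgn * δ)).im| := by
      rw [abs_pos]; intro h
      have := him δ h2
      rw [h] at this; simp at this; linarith
    have h9 : Real.log |(V (s.sgn * δ)).im| ≤ C * (δ ^ (μ + 1) / (μ + 1)) + Real.log A := by
      rw [← Real.log_exp (C * (δ ^ (μ + 1) / (μ + 1))), ← Real.log_mul (Real.exp_pos _).ne' hA.ne']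
      exact Real.log_le_log h8 h7
    have h10 : Real.log lam = 2 * Real.log |(V (s.sgn * δ)).im| - p * Real.log (bracket δ) := by
      rw [← h6, levelFun, Real.log_div (by positivity)
        (Real.rpow_pos_of_pos (bracket_pos δ) _).ne', Real.log_pow, Real.log_rpow (bracket_pos δ)]
      norm_num [hp]
    have h11 : -(p * Real.log (bracket δ)) ≤ |p| * (Real.log 2 + Real.log δ) := by
      have hb : 0 ≤ Real.log (bracket δ) := Real.log_nonneg (one_le_bracket δ)
      calc -(p * Real.log (bracket δ)) = -p * Real.log (bracket δ) := by ring
        _ ≤ |p| * Real.log (bracket δ) := by gcongr; exact neg_le_abs p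
        _ ≤ |p| * (Real.log 2 + Real.log δ) := by
            rw [← Real.log_mul two_ne_zero (by linarith)]
            gcongr
            · exact bracket_pos δ
            · exact bracket_le_two_mul hδ1
    rw [h10]
    linarith

/-- The factor in `sigmaRate` which depends on the potential. -/
def sigmaSup (ν : Side → ℝ) (ε₁ : ℝ) (ε₂ : Side → ℝ) (V : ℝ → ℂ) (n : ℕ) (s : Side)
    (lam : ℝ) : ℝ :=
  open Classical in if BoundedAt V s then 1
  else sSup ((fun x => ‖V x‖ * bracket x ^ (((n : ℝ) + 1) * ν s)) '' cutInterval ν ε₁ ε₂ V s lam)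

theorem sigmaRate_eq (n : ℕ) (s : Side) (lam : ℝ) : sigmaRate ν ε₁ ε₂ V n s lam =
    lam ^ (-((n : ℝ) + 1) / 2) * sigmaSup ν ε₁ ε₂ V n s lam := by
  unfold sigmaRate sigmaSup
  split_ifs
  · rw [mul_one]
  · rfl

theorem measurableSet_cutInterval (s : Side) (lam : ℝ) :
    MeasurableSet (cutInterval ν ε₁ ε₂ V s lam) :=
  s.measurableSet_halfLine.inter (measurableSet_lt measurable_norm measurable_const)

theorem mem_cutInterval {s : Side} {lam x : ℝ} : x ∈ cutInterval ν ε₁ ε₂ V s lam ↔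
    0 < s.sgn * x ∧ s.sgn * x < cutRadius ν ε₁ ε₂ V s lam := by
  rw [cutInterval, mem_ofPred_eq, s.mem_halfLine]
  constructor
  · rintro ⟨h1, h2⟩; exact ⟨h1, by rwa [← s.abs_eq_of_mem h1.le]⟩
  · rintro ⟨h1, h2⟩; exact ⟨h1, by rwa [s.abs_eq_of_mem h1.le]⟩

/-- V does not vanish at a fixed point far out, which belongs to the cut-off interval for large λ.
So the supremum is bounded below, and O(1) contributions from compact sets can be absorbed in it. -/
theorem RegularPotential.exists_sigmaSup (hV : RegularPotential N ν ε₁ V)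
    (hν : ∀ s, ν s < 0) (hε₂ : ∀ s, 0 < ε₂ s) (n : ℕ) (s : Side) :
    ∃ C : ℝ, 1 ≤ C ∧ ∀ᶠ lam in atTop, 1 ≤ C * sigmaSup ν ε₁ ε₂ V n s lam ∧
      ∀ x ∈ cutInterval ν ε₁ ε₂ V s lam,
        ‖V x‖ * bracket x ^ (((n : ℝ) + 1) * ν s) ≤ C * sigmaSup ν ε₁ ε₂ V n s lam := by
  have hq : ((n : ℝ) + 1) * ν s ≤ 0 :=
    mul_nonpos_of_nonneg_of_nonpos (by positivity) (hν s).le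
  by_cases hs : BoundedAt V s
  · obtain ⟨R, C, hR, hC0, hC⟩ := hs.exists_forall
    obtain ⟨C', hC0', hC'⟩ := exists_bound_on_interval hV.continuous s R
    have hC1 : 1 ≤ C + C' + 1 := by linarith
    refine ⟨C + C' + 1, hC1, Eventually.of_forall fun lam => ?_⟩
    rw [sigmaSup, if_pos hs, mul_one]
    refine ⟨hC1, fun x hx => ?_⟩
    rw [mem_cutInterval] at hx
    refine (mul_le_of_le_one_right (norm_nonneg _) (bracket_rpow_le_one hq x)).trans ?_
    rw [← s.sgn_mul_sgn_mul x]
    rcases le_total (s.sgn * x) R with h | h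
    · linarith [hC' _ hx.1.le h]
    · linarith [hC _ h]
  · obtain ⟨R, c, hR, hc, him⟩ := hV.exists_im_ge s
    have hx0 : 0 < ‖V (s.sgn * R)‖ := norm_pos_iff.2 fun h => by
      have := him R le_rfl
      rw [h] at this; simp at this; linarith
    set t₀ := ‖V (s.sgn * R)‖ * bracket (s.sgn * R) ^ (((n : ℝ) + 1) * ν s)
    have ht₀ : 0 < t₀ := mul_pos hx0 (Real.rpow_pos_of_pos (bracket_pos _) _)
    refine ⟨max 1 t₀⁻¹, le_max_left _ _, ?_⟩
    filter_upwards [(hV.tendsto_cutRadius hε₂ s).eventually_gt_atTop R] with lam h1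
    rw [sigmaSup, if_neg hs]
    -- Boundedness is essential: the real supremum of an unbounded set would be 0.
    have hbdd : BddAbove ((fun x => ‖V x‖ * bracket x ^ (((n : ℝ) + 1) * ν s)) ''
        cutInterval ν ε₁ ε₂ V s lam) := by
      have hcont : Continuous fun x => ‖V x‖ * bracket x ^ (((n : ℝ) + 1) * ν s) :=
        hV.continuous.norm.mul
          (continuous_bracket.rpow_const fun x => Or.inl (bracket_pos x).ne')
      refine ((isCompact_Icc (a := -cutRadius ν ε₁ ε₂ V s lam)
        (b := cutRadius ν ε₁ ε₂ V s lam)).bddAbove_image hcont.continuousOn).mono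
        (image_mono fun x hx => ?_)
      exact abs_le.1 hx.2.le
    have hle : ∀ x ∈ cutInterval ν ε₁ ε₂ V s lam,
        ‖V x‖ * bracket x ^ (((n : ℝ) + 1) * ν s) ≤
        sSup ((fun x => ‖V x‖ * bracket x ^ (((n : ℝ) + 1) * ν s)) ''
        cutInterval ν ε₁ ε₂ V s lam) := fun x hx =>
      le_csSup hbdd ⟨x, hx, rfl⟩
    have h2 := hle (s.sgn * R) (by
      rw [mem_cutInterval, s.sgn_mul_sgn_mul]; exact ⟨by linarith, h1⟩)
    have h3 : 0 < sSup ((fun x => ‖V x‖ * bracket x ^ (((n : ℝ) + 1) * ν s)) ''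
        cutInterval ν ε₁ ε₂ V s lam) := ht₀.trans_le h2
    refine ⟨?_, fun x hx => ?_⟩
    · calc (1 : ℝ) = t₀⁻¹ * t₀ := (inv_mul_cancel₀ ht₀.ne').symm
        _ ≤ _ := by
          gcongr
          exact le_max_right _ _
    · exact (hle x hx).trans (le_mul_of_one_le_left h3.le (le_max_left _ _))

/-- Near the origin only local boundedness of V' is known; the summand 1 accounts for it. -/
theorem RegularPotential.exists_deriv_le (hV : RegularPotential N ν ε₁ V) (hN : 1 ≤ N)
    (s : Side) : ∃ C : ℝ, 1 ≤ C ∧ ∀ᵐ x ∂volume, 0 < s.sgn * x →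
      ‖deriv V x‖ ≤ C * (1 + ‖V x‖ * bracket x ^ ν s) := by
  obtain ⟨hL, hb⟩ := hV.lipschitz_and_bounds hN
  obtain ⟨C, hC⟩ := (hb s).2.bound
  obtain ⟨R, hR, hR'⟩ := s.eventually_atEnd_ae hC
  obtain ⟨K, hK0, hK⟩ := exists_norm_deriv_le_of_locallyLipschitz hL R
  refine ⟨max 1 (max C K), le_max_left _ _, ?_⟩
  filter_upwards [hR'] with x hx hxs
  have hnn : 0 ≤ ‖V x‖ * bracket x ^ ν s :=
    mul_nonneg (norm_nonneg _) (Real.rpow_nonneg (bracket_pos x).le _)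
  have hC' : C ≤ max 1 (max C K) := (le_max_left _ _).trans (le_max_right _ _)
  have hK' : K ≤ max 1 (max C K) := (le_max_right _ _).trans (le_max_right _ _)
  have h1' : (1 : ℝ) ≤ max 1 (max C K) := le_max_left _ _
  rcases le_total R (s.sgn * x) with h | h
  · have := hx h
    rw [Real.norm_of_nonneg hnn] at this
    nlinarith
  · have := hK x (by rwa [s.abs_eq_of_mem hxs.le])
    nlinarith

theorem RegularPotential.exists_deriv_deriv_le (hV : RegularPotential N ν ε₁ V) (hN : 2 ≤ N)
    (s : Side) : ∃ C : ℝ, 1 ≤ C ∧ ∀ᵐ x ∂volume, 0 < s.sgn * x →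
      ‖deriv (deriv V) x‖ ≤ C * (1 + ‖V x‖ * bracket x ^ (2 * ν s)) := by
  obtain ⟨-, hL, hb⟩ := hV.contDiff_and_bounds hN
  obtain ⟨C, hC⟩ := (hb s).bound
  obtain ⟨R, hR, hR'⟩ := s.eventually_atEnd_ae hC
  obtain ⟨K, hK0, hK⟩ := exists_norm_deriv_le_of_locallyLipschitz hL R
  refine ⟨max 1 (max C K), le_max_left _ _, ?_⟩
  filter_upwards [hR'] with x hx hxs
  have hnn : 0 ≤ ‖V x‖ * bracket x ^ (2 * ν s) :=
    mul_nonneg (norm_nonneg _) (Real.rpow_nonneg (bracket_pos x).le _)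
  have hC' : C ≤ max 1 (max C K) := (le_max_left _ _).trans (le_max_right _ _)
  have hK' : K ≤ max 1 (max C K) := (le_max_right _ _).trans (le_max_right _ _)
  have h1' : (1 : ℝ) ≤ max 1 (max C K) := le_max_left _ _
  rcases le_total R (s.sgn * x) with h | h
  · have := hx h
    rw [Real.norm_of_nonneg hnn] at this
    nlinarith
  · have := hK x (by rwa [s.abs_eq_of_mem hxs.le])
    nlinarith

end Decay


/-! ### The smoothed potential on the support of the cut-off. -/

section Mollified

variable {N : ℕ} {ν : Side → ℝ} {ε₁ : ℝ} {ε₂ : Side → ℝ} {V W₁ W₂ : ℝ → ℂ} {w : ℝ → ℝ}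
  {α : Side → ℝ} {α₀ : ℝ}

/-- The closed interval which carries the pseudomode. -/
def carrier (ν : Side → ℝ) (ε₁ : ℝ) (ε₂ : Side → ℝ) (V : ℝ → ℂ) (lam : ℝ) : Set ℝ :=
  {x | ∀ s : Side, s.sgn * x ≤ cutRadius ν ε₁ ε₂ V s lam}

theorem mem_carrier_iff {lam x : ℝ} : x ∈ carrier ν ε₁ ε₂ V lam ↔
    x ∈ Icc (-cutRadius ν ε₁ ε₂ V .minus lam) (cutRadius ν ε₁ ε₂ V .plus lam) := by
  constructor
  · intro h
    have h1 := h .minus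
    have h2 := h .plus
    simp only [Side.sgn] at h1 h2
    exact ⟨by linarith, by linarith⟩
  · rintro ⟨h1, h2⟩ s
    cases s <;> simp only [Side.sgn] <;> linarith

theorem Side.exists_nonneg (x : ℝ) : ∃ s : Side, 0 ≤ s.sgn * x := by
  rcases le_total 0 x with h | h
  · exact ⟨.plus, by simpa [Side.sgn] using h⟩
  · exact ⟨.minus, by simpa [Side.sgn] using h⟩

theorem abs_sgn_mul_sub (s : Side) (x y : ℝ) : |s.sgn * x - s.sgn * y| = |x - y| := by
  rw [← mul_sub, abs_mul, s.abs_sgn, one_mul]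

theorem RoughPotential.locallyIntegrable_indicator (hW : RoughPotential ν ε₁ ε₂ V W₁ W₂)
    (hV : Continuous V) (s : Side) : LocallyIntegrable (s.halfLine.indicator W₁) volume :=
  (hW.locallyIntegrable₁ hV).indicator s.measurableSet_halfLine

theorem RoughPotential.abs_im_le (hW : RoughPotential ν ε₁ ε₂ V W₁ W₂) :
    ∀ᵐ x ∂volume, |(W₁ x).im| ≤ |(V x).im| := by
  obtain ⟨ε, h0, h1, h⟩ := hW.im_le
  filter_upwards [h] with x hx
  exact hx.trans (mul_le_of_le_one_left (abs_nonneg _) (by linarith))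

/-- A neighbourhood of x may cross the origin, so y is treated according to its own sign. The
distance 1 covers every mollification scale used for large λ. -/
theorem RoughPotential.exists_norm_le_lam (hW : RoughPotential ν ε₁ ε₂ V W₁ W₂)
    (hV : RegularPotential N ν ε₁ V) (hN : 1 ≤ N) (hν : ∀ s, ν s < 0) (hε₂ : ∀ s, 0 < ε₂ s) :
    ∃ C : ℝ, 1 ≤ C ∧ ∀ᶠ lam in atTop, ∀ x ∈ carrier ν ε₁ ε₂ V lam,
      ∀ᵐ y ∂volume, |y - x| ≤ 1 → ‖W₁ y‖ ≤ C * lam ∧ |(W₁ y).im| ≤ C * lam := by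
  choose C hC1 hC using fun s => hV.exists_im_le_lam (ε₂ := ε₂) hN hν hε₂ s
  refine ⟨1 + C .minus + C .plus, by linarith [hC1 .minus, hC1 .plus], ?_⟩
  filter_upwards [hC .minus, hC .plus, hW.re_le_lam hV hN hν hε₂ .minus one_pos,
    hW.re_le_lam hV hN hν hε₂ .plus one_pos, eventually_gt_atTop 0] with lam h1 h2 h3 h4 h0 x hx
  have hy0 : ∀ᵐ y ∂(volume : Measure ℝ), y ≠ 0 := by simp [ae_iff, measure_singleton]
  filter_upwards [h3, h4, hW.abs_im_le, hy0] with y h5 h6 h7 hy hyx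
  have hCm := hC1 .minus
  have hCp := hC1 .plus
  have main : |(W₁ y).re| ≤ 1 * lam ∧ |(W₁ y).im| ≤ (C .minus + C .plus) * lam := by
    rcases lt_or_gt_of_ne hy with h | h
    · have hxm := hx .minus
      simp only [Side.sgn] at hxm
      have hyl : |y| ≤ cutRadius ν ε₁ ε₂ V .minus lam + 1 := by
        rw [abs_of_neg h]; linarith [(abs_le.1 hyx).1]
      refine ⟨h5 h hyl, h7.trans ?_⟩
      have := h1 |y| (abs_nonneg y) hyl
      rw [abs_of_neg h] at this
      simp only [Side.sgn, neg_mul_neg, one_mul] at this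
      nlinarith
    · have hxm := hx .plus
      simp only [Side.sgn] at hxm
      have hyl : |y| ≤ cutRadius ν ε₁ ε₂ V .plus lam + 1 := by
        rw [abs_of_pos h]; linarith [(abs_le.1 hyx).2]
      refine ⟨h6 h hyl, h7.trans ?_⟩
      have := h2 |y| (abs_nonneg y) hyl
      rw [abs_of_pos h] at this
      simp only [Side.sgn, one_mul] at this
      nlinarith
  refine ⟨(Complex.norm_le_abs_re_add_abs_im _).trans ?_, main.2.trans ?_⟩ <;> nlinarith [main.1, main.2]

theorem RoughPotential.re_le_lam_near (hW : RoughPotential ν ε₁ ε₂ V W₁ W₂)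
    (hV : RegularPotential N ν ε₁ V) (hN : 1 ≤ N) (hν : ∀ s, ν s < 0) (hε₂ : ∀ s, 0 < ε₂ s)
    {η : ℝ} (hη : 0 < η) : ∀ᶠ lam in atTop, ∀ x ∈ carrier ν ε₁ ε₂ V lam,
      ∀ᵐ y ∂volume, |y - x| ≤ 1 → |(W₁ y).re| ≤ η * lam := by
  filter_upwards [hW.re_le_lam hV hN hν hε₂ .minus hη,
    hW.re_le_lam hV hN hν hε₂ .plus hη] with lam h3 h4 x hx
  have hy0 : ∀ᵐ y ∂(volume : Measure ℝ), y ≠ 0 := by simp [ae_iff, measure_singleton]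
  filter_upwards [h3, h4, hy0] with y h5 h6 hy hyx
  rcases lt_or_gt_of_ne hy with h | h
  · have hxm := hx .minus
    simp only [Side.sgn] at hxm
    exact h5 h (by rw [abs_of_neg h]; linarith [(abs_le.1 hyx).1])
  · have hxm := hx .plus
    simp only [Side.sgn] at hxm
    exact h6 h (by rw [abs_of_pos h]; linarith [(abs_le.1 hyx).2])

theorem eventually_rpow_neg_le {a b : ℝ} (ha : 0 < a) (hb : 0 < b) :
    ∀ᶠ lam : ℝ in atTop, lam ^ (-a) ≤ b :=
  ((tendsto_rpow_neg_atTop ha).eventually_lt_const hb).mono fun _ h => h.le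

theorem norm_indicator_clm_le {φ : ℝ → ℂ} (ℓ : ℂ →L[ℝ] ℝ) {A : Set ℝ} {M y : ℝ} (hM : 0 ≤ M)
    (h : |ℓ (φ y)| ≤ M) : |ℓ (A.indicator φ y)| ≤ M := by
  by_cases hy : y ∈ A
  · rwa [indicator_of_mem hy]
  · rw [indicator_of_notMem hy]; simpa using hM

/-- Pointwise bounds for the mollification of `W₂`. -/
theorem RoughPotential.exists_mollify₂_le (hW : RoughPotential ν ε₁ ε₂ V W₁ W₂)
    (hw : IsMollifier w) : ∃ C : ℝ, 1 ≤ C ∧ ∀ lam : ℝ, 1 ≤ lam → ∀ x,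
      ‖mollify w (lam ^ (-α₀)) W₂ x‖ ≤ C * lam ^ (α₀ / 2) ∧
      ‖deriv (mollify w (lam ^ (-α₀)) W₂) x‖ ≤ C * lam ^ (α₀ / 2) / lam ^ (-α₀) := by
  obtain ⟨B, hB0, hB⟩ := hw.exists_bound
  have hn : 0 ≤ norm2 W₂ := ENNReal.toReal_nonneg
  refine ⟨max 1 (B * Real.sqrt 2 * norm2 W₂), le_max_left _ _, fun lam hlam x => ?_⟩
  have hl : 0 < lam := by linarith
  have hε : 0 < lam ^ (-α₀) := Real.rpow_pos_of_pos hl _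
  have hsq : Real.sqrt (2 * lam ^ (-α₀)) = Real.sqrt 2 * lam ^ (-(α₀ / 2)) := by
    rw [Real.sqrt_mul zero_le_two, Real.sqrt_eq_rpow (lam ^ (-α₀)), ← Real.rpow_mul hl.le]
    congr 2; ring
  -- Scaling of the kernel in L²: ε^{-1}·ε^{1/2} = ε^{-1/2} with ε = λ^{-α₀}.
  have hkey : (lam ^ (-α₀))⁻¹ * lam ^ (-(α₀ / 2)) = lam ^ (α₀ / 2) := by
    rw [← Real.rpow_neg hl.le, ← Real.rpow_add hl]
    congr 1; ring
  have hp : 0 ≤ lam ^ (α₀ / 2) := Real.rpow_nonneg hl.le _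
  constructor
  · rw [mollify_eq_mollifyDeriv_zero]
    refine (norm_mollifyDeriv_le_of_memLp hw hB hε hW.memLp₂ (by norm_num) x).trans ?_
    rw [hsq, zero_add, pow_one]
    calc _ = (B * Real.sqrt 2 * norm2 W₂) * ((lam ^ (-α₀))⁻¹ * lam ^ (-(α₀ / 2))) := by ring
      _ ≤ _ := by
        rw [hkey]
        gcongr
        exact le_max_right _ _
  · rw [deriv_mollify hw hε (hW.memLp₂.locallyIntegrable (by norm_num))]
    refine (norm_mollifyDeriv_le_of_memLp hw hB hε hW.memLp₂ (j := 1) (by norm_num) x).trans ?_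
    rw [hsq]
    calc _ = (B * Real.sqrt 2 * norm2 W₂) * ((lam ^ (-α₀))⁻¹ * lam ^ (-(α₀ / 2))) /
          lam ^ (-α₀) := by
          rw [pow_succ, pow_one]
          field_simp
      _ ≤ _ := by
        rw [hkey]
        gcongr
        exact le_max_right _ _

theorem RoughPotential.exists_mollify₂_eq_zero (hW : RoughPotential ν ε₁ ε₂ V W₁ W₂)
    (hw : IsMollifier w) : ∃ R : ℝ, ∀ ε : ℝ, 0 < ε → ε ≤ 1 → ∀ x, R < |x| →
      mollify w ε W₂ x = 0 := by
  obtain ⟨R, hR⟩ := hW.support₂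
  obtain ⟨B, hB0, hB⟩ := hw.exists_bound
  refine ⟨R + 1, fun ε hε hε1 x hx => ?_⟩
  rw [mollify_eq_mollifyDeriv_zero, ← norm_le_zero_iff]
  refine (norm_mollifyDeriv_le_of_bound hw hB hε (M := 0) ?_ (by norm_num)).trans (by simp)
  filter_upwards [hR] with y hy hyx
  rw [hy, norm_zero]
  have h1 := abs_sub_abs_le_abs_sub x y
  rw [abs_sub_comm] at h1
  linarith

/-- The shifted potential `λ - U` stays in the right half plane, at a distance of order `λ`. -/
theorem RoughPotential.exists_spectral_bounds (hW : RoughPotential ν ε₁ ε₂ V W₁ W₂)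
    (hV : RegularPotential N ν ε₁ V) (hN : 1 ≤ N) (hν : ∀ s, ν s < 0) (hε₂ : ∀ s, 0 < ε₂ s)
    (hw : IsMollifier w) (hα : ∀ s, 0 < α s) (hα₀ : 0 < α₀ ∧ α₀ < 1) :
    ∃ C : ℝ, 1 ≤ C ∧ ∀ᶠ lam in atTop, ∀ x ∈ carrier ν ε₁ ε₂ V lam,
      lam / 2 ≤ ((lam : ℂ) - (V x + mollifiedW w α α₀ W₁ W₂ lam x)).re ∧
      ‖(lam : ℂ) - (V x + mollifiedW w α α₀ W₁ W₂ lam x)‖ ≤ C * lam := by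
  choose C hC1 hC using fun s => hV.exists_im_le_lam (ε₂ := ε₂) hN hν hε₂ s
  obtain ⟨C', hC1', hC'⟩ := hW.exists_norm_le_lam hV hN hν hε₂
  obtain ⟨C₂, hC₂, hW₂⟩ := hW.exists_mollify₂_le (α₀ := α₀) hw
  -- Four real parts occur, those of V, of the two halves of W₁ and of W₂; an eighth of λ for each
  -- leaves λ/2.
  have hη : (0 : ℝ) < 1 / 8 := by norm_num
  have ho : ∀ᶠ lam : ℝ in atTop, C₂ * lam ^ (α₀ / 2) ≤ 1 / 8 * lam := by
    have h := eventually_rpow_neg_le (a := 1 - α₀ / 2) (b := 1 / (8 * C₂)) (by linarith)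
      (by positivity)
    filter_upwards [h, eventually_gt_atTop 0] with lam h1 h2
    rw [show -(1 - α₀ / 2) = α₀ / 2 - 1 by ring, Real.rpow_sub h2, Real.rpow_one,
      div_le_div_iff₀ h2 (by positivity)] at h1
    linarith
  refine ⟨2 + C .minus + C .plus + C' + C', by linarith [hC1 .minus, hC1 .plus], ?_⟩
  filter_upwards [hC .minus, hC .plus, hV.re_le_lam (ε₂ := ε₂) hN hν hε₂ .minus hη,
    hV.re_le_lam (ε₂ := ε₂) hN hν hε₂ .plus hη, hC', hW.re_le_lam_near hV hN hν hε₂ hη, ho,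
    eventually_ge_atTop 1, eventually_rpow_neg_le (hα .minus) one_pos,
    eventually_rpow_neg_le (hα .plus) one_pos] with lam h1 h2 h3 h4 h5 h6 h7 h8 h9 h10 x hx
  have hl : 0 < lam := by linarith
  have hpc : ∀ s : Side, lam ^ (-α s) ≤ 1 →
      |(mollify w (lam ^ (-α s)) (s.halfLine.indicator W₁) x).re| ≤ 1 / 8 * lam ∧
      |(mollify w (lam ^ (-α s)) (s.halfLine.indicator W₁) x).im| ≤ C' * lam := by
    intro s hs
    have hε : 0 < lam ^ (-α s) := Real.rpow_pos_of_pos hl _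
    constructor
    · refine abs_clm_mollify_le hw hε (hW.locallyIntegrable_indicator hV.continuous s)
        Complex.reCLM ?_
      filter_upwards [h6 x hx] with y hy hyx
      exact norm_indicator_clm_le Complex.reCLM (by positivity) (hy (hyx.trans hs))
    · refine abs_clm_mollify_le hw hε (hW.locallyIntegrable_indicator hV.continuous s)
        Complex.imCLM ?_
      filter_upwards [h5 x hx] with y hy hyx
      exact norm_indicator_clm_le Complex.imCLM (by positivity) (hy (hyx.trans hs)).2
  obtain ⟨a1, a2⟩ := hpc .minus h9
  obtain ⟨b1, b2⟩ := hpc .plus h10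
  have c1 := ((hW₂ lam h8 x).1).trans h7
  have c2 := (Complex.abs_re_le_norm _).trans c1
  have c3 := (Complex.abs_im_le_norm _).trans c1
  have hVb : |(V x).re| ≤ 1 / 8 * lam ∧ |(V x).im| ≤ (C .minus + C .plus) * lam := by
    have hCm := hC1 .minus
    have hCp := hC1 .plus
    obtain ⟨s, hs⟩ := Side.exists_nonneg x
    have hxs := hx s
    cases s
    · have e1 := h3 _ hs (by linarith)
      have e2 := h1 _ hs (by linarith)
      rw [Side.sgn_mul_sgn_mul] at e1 e2
      exact ⟨e1, by nlinarith⟩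
    · have e1 := h4 _ hs (by linarith)
      have e2 := h2 _ hs (by linarith)
      rw [Side.sgn_mul_sgn_mul] at e1 e2
      exact ⟨e1, by nlinarith⟩
  have hre : ((lam : ℂ) - (V x + mollifiedW w α α₀ W₁ W₂ lam x)).re = lam - ((V x).re +
      ((mollify w (lam ^ (-α .minus)) (Side.minus.halfLine.indicator W₁) x).re +
      (mollify w (lam ^ (-α .plus)) (Side.plus.halfLine.indicator W₁) x).re +
      (mollify w (lam ^ (-α₀)) W₂ x).re)) := by
    simp [mollifiedW]
  have him : ((lam : ℂ) - (V x + mollifiedW w α α₀ W₁ W₂ lam x)).im = -((V x).im +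
      ((mollify w (lam ^ (-α .minus)) (Side.minus.halfLine.indicator W₁) x).im +
      (mollify w (lam ^ (-α .plus)) (Side.plus.halfLine.indicator W₁) x).im +
      (mollify w (lam ^ (-α₀)) W₂ x).im)) := by
    simp [mollifiedW]
  rw [abs_le] at a1 a2 b1 b2 c2 c3
  have hV1 := abs_le.1 hVb.1
  have hV2 := abs_le.1 hVb.2
  refine ⟨by rw [hre]; linarith, (Complex.norm_le_abs_re_add_abs_im _).trans ?_⟩
  have k1 : |((lam : ℂ) - (V x + mollifiedW w α α₀ W₁ W₂ lam x)).re| ≤ 3 / 2 * lam := by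
    rw [hre, abs_le]; constructor <;> linarith
  have k2 : |((lam : ℂ) - (V x + mollifiedW w α α₀ W₁ W₂ lam x)).im| ≤
      (C .minus + C .plus + C' + C' + 1 / 8) * lam := by
    rw [him, abs_le]; constructor <;> linarith
  linarith

/-- Far out, averaging |Im W₁| ≤ (1 − θ)|Im V| over a distance ε replaces 1 − θ by (1 − θ)exp(Cε),
which is eventually at most 1 − θ/2. So the smoothed imaginary part keeps the sign of Im V and a
fixed fraction of its size. Near the origin everything is bounded except the mollification of W₂. -/
theorem RoughPotential.exists_im_mollified (hW : RoughPotential ν ε₁ ε₂ V W₁ W₂)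
    (hV : RegularPotential N ν ε₁ V) (hN : 1 ≤ N) (hν : ∀ s, ν s < 0)
    (hw : IsMollifier w) (hα : ∀ s, 0 < α s) (hα₀ : 0 < α₀ ∧ α₀ < 1) :
    ∃ R C c : ℝ, 1 ≤ R ∧ 1 ≤ C ∧ 0 < c ∧ ∀ᶠ lam in atTop,
      (∀ s : Side, ∀ d, R ≤ d → c * |(V (s.sgn * d)).im| ≤
        s.sgn * (V (s.sgn * d) + mollifiedW w α α₀ W₁ W₂ lam (s.sgn * d)).im) ∧
      ∀ x, |x| ≤ R → |(V x + mollifiedW w α α₀ W₁ W₂ lam x).im| ≤ C * lam ^ (α₀ / 2) := by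
  obtain ⟨θ, hθ0, hθ1, hθ⟩ := hW.im_le
  choose r C c hr hC hc him hK hL hg hb using fun s => hV.exists_im_le hN hν s
  obtain ⟨r₂, hr₂⟩ := hW.exists_mollify₂_eq_zero hw
  obtain ⟨C₂, hC₂, hW₂⟩ := hW.exists_mollify₂_le (α₀ := α₀) hw
  set R := max (max (r .minus) (r .plus)) (|r₂|) + 1 with hR
  have hrR : ∀ s, r s + 1 ≤ R := by
    intro s
    rw [hR]
    have h1 := le_max_left (max (r .minus) (r .plus)) (|r₂|)
    cases s
    · linarith [le_max_left (r .minus) (r .plus)]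
    · linarith [le_max_right (r .minus) (r .plus)]
  have hr₂R : r₂ < R := by
    rw [hR]
    linarith [le_max_right (max (r .minus) (r .plus)) (|r₂|), le_abs_self r₂]
  have hR1 : 1 ≤ R := by linarith [hrR .plus, hr .plus]
  obtain ⟨M, hM⟩ := (isCompact_Icc (a := -(R + 1)) (b := R + 1)).exists_bound_of_continuousOn
    hV.continuous.continuousOn
  have hM0 : 0 ≤ M := (norm_nonneg _).trans (hM 0 ⟨by linarith, by linarith⟩)
  -- for small mollification parameters, `Im V` hardly changes
  have hsmall : ∀ s, ∀ᶠ lam : ℝ in atTop,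
      (1 - θ) * Real.exp (C s * lam ^ (-α s)) ≤ 1 - θ / 2 := by
    intro s
    have ht : Tendsto (fun lam : ℝ => (1 - θ) * Real.exp (C s * lam ^ (-α s))) atTop
        (𝓝 ((1 - θ) * Real.exp (C s * 0))) :=
      ((Real.continuous_exp.tendsto _).comp
        ((tendsto_rpow_neg_atTop (hα s)).const_mul (C s))).const_mul (1 - θ)
    rw [mul_zero, Real.exp_zero, mul_one] at ht
    exact (ht.eventually_lt_const (by linarith)).mono fun _ h => h.le
  refine ⟨R, M + M + M + C₂, θ / 2, hR1, by linarith, by linarith, ?_⟩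
  filter_upwards [hsmall .minus, hsmall .plus, eventually_rpow_neg_le (hα .minus) one_pos,
    eventually_rpow_neg_le (hα .plus) one_pos, eventually_rpow_neg_le hα₀.1 one_pos,
    eventually_ge_atTop 1] with lam h1 h2 h3 h4 h5 h6
  have hl : 0 < lam := by linarith
  have hε : ∀ s, 0 < lam ^ (-α s) := fun s => Real.rpow_pos_of_pos hl _
  have hε₀ : 0 < lam ^ (-α₀) := Real.rpow_pos_of_pos hl _
  have hs1 : ∀ s, (1 - θ) * Real.exp (C s * lam ^ (-α s)) ≤ 1 - θ / 2 := by
    intro s; cases s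
    exacts [h1, h2]
  have hs2 : ∀ s, lam ^ (-α s) ≤ 1 := by
    intro s; cases s
    exacts [h3, h4]
  have hLI := fun s => hW.locallyIntegrable_indicator hV.continuous s
  -- the piece of the same side
  have same : ∀ s : Side, ∀ d, R ≤ d →
      |(mollify w (lam ^ (-α s)) (s.halfLine.indicator W₁) (s.sgn * d)).im| ≤
        (1 - θ / 2) * |(V (s.sgn * d)).im| := by
    intro s d hd
    refine abs_clm_mollify_le hw (hε s) (hLI s) Complex.imCLM ?_
    filter_upwards [hθ] with y hy hyx
    refine norm_indicator_clm_le Complex.imCLM (mul_nonneg (by linarith) (abs_nonneg _)) ?_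
    have e1 : |s.sgn * y - d| ≤ lam ^ (-α s) := by
      have := abs_sgn_mul_sub s y (s.sgn * d)
      rw [s.sgn_mul_sgn_mul] at this
      rwa [this]
    have e2 : r s ≤ s.sgn * y := by
      have := (abs_le.1 e1).1
      linarith [hrR s, hs2 s]
    have e3 := hL s d (s.sgn * y) (by linarith [hrR s]) e2
    rw [s.sgn_mul_sgn_mul] at e3
    calc |Complex.imCLM (W₁ y)| ≤ (1 - θ) * |(V y).im| := hy
      _ ≤ (1 - θ) * (Real.exp (C s * lam ^ (-α s)) * |(V (s.sgn * d)).im|) := by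
          refine mul_le_mul_of_nonneg_left (e3.trans ?_) (by linarith)
          gcongr
          exact hC s
      _ = (1 - θ) * Real.exp (C s * lam ^ (-α s)) * |(V (s.sgn * d)).im| := by ring
      _ ≤ _ := by
          gcongr
          exact hs1 s
  -- the piece of the opposite side
  have opp : ∀ s s' : Side, s'.sgn = -s.sgn → ∀ d, R ≤ d →
      (mollify w (lam ^ (-α s')) (s'.halfLine.indicator W₁) (s.sgn * d)).im = 0 := by
    intro s s' hss d hd
    rw [← abs_nonpos_iff]
    refine abs_clm_mollify_le hw (hε s') (hLI s') Complex.imCLM ?_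
    refine Eventually.of_forall fun y hyx => ?_
    rw [indicator_of_notMem]
    · simp
    · rw [s'.mem_halfLine, hss, not_lt]
      have e1 := abs_sgn_mul_sub s y (s.sgn * d)
      rw [s.sgn_mul_sgn_mul] at e1
      have := (abs_le.1 (e1.le.trans hyx)).1
      linarith [hs2 s']
  have zero₂ : ∀ s : Side, ∀ d, R ≤ d → mollify w (lam ^ (-α₀)) W₂ (s.sgn * d) = 0 := by
    intro s d hd
    refine hr₂ _ hε₀ h5 _ ?_
    rw [abs_mul, s.abs_sgn, one_mul, abs_of_nonneg (by linarith)]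
    linarith
  refine ⟨fun s d hd => ?_, fun x hx => ?_⟩
  · have hpos : |(V (s.sgn * d)).im| = s.sgn * (V (s.sgn * d)).im := by
      have := him s d (by linarith [hrR s])
      exact s.abs_eq_of_mem (by linarith [hc s])
    have e1 := same s d hd
    have e2 : ∀ t : ℝ, -|t| ≤ s.sgn * t := fun t => by
      have := neg_abs_le (s.sgn * t)
      rwa [abs_mul, s.abs_sgn, one_mul] at this
    have e3 := e2 (mollify w (lam ^ (-α s)) (s.halfLine.indicator W₁) (s.sgn * d)).im
    rw [Complex.add_im, mul_add, ← hpos, mollifiedW, zero₂ s d hd, add_zero, Complex.add_im]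
    cases s
    · rw [opp .minus .plus (by simp [Side.sgn]) d hd, add_zero]
      linarith
    · rw [opp .plus .minus (by simp [Side.sgn]) d hd, zero_add]
      linarith
  · have hpow : 1 ≤ lam ^ (α₀ / 2) := Real.one_le_rpow h6 (by linarith)
    have hVx : ∀ y, |y| ≤ R + 1 → |(V y).im| ≤ M := fun y hy =>
      (Complex.abs_im_le_norm _).trans (hM y (abs_le.1 hy))
    have hp : ∀ s : Side,
        |(mollify w (lam ^ (-α s)) (s.halfLine.indicator W₁) x).im| ≤ M := by
      intro s
      refine abs_clm_mollify_le hw (hε s) (hLI s) Complex.imCLM ?_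
      filter_upwards [hW.abs_im_le] with y hy hyx
      refine norm_indicator_clm_le Complex.imCLM hM0 (hy.trans (hVx y ?_))
      have := abs_add_le (y - x) x
      rw [sub_add_cancel] at this
      linarith [hs2 s]
    have hp₂ := (Complex.abs_im_le_norm _).trans (hW₂ lam h6 x).1
    have a0 := hVx x (by linarith)
    have a1 := hp .minus
    have a2 := hp .plus
    simp only [mollifiedW, Complex.add_im]
    calc _ ≤ M + (M + M + C₂ * lam ^ (α₀ / 2)) := by
          refine (abs_add_le _ _).trans (add_le_add a0 ((abs_add_le _ _).trans (add_le_add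
            ((abs_add_le _ _).trans (add_le_add a1 a2)) hp₂)))
      _ ≤ _ := by nlinarith

/-- The derivatives of the mollifications on the carrier. -/
theorem RoughPotential.exists_deriv_mollify_le (hW : RoughPotential ν ε₁ ε₂ V W₁ W₂)
    (hV : RegularPotential N ν ε₁ V) (hN : 1 ≤ N) (hν : ∀ s, ν s < 0) (hε₂ : ∀ s, 0 < ε₂ s)
    (hw : IsMollifier w) (hα : ∀ s, 0 < α s) (hα₀ : 0 < α₀ ∧ α₀ < 1) :
    ∃ M : ℝ, 1 ≤ M ∧ ∀ᶠ lam in atTop, ∀ x ∈ carrier ν ε₁ ε₂ V lam,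
      (∀ s : Side, ‖deriv (mollify w (lam ^ (-α s)) (s.halfLine.indicator W₁)) x‖ ≤
        M * lam / lam ^ (-α s)) ∧
      (∀ s : Side, ‖deriv (mollify w (lam ^ (-α s)) W₁) x‖ ≤ M * lam / lam ^ (-α s)) ∧
      ‖deriv (mollify w (lam ^ (-α₀)) W₂) x‖ ≤ M * lam / lam ^ (-α₀) := by
  obtain ⟨C', hC1', hC'⟩ := hW.exists_norm_le_lam hV hN hν hε₂
  obtain ⟨C₂, hC₂, hW₂⟩ := hW.exists_mollify₂_le (α₀ := α₀) hw
  obtain ⟨B, hB0, hB⟩ := hw.exists_bound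
  refine ⟨2 * B * C' + C₂, by nlinarith, ?_⟩
  filter_upwards [hC', eventually_ge_atTop 1, eventually_rpow_neg_le (hα .minus) one_pos,
    eventually_rpow_neg_le (hα .plus) one_pos] with lam h1 h2 h3 h4 x hx
  have hl : 0 < lam := by linarith
  have hε : ∀ s, 0 < lam ^ (-α s) := fun s => Real.rpow_pos_of_pos hl _
  have hs2 : ∀ s, lam ^ (-α s) ≤ 1 := by
    intro s; cases s
    exacts [h3, h4]
  have hBC : 0 ≤ 2 * B * C' := by positivity
  refine ⟨fun s => ?_, fun s => ?_, ?_⟩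
  · rw [deriv_mollify hw (hε s) (hW.locallyIntegrable_indicator hV.continuous s)]
    refine (norm_mollifyDeriv_le_of_bound hw hB (hε s) (M := C' * lam) ?_ (by norm_num)).trans ?_
    · filter_upwards [h1 x hx] with y hy hyx
      exact (norm_indicator_le_norm_self _ _).trans (hy (hyx.trans (hs2 s))).1
    · rw [pow_one, div_eq_mul_inv]
      calc _ = (2 * B * C') * lam * (lam ^ (-α s))⁻¹ := by ring
        _ ≤ _ := by
          have := (hε s).le
          gcongr
          linarith
  · rw [deriv_mollify hw (hε s) (hW.locallyIntegrable₁ hV.continuous)]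
    refine (norm_mollifyDeriv_le_of_bound hw hB (hε s) (M := C' * lam) ?_ (by norm_num)).trans ?_
    · filter_upwards [h1 x hx] with y hy hyx
      exact (hy (hyx.trans (hs2 s))).1
    · rw [pow_one, div_eq_mul_inv]
      calc _ = (2 * B * C') * lam * (lam ^ (-α s))⁻¹ := by ring
        _ ≤ _ := by
          have := (hε s).le
          gcongr
          linarith
  · refine ((hW₂ lam h2 x).2).trans ?_
    have : lam ^ (α₀ / 2) ≤ lam := by
      conv_rhs => rw [← Real.rpow_one lam]
      exact Real.rpow_le_rpow_of_exponent_le h2 (by linarith)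
    have h0 := Real.rpow_pos_of_pos hl (-α₀)
    gcongr
    linarith

end Mollified


/-! ### Cut-off exponentials and the action of the Schrödinger operator. -/

theorem LipAt.continuousAt {E : Type*} [NormedAddCommGroup E] {f : ℝ → E} {x : ℝ}
    (hf : LipAt f x) : ContinuousAt f x := by
  obtain ⟨K, t, ht, hK⟩ := hf
  exact hK.continuousOn.continuousAt ht

theorem isOpen_setOf_lipAt {E : Type*} [NormedAddCommGroup E] (f : ℝ → E) :
    IsOpen {x | LipAt f x} := by
  rw [isOpen_iff_mem_nhds]
  rintro x ⟨K, t, ht, hK⟩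
  filter_upwards [interior_mem_nhds.2 ht] with y hy
  exact ⟨K, t, mem_interior_iff_mem_nhds.1 hy, hK⟩

/-- The support of the cut-off may reach the ends of the closed interval, where derivatives require
an open neighbourhood. Being locally Lipschitz is an open condition, so by compactness it persists
on a slightly larger interval. -/
theorem exists_Ioo_lipAt {m : ℝ → ℂ} {a b : ℝ} (hab : a ≤ b) (hm : ∀ x ∈ Icc a b, LipAt m x) :
    ∃ a' b', a' < a ∧ b < b' ∧ ∀ x ∈ Ioo a' b', LipAt m x := by
  obtain ⟨δ, hδ, hsub⟩ := isCompact_Icc.exists_cthickening_subset_open (isOpen_setOf_lipAt m)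
    (s := Icc a b) (fun x hx => hm x hx)
  refine ⟨a - δ, b + δ, by linarith, by linarith, fun x hx => hsub ?_⟩
  rw [Metric.mem_cthickening_iff]
  rcases le_total x a with h | h
  · refine (Metric.infEDist_le_edist_of_mem (left_mem_Icc.2 hab)).trans ?_
    rw [edist_dist, Real.dist_eq, abs_of_nonpos (by linarith)]
    exact ENNReal.ofReal_le_ofReal (by linarith [hx.1])
  · rcases le_total x b with h' | h'
    · rw [Metric.infEDist_zero_of_mem (show x ∈ Icc a b from ⟨h, h'⟩)]; exact zero_le
    · refine (Metric.infEDist_le_edist_of_mem (right_mem_Icc.2 hab)).trans ?_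
      rw [edist_dist, Real.dist_eq, abs_of_nonneg (by linarith)]
      exact ENNReal.ofReal_le_ofReal (by linarith [hx.2])

section Exponential

variable {m : ℝ → ℂ} {a b : ℝ}

theorem hasDerivAt_exp_integral (h0 : (0 : ℝ) ∈ Ioo a b) (hm : ∀ x ∈ Ioo a b, LipAt m x) {x : ℝ}
    (hx : x ∈ Ioo a b) : HasDerivAt (fun y => Complex.exp (∫ t in (0 : ℝ)..y, m t))
      (m x * Complex.exp (∫ t in (0 : ℝ)..x, m t)) x := by
  have hc : ContinuousOn m (Ioo a b) := fun y hy => (hm y hy).continuousAt.continuousWithinAt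
  have hsub : uIcc 0 x ⊆ Ioo a b := by
    intro y hy
    rcases le_total 0 x with h | h
    · rw [uIcc_of_le h] at hy; exact ⟨h0.1.trans_le hy.1, hy.2.trans_lt hx.2⟩
    · rw [uIcc_of_ge h] at hy; exact ⟨hx.1.trans_le hy.1, hy.2.trans_lt h0.2⟩
  have := intervalIntegral.integral_hasDerivAt_right ((hc.mono hsub).intervalIntegrable)
    (hc.stronglyMeasurableAtFilter isOpen_Ioo x hx) (hm x hx).continuousAt
  rw [mul_comm]
  exact this.cexp

theorem lipAt_exp_integral (h0 : (0 : ℝ) ∈ Ioo a b) (hm : ∀ x ∈ Ioo a b, LipAt m x) {x : ℝ}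
    (hx : x ∈ Ioo a b) : LipAt (fun y => Complex.exp (∫ t in (0 : ℝ)..y, m t)) x := by
  refine lipAt_of_contDiffAt (contDiffAt_one_iff.2 ⟨fun y => ContinuousLinearMap.toSpanSingleton ℝ
    (m y * Complex.exp (∫ t in (0 : ℝ)..y, m t)), Ioo a b, isOpen_Ioo.mem_nhds hx, ?_,
    fun y hy => (hasDerivAt_exp_integral h0 hm hy).hasFDerivAt⟩)
  have hcl : Continuous fun z : ℂ => ContinuousLinearMap.toSpanSingleton ℝ z :=
    (ContinuousLinearMap.toSpanSingletonCLE (𝕜 := ℝ) (E := ℂ)).continuous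
  refine hcl.comp_continuousOn fun y hy => ?_
  exact ((hm y hy).continuousAt.mul
    (hasDerivAt_exp_integral h0 hm hy).continuousAt).continuousWithinAt

variable {ξ : ℝ → ℝ}

/-- A cut-off exponential has weak derivatives up to order two. -/
theorem isWeakDeriv_two_cutoff_exp (hξ : ContDiff ℝ ∞ ξ) (h0 : (0 : ℝ) ∈ Ioo a b)
    (hsupp : tsupport ξ ⊆ Ioo a b) (hm : ∀ x ∈ Ioo a b, LipAt m x) :
    ∃ f₁ : ℝ → ℂ,
      (∀ x, HasDerivAt (fun y => (ξ y : ℂ) * Complex.exp (∫ t in (0 : ℝ)..y, m t)) (f₁ x) x) ∧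
      LocallyLipschitz f₁ ∧ (∀ x, x ∉ tsupport ξ → f₁ x = 0) ∧
      ∀ᵐ x ∂volume, HasDerivAt f₁
        ((((deriv (deriv ξ) x : ℝ) : ℂ) + 2 * ((deriv ξ x : ℝ) : ℂ) * m x +
          (ξ x : ℂ) * (deriv m x + m x ^ 2)) * Complex.exp (∫ t in (0 : ℝ)..x, m t)) x := by
  set g : ℝ → ℂ := fun y => Complex.exp (∫ t in (0 : ℝ)..y, m t) with hg
  have hgd : ∀ x ∈ Ioo a b, HasDerivAt g (m x * g x) x := fun x hx =>
    hasDerivAt_exp_integral h0 hm hx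
  have hgl : ∀ x ∈ Ioo a b, LipAt g x := fun x hx => lipAt_exp_integral h0 hm hx
  have hξ1 : ContDiff ℝ ∞ (deriv ξ) := (contDiff_infty_iff_deriv.1 hξ).2
  have hξd : ∀ x, HasDerivAt (fun y => (ξ y : ℂ)) ((deriv ξ x : ℝ) : ℂ) x := fun x =>
    (hξ.differentiable (by simp) x).hasDerivAt.ofReal_comp
  have hξdd : ∀ x, HasDerivAt (fun y => ((deriv ξ y : ℝ) : ℂ)) ((deriv (deriv ξ) x : ℝ) : ℂ) x := fun x =>
    (hξ1.differentiable (by simp) x).hasDerivAt.ofReal_comp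
  have hout : ∀ x, x ∉ tsupport ξ → ∀ᶠ y in 𝓝 x, ξ y = 0 ∧ deriv ξ y = 0 := by
    intro x hx
    filter_upwards [(isClosed_tsupport ξ).isOpen_compl.mem_nhds hx] with y hy
    exact ⟨image_eq_zero_of_notMem_tsupport hy,
      image_eq_zero_of_notMem_tsupport fun h => hy (tsupport_deriv_subset h)⟩
  refine ⟨fun x => ((deriv ξ x : ℝ) : ℂ) * g x + (ξ x : ℂ) * (m x * g x), fun x => ?_, fun x => ?_,
    fun x hx => ?_, ?_⟩
  -- Outside the support nothing is known about m or the exponential, but there ξ vanishes in a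
  -- neighbourhood.
  · by_cases hx : x ∈ tsupport ξ
    · exact (hξd x).mul (hgd x (hsupp hx))
    · have h := hout x hx
      have h0 := h.self_of_nhds
      simp only [h0.1, h0.2, Complex.ofReal_zero, zero_mul, add_zero]
      refine (hasDerivAt_const x (0 : ℂ)).congr_of_eventuallyEq ?_
      filter_upwards [h] with y hy
      simp [hy.1]
  · change LipAt _ x
    by_cases hx : x ∈ tsupport ξ
    · have h1 : LipAt (fun y => (ξ y : ℂ)) x :=
        locallyLipschitz_ofReal (hξ.of_le (by simp)) x
      have h2 : LipAt (fun y => ((deriv ξ y : ℝ) : ℂ)) x :=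
        locallyLipschitz_ofReal (hξ1.of_le (by simp)) x
      exact (h2.mul (hgl x (hsupp hx))).add (h1.mul ((hm x (hsupp hx)).mul (hgl x (hsupp hx))))
    · refine (lipAt_const (0 : ℂ) x).congr ?_
      filter_upwards [hout x hx] with y hy
      simp [hy.1, hy.2]
  · have h := (hout x hx).self_of_nhds
    simp [h.1, h.2]
  · filter_upwards [ae_differentiableAt_of_lipAt hm] with x hxm
    by_cases hx : x ∈ tsupport ξ
    · have hmd := (hxm (hsupp hx)).hasDerivAt
      have hgx := hgd x (hsupp hx)
      refine (((hξdd x).mul hgx).add ((hξd x).mul (hmd.mul hgx))).congr_deriv ?_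
      simp only [Pi.mul_apply, hg]
      ring
    · have h := hout x hx
      have h2 : deriv (deriv ξ) x = 0 := by
        have : deriv ξ =ᶠ[𝓝 x] fun _ => 0 := h.mono fun y hy => hy.2
        rw [this.deriv_eq, deriv_const]
      rw [h.self_of_nhds.1, h.self_of_nhds.2, h2]
      simp only [Complex.ofReal_zero, zero_mul, mul_zero, add_zero]
      refine (hasDerivAt_const x (0 : ℂ)).congr_of_eventuallyEq ?_
      filter_upwards [h] with y hy
      simp [hy.1, hy.2]

theorem memLp_of_bound_of_support {f : ℝ → ℂ} {R C : ℝ} (hf : AEStronglyMeasurable f volume)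
    (hb : ∀ᵐ x ∂volume, |x| ≤ R → ‖f x‖ ≤ C) (hs : ∀ᵐ x ∂volume, R < |x| → f x = 0) :
    MemLp f 2 volume := by
  have h1 : MemLp ((Icc (-R) R).indicator fun _ => (C : ℝ)) 2 volume :=
    memLp_indicator_const 2 measurableSet_Icc C (Or.inr measure_Icc_lt_top.ne)
  refine h1.mono hf ?_
  filter_upwards [hb, hs] with x hx hx'
  by_cases h : |x| ≤ R
  · rw [indicator_of_mem (show x ∈ Icc (-R) R from abs_le.1 h)]
    exact (hx h).trans (le_abs_self C)
  · rw [hx' (not_le.1 h), norm_zero]; exact norm_nonneg _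

/-- The action of the Schrödinger operator on a cut-off exponential. -/
theorem schrodinger_cutoff_exp {V W₁ W₂ : ℝ → ℂ} (hV : Continuous V)
    (hW₁ : AEStronglyMeasurable W₁ volume)
    (hW₁b : ∀ R : ℝ, ∃ C : ℝ, 0 ≤ C ∧ ∀ᵐ x ∂volume, |x| ≤ R → ‖W₁ x‖ ≤ C)
    (hW₂ : MemLp W₂ 2 volume) (hξ : ContDiff ℝ ∞ ξ) (hξc : HasCompactSupport ξ)
    (h0 : (0 : ℝ) ∈ Ioo a b)
    (hsupp : tsupport ξ ⊆ Ioo a b) (hm : ∀ x ∈ Ioo a b, LipAt m x) {f : ℝ → ℂ}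
    (hf : f = fun y => (ξ y : ℂ) * Complex.exp (∫ t in (0 : ℝ)..y, m t)) :
    Continuous f ∧ MemLp f 2 volume ∧ f ∈ schrodingerDomain (fun y => V y + (W₁ y + W₂ y)) ∧
    ∀ lam : ℂ, (fun x => schrodinger (fun y => V y + (W₁ y + W₂ y)) f x - lam * f x)
      =ᵐ[volume] fun x => -((((deriv (deriv ξ) x : ℝ) : ℂ) + 2 * ((deriv ξ x : ℝ) : ℂ) * m x) *
          Complex.exp (∫ t in (0 : ℝ)..x, m t)) +
        (V x + (W₁ x + W₂ x) - lam - (deriv m x + m x ^ 2)) * f x := by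
  obtain ⟨f₁, hd, hl, hz, hdd⟩ := isWeakDeriv_two_cutoff_exp hξ h0 hsupp hm
  rw [← hf] at hd
  set h2 : ℝ → ℂ := fun x => (((deriv (deriv ξ) x : ℝ) : ℂ) + 2 * ((deriv ξ x : ℝ) : ℂ) * m x +
          (ξ x : ℂ) * (deriv m x + m x ^ 2)) * Complex.exp (∫ t in (0 : ℝ)..x, m t) with hh2
  have hcont : Continuous f := continuous_iff_continuousAt.2 fun x => (hd x).continuousAt
  obtain ⟨R, hR⟩ := hξc.isCompact.isBounded.subset_closedBall 0
  have hfar : ∀ x, R < |x| → x ∉ tsupport ξ := by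
    intro x hx h
    have := hR h
    simp only [Metric.mem_closedBall, dist_zero_right, Real.norm_eq_abs] at this
    linarith
  have hf0 : ∀ x, R < |x| → f x = 0 := fun x hx => by
    rw [hf]; simp [image_eq_zero_of_notMem_tsupport (hfar x hx)]
  obtain ⟨F, hF⟩ := (isCompact_Icc (a := -R) (b := R)).exists_bound_of_continuousOn
    hcont.continuousOn
  have hfb : ∀ x, |x| ≤ R → ‖f x‖ ≤ F := fun x hx => hF x (abs_le.1 hx)
  have hfall : ∀ x, ‖f x‖ ≤ |F| := fun x => by
    by_cases h : |x| ≤ R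
    · exact (hfb x h).trans (le_abs_self F)
    · rw [hf0 x (not_le.1 h), norm_zero]; exact abs_nonneg F
  have hf2 : MemLp f 2 volume := memLp_of_bound_of_support hcont.aestronglyMeasurable
    (Eventually.of_forall hfb) (Eventually.of_forall hf0)
  have hh2ae : deriv f₁ =ᵐ[volume] h2 := by
    filter_upwards [hdd] with x hx using hx.deriv
  have hh2L : MemLp h2 2 volume := by
    refine (memLp_congr_ae hh2ae).1 ?_
    obtain ⟨C, hC, hC'⟩ := exists_norm_deriv_le_of_locallyLipschitz hl R
    refine memLp_of_bound_of_support (measurable_deriv f₁).aestronglyMeasurable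
      (Eventually.of_forall hC') (Eventually.of_forall fun x hx => ?_)
    have : f₁ =ᶠ[𝓝 x] fun _ => 0 := by
      filter_upwards [(isClosed_tsupport ξ).isOpen_compl.mem_nhds (hfar x hx)] with y hy
      exact hz y hy
    rw [this.deriv_eq, deriv_const]
  have hVf : MemLp (fun x => V x * f x) 2 volume := by
    obtain ⟨C, hC⟩ := (isCompact_Icc (a := -R) (b := R)).exists_bound_of_continuousOn
      (hV.mul hcont).continuousOn
    exact memLp_of_bound_of_support (hV.mul hcont).aestronglyMeasurable
      (Eventually.of_forall fun x hx => hC x (abs_le.1 hx))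
      (Eventually.of_forall fun x hx => by rw [hf0 x hx, mul_zero])
  have hW1f : MemLp (fun x => W₁ x * f x) 2 volume := by
    obtain ⟨C, hC0, hC⟩ := hW₁b R
    refine memLp_of_bound_of_support (hW₁.mul hcont.aestronglyMeasurable) (R := R)
      (C := C * F) ?_ (Eventually.of_forall fun x hx => by rw [hf0 x hx, mul_zero])
    filter_upwards [hC] with x hx hxR
    rw [norm_mul]
    exact mul_le_mul (hx hxR) (hfb x hxR) (norm_nonneg _) hC0
  -- W₂ is merely square-integrable, so here the boundedness of f is used; for V and W₁ it is local
  -- boundedness and the compact support of f.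
  have hW2f : MemLp (fun x => W₂ x * f x) 2 volume := by
    refine (hW₂.const_mul ((|F| : ℝ) : ℂ)).mono (hW₂.1.mul hcont.aestronglyMeasurable) ?_
    refine Eventually.of_forall fun x => ?_
    rw [norm_mul, norm_mul, mul_comm, Complex.norm_real, Real.norm_eq_abs, abs_abs]
    exact mul_le_mul_of_nonneg_right (hfall x) (norm_nonneg _)
  have hUf : MemLp (fun x => (V x + (W₁ x + W₂ x)) * f x) 2 volume := by
    refine (hVf.add (hW1f.add hW2f)).ae_eq (Eventually.of_forall fun x => ?_)
    simp only [Pi.add_apply]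
    ring
  have himg : IsSchrodingerImage (fun y => V y + (W₁ y + W₂ y)) f
      (fun x => (V x + (W₁ x + W₂ x)) * f x - h2 x) := by
    refine ⟨hf2, hUf.sub hh2L, ?_⟩
    simp only [sub_sub_cancel]
    exact isWeakDeriv_two_of_locallyLipschitz hd hl hdd
  refine ⟨hcont, hf2, ⟨_, himg⟩, fun lam => ?_⟩
  filter_upwards [schrodinger_ae_eq himg] with x hx
  rw [hx, hh2, hf]
  ring

end Exponential

/-! ### The principal root and the WKB remainder. -/

section Root

theorem cpow_half_sq {z : ℂ} : (z ^ (1 / 2 : ℂ)) ^ 2 = z := by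
  rw [← Complex.cpow_nat_mul]; norm_num

theorem norm_cpow_half (z : ℂ) : ‖z ^ (1 / 2 : ℂ)‖ = Real.sqrt ‖z‖ := by
  rw [← Real.sqrt_sq (norm_nonneg (z ^ (1 / 2 : ℂ))), ← norm_pow, cpow_half_sq]

theorem cpow_half_re_bounds (z : ℂ) :
    Real.sqrt z.re ≤ (z ^ (1 / 2 : ℂ)).re ∧ (z ^ (1 / 2 : ℂ)).re ≤ Real.sqrt ‖z‖ := by
  rw [one_div, Complex.cpow_inv_two_re]
  have := Complex.re_le_norm z
  exact ⟨Real.sqrt_le_sqrt (by linarith), Real.sqrt_le_sqrt (by linarith)⟩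

/-- As the principal root has nonnegative real part, the sign of Im z passes to the imaginary part
of the root, and thus to growth or decay of the exponential. -/
theorem two_mul_re_mul_im_cpow_half (z : ℂ) :
    2 * ((z ^ (1 / 2 : ℂ)).re * (z ^ (1 / 2 : ℂ)).im) = z.im := by
  conv_rhs => rw [← cpow_half_sq (z := z)]
  rw [sq, Complex.mul_im]
  ring

variable {U : ℝ → ℂ} {lam : ℝ}

/-- The logarithmic derivative of the approximate solution of order `n`. -/
def logDeriv (U : ℝ → ℂ) (n : ℕ) (lam : ℝ) (x : ℝ) : ℂ :=
  match n with
  | 0 => -Complex.I * ((lam : ℂ) - U x) ^ (1 / 2 : ℂ)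
  | _ => -Complex.I * ((lam : ℂ) - U x) ^ (1 / 2 : ℂ) + 1 / 4 * (deriv U x / ((lam : ℂ) - U x))

theorem lipAt_root {x : ℝ} (hU : LipAt U x) (hx : 0 < ((lam : ℂ) - U x).re) :
    LipAt (fun y => -Complex.I * ((lam : ℂ) - U y) ^ (1 / 2 : ℂ)) x := by
  refine LipAt.comp_contDiffAt (f := U)
    (F := fun z => -Complex.I * ((lam : ℂ) - z) ^ (1 / 2 : ℂ)) ?_ hU
  have h : ContDiffAt ℂ 1 (fun z : ℂ => -Complex.I * ((lam : ℂ) - z) ^ (1 / 2 : ℂ)) (U x) := by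
    refine contDiffAt_const.mul (AnalyticAt.contDiffAt ?_)
    exact (analyticAt_const.sub analyticAt_id).cpow analyticAt_const (Or.inl hx)
  exact h.restrict_scalars ℝ

theorem lipAt_logDeriv {n : ℕ} {x : ℝ} (hU : LipAt U x) (hU' : n = 1 → LipAt (deriv U) x)
    (hn : n ≤ 1) (hx : 0 < ((lam : ℂ) - U x).re) : LipAt (logDeriv U n lam) x := by
  interval_cases n
  · exact lipAt_root hU hx
  · refine (lipAt_root hU hx).add ?_
    refine (lipAt_const (1 / 4 : ℂ) x).mul ?_
    refine LipAt.comp_contDiffAt (f := fun y => (deriv U y, U y))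
      (F := fun p : ℂ × ℂ => p.1 / ((lam : ℂ) - p.2)) ?_ ((hU' rfl).prodMk hU)
    have h1 : ContDiffAt ℝ 1 (fun p : ℂ × ℂ => p.1) (deriv U x, U x) := contDiffAt_fst
    have h2 : ContDiffAt ℝ 1 (fun p : ℂ × ℂ => (lam : ℂ) - p.2) (deriv U x, U x) :=
      contDiffAt_const.sub contDiffAt_snd
    have h3 : (lam : ℂ) - U x ≠ 0 := fun h => by
      rw [h] at hx
      simp at hx
    simp only [div_eq_mul_inv]
    exact h1.mul (h2.inv h3)

theorem hasDerivAt_root {x : ℝ} (hU : DifferentiableAt ℝ U x)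
    (hx : 0 < ((lam : ℂ) - U x).re) :
    HasDerivAt (fun y => ((lam : ℂ) - U y) ^ (1 / 2 : ℂ))
      (-deriv U x / (2 * ((lam : ℂ) - U x) ^ (1 / 2 : ℂ))) x := by
  have h1 : HasDerivAt (fun y => (lam : ℂ) - U y) (-deriv U x) x :=
    hU.hasDerivAt.const_sub _
  have h2 : HasDerivAt (fun z : ℂ => z ^ (1 / 2 : ℂ))
      ((1 / 2 : ℂ) * ((lam : ℂ) - U x) ^ ((1 / 2 : ℂ) - 1) * 1) ((lam : ℂ) - U x) :=
    (hasDerivAt_id ((lam : ℂ) - U x)).cpow_const (Or.inl hx)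
  refine (HasDerivAt.comp_of_eq (𝕜 := ℝ) (𝕜' := ℂ) (h₂ := fun z : ℂ => z ^ (1 / 2 : ℂ)) x h2 h1 rfl).congr_deriv ?_
  have hz : (lam : ℂ) - U x ≠ 0 := fun h => by rw [h] at hx; simp at hx
  have hS : ((lam : ℂ) - U x) ^ (1 / 2 : ℂ) ≠ 0 := by
    rw [Complex.cpow_ne_zero_iff]; exact Or.inl hz
  rw [Complex.cpow_sub _ _ hz, Complex.cpow_one]
  nth_rewrite 2 [← cpow_half_sq (z := (lam : ℂ) - U x)]
  field_simp

/-- The remainder of the expansion of order `n`. -/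
def remainderSize (U : ℝ → ℂ) (n : ℕ) (lam : ℝ) (x : ℝ) : ℝ :=
  match n with
  | 0 => lam ^ (-(1 / 2) : ℝ) * ‖deriv U x‖
  | _ => lam⁻¹ * ‖deriv (deriv U) x‖ + 2 * ((lam ^ 2)⁻¹ * ‖deriv U x‖ ^ 2)

/-- Let S² = λ − U. For m = −iS, m² cancels U − λ and the remainder is −m' = −iU'/(2S). With A =
U'/(4S²) added, the derivative of −iS cancels against −2iSA, and −(A' + A²) = −U''/(4S²) −
5U'²/(16S⁴) remains. The powers of λ come from |S|² ≥ λ/2. -/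
theorem norm_remainder_le {n : ℕ} (hn : n ≤ 1) {x : ℝ} (hlam : 0 < lam)
    (hU : DifferentiableAt ℝ U x)
    (hU' : n = 1 → DifferentiableAt ℝ (deriv U) x)
    (hx : lam / 2 ≤ ((lam : ℂ) - U x).re) :
    ‖U x - lam - (deriv (logDeriv U n lam) x + logDeriv U n lam x ^ 2)‖ ≤
      remainderSize U n lam x := by
  have hx0 : 0 < ((lam : ℂ) - U x).re := by linarith
  set z := (lam : ℂ) - U x with hz
  have hzn : lam / 2 ≤ ‖z‖ := hx.trans (Complex.re_le_norm z)
  have hz0 : z ≠ 0 := fun h => by rw [h] at hx0; simp at hx0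
  have hS0 : z ^ (1 / 2 : ℂ) ≠ 0 := by
    rw [Complex.cpow_ne_zero_iff]; exact Or.inl hz0
  have hS2 : (z ^ (1 / 2 : ℂ)) ^ 2 = z := cpow_half_sq
  have hroot := (hasDerivAt_root hU hx0).const_mul (-Complex.I)
  rw [← hz] at hroot
  interval_cases n
  · have hd : deriv (logDeriv U 0 lam) x = -Complex.I * (-deriv U x / (2 * z ^ (1 / 2 : ℂ))) :=
      hroot.deriv
    have e : U x - lam - (deriv (logDeriv U 0 lam) x + logDeriv U 0 lam x ^ 2) =
        -(Complex.I * deriv U x / (2 * z ^ (1 / 2 : ℂ))) := by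
      rw [hd]
      simp only [logDeriv, ← hz]
      rw [mul_pow, hS2, neg_sq, Complex.I_sq, show U x - lam = -z by rw [hz]; ring]
      ring
    rw [e, norm_neg, norm_div, norm_mul, Complex.norm_I, one_mul, norm_mul, norm_cpow_half]
    simp only [remainderSize, Complex.norm_ofNat]
    have h2 : lam ^ (1 / 2 : ℝ) ≤ 2 * Real.sqrt ‖z‖ := by
      rw [← Real.sqrt_eq_rpow, Real.sqrt_le_left (by positivity), mul_pow,
        Real.sq_sqrt (norm_nonneg _)]
      linarith
    rw [Real.rpow_neg hlam.le, inv_mul_eq_div]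
    have := Real.rpow_pos_of_pos hlam (1 / 2)
    gcongr
  · have hA : HasDerivAt (fun y => (1 / 4 : ℂ) * (deriv U y / ((lam : ℂ) - U y)))
        ((1 / 4 : ℂ) * ((deriv (deriv U) x * z - deriv U x * -deriv U x) / z ^ 2)) x := by
      have h1 : HasDerivAt (fun y => (lam : ℂ) - U y) (-deriv U x) x :=
        hU.hasDerivAt.const_sub _
      exact ((hU' rfl).hasDerivAt.div h1 hz0).const_mul _
    have hd : deriv (logDeriv U 1 lam) x = _ := (hroot.add hA).deriv
    have e : U x - lam - (deriv (logDeriv U 1 lam) x + logDeriv U 1 lam x ^ 2) =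
        -(1 / 4 * (deriv (deriv U) x / z) + 5 / 16 * (deriv U x ^ 2 / z ^ 2)) := by
      rw [hd]
      simp only [logDeriv, ← hz]
      rw [show U x - lam = -z by rw [hz]; ring]
      have hI := Complex.I_sq
      have : ∀ S : ℂ, S ≠ 0 → S ^ 2 = z → -z - (-Complex.I * (-deriv U x / (2 * S)) +
          1 / 4 * ((deriv (deriv U) x * z - deriv U x * -deriv U x) / z ^ 2) +
          (-Complex.I * S + 1 / 4 * (deriv U x / z)) ^ 2) =
          -(1 / 4 * (deriv (deriv U) x / z) + 5 / 16 * (deriv U x ^ 2 / z ^ 2)) := by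
        intro S hS hSz
        rw [← hSz]
        field_simp
        linear_combination (-512 * S ^ 6) * hI
      exact this _ hS0 hS2
    rw [e, norm_neg]
    simp only [remainderSize]
    refine (norm_add_le _ _).trans ?_
    simp only [norm_mul, norm_div, norm_pow, norm_one, Complex.norm_ofNat]
    have h1 : ‖deriv (deriv U) x‖ / ‖z‖ ≤ ‖deriv (deriv U) x‖ / (lam / 2) := by gcongr
    have h2 : ‖deriv U x‖ ^ 2 / ‖z‖ ^ 2 ≤ ‖deriv U x‖ ^ 2 / (lam / 2) ^ 2 := by gcongr
    have h3 : ‖deriv (deriv U) x‖ / (lam / 2) = 2 * (lam⁻¹ * ‖deriv (deriv U) x‖) := by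
      field_simp
    have h4 : ‖deriv U x‖ ^ 2 / (lam / 2) ^ 2 = 4 * ((lam ^ 2)⁻¹ * ‖deriv U x‖ ^ 2) := by
      field_simp; norm_num
    rw [h3] at h1
    rw [h4] at h2
    have h5 : 0 ≤ lam⁻¹ * ‖deriv (deriv U) x‖ := by positivity
    have h6 : 0 ≤ (lam ^ 2)⁻¹ * ‖deriv U x‖ ^ 2 := by positivity
    linarith

end Root


/-! ### The modulus of the approximate solution. -/

/-- The central part contributes at most R · (1/R), everything beyond it at most zero, and the strip
[p, p'] at most −μ times its length. -/
theorem integral_le_of_decay {ψ : ℝ → ℝ} {R p p' δ μ : ℝ} (hR : 0 < R) (hp : R ≤ p) (hpp : p ≤ p')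
    (hδ : p' ≤ δ) (hψ : ContinuousOn ψ (Icc 0 δ)) (h1 : ∀ t ∈ Icc 0 R, ψ t ≤ 1 / R)
    (h2 : ∀ t ∈ Icc R δ, ψ t ≤ 0) (h3 : ∀ t ∈ Icc p p', ψ t ≤ -μ) :
    (∀ d ∈ Icc 0 δ, ∫ t in (0 : ℝ)..d, ψ t ≤ 1) ∧
      ∀ d ∈ Icc p' δ, ∫ t in (0 : ℝ)..d, ψ t ≤ 1 - μ * (p' - p) := by
  have hi : ∀ a ∈ Icc 0 δ, ∀ b ∈ Icc 0 δ, IntervalIntegrable ψ volume a b := fun a ha b hb =>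
    (hψ.mono (uIcc_subset_Icc ha hb)).intervalIntegrable
  have hδR : R ≤ δ := by linarith
  have z0 : (0 : ℝ) ∈ Icc 0 δ := ⟨le_rfl, by linarith⟩
  have small : ∀ d ∈ Icc 0 R, ∫ t in (0 : ℝ)..d, ψ t ≤ 1 := by
    intro d hd
    have h := intervalIntegral.integral_mono_on hd.1 (hi 0 z0 d ⟨hd.1, hd.2.trans hδR⟩)
      (intervalIntegrable_const (c := 1 / R)) fun t ht => h1 t ⟨ht.1, ht.2.trans hd.2⟩
    rw [intervalIntegral.integral_const, smul_eq_mul, sub_zero, mul_one_div] at h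
    exact h.trans ((div_le_one hR).2 hd.2)
  have nonpos : ∀ a ∈ Icc R δ, ∀ b ∈ Icc a δ, ∫ t in a..b, ψ t ≤ 0 := by
    intro a ha b hb
    have h := intervalIntegral.integral_mono_on hb.1
      (hi a ⟨hR.le.trans ha.1, ha.2⟩ b ⟨(hR.le.trans ha.1).trans hb.1, hb.2⟩)
      (intervalIntegrable_const (c := (0 : ℝ))) fun t ht => h2 t ⟨ha.1.trans ht.1, ht.2.trans hb.2⟩
    simpa using h
  have hRm : R ∈ Icc 0 δ := ⟨hR.le, hδR⟩
  have hpm : p ∈ Icc 0 δ := ⟨by linarith, by linarith⟩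
  have hpm' : p' ∈ Icc 0 δ := ⟨by linarith, by linarith⟩
  refine ⟨fun d hd => ?_, fun d hd => ?_⟩
  · rcases le_total d R with h | h
    · exact small d ⟨hd.1, h⟩
    · rw [← intervalIntegral.integral_add_adjacent_intervals (hi 0 z0 R hRm) (hi R hRm d hd)]
      linarith [small R ⟨hR.le, le_rfl⟩, nonpos R ⟨le_rfl, hδR⟩ d ⟨h, hd.2⟩]
  · have hd' : d ∈ Icc 0 δ := ⟨hpm'.1.trans hd.1, hd.2⟩
    rw [← intervalIntegral.integral_add_adjacent_intervals (hi 0 z0 p' hpm') (hi p' hpm' d hd'),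
      ← intervalIntegral.integral_add_adjacent_intervals (hi 0 z0 p hpm) (hi p hpm p' hpm'),
      ← intervalIntegral.integral_add_adjacent_intervals (hi 0 z0 R hRm) (hi R hRm p hpm)]
    have h := intervalIntegral.integral_mono_on hpp (hi p hpm p' hpm')
      (intervalIntegrable_const (c := -μ)) h3
    rw [intervalIntegral.integral_const, smul_eq_mul] at h
    linarith [small R ⟨hR.le, le_rfl⟩, nonpos R ⟨le_rfl, hδR⟩ p ⟨hp, hpm.2⟩,
      nonpos p' ⟨hp.trans hpp, hδ⟩ d hd]

section Wkb

variable {U : ℝ → ℂ} {lam a b C : ℝ} {n : ℕ}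

theorem re_logDeriv_zero (x : ℝ) :
    (logDeriv U 0 lam x).re = (((lam : ℂ) - U x) ^ (1 / 2 : ℂ)).im := by
  simp [logDeriv]

theorem re_logDeriv_zero_mul (x : ℝ) :
    2 * ((((lam : ℂ) - U x) ^ (1 / 2 : ℂ)).re * (logDeriv U 0 lam x).re) = -(U x).im := by
  rw [re_logDeriv_zero, two_mul_re_mul_im_cpow_half]
  simp

theorem re_integral_logDeriv_zero (hm : ∀ x ∈ Icc a b, LipAt U x)
    (h0 : (0 : ℝ) ∈ Icc a b) (hre : ∀ x ∈ Icc a b, 0 < ((lam : ℂ) - U x).re) {x : ℝ}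
    (hx : x ∈ Icc a b) :
    (∫ t in (0 : ℝ)..x, logDeriv U 0 lam t).re = ∫ t in (0 : ℝ)..x, (logDeriv U 0 lam t).re := by
  have hc : ContinuousOn (logDeriv U 0 lam) (uIcc 0 x) := fun y hy => by
    have hy' := uIcc_subset_Icc h0 hx hy
    exact (lipAt_logDeriv (hm y hy') (by simp) zero_le_one
      (hre y hy')).continuousAt.continuousWithinAt
  exact (Complex.reCLM.intervalIntegral_comp_comm hc.intervalIntegrable).symm

/-- The amplitude factor is `((λ - U(0)) / (λ - U(x)))^{1/4}` in absolute value. -/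
theorem integral_amplitude (hU : ∀ x ∈ Icc a b, LipAt U x ∧ LipAt (deriv U) x ∧
      DifferentiableAt ℝ U x) (h0 : (0 : ℝ) ∈ Icc a b)
    (hre : ∀ x ∈ Icc a b, 0 < ((lam : ℂ) - U x).re) {x : ℝ} (hx : x ∈ Icc a b) :
    IntervalIntegrable (fun t => 1 / 4 * (deriv U t / ((lam : ℂ) - U t))) volume 0 x ∧
    (∫ t in (0 : ℝ)..x, 1 / 4 * (deriv U t / ((lam : ℂ) - U t))).re =
      1 / 4 * (Real.log ‖(lam : ℂ) - U 0‖ - Real.log ‖(lam : ℂ) - U x‖) := by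
  have hsub := uIcc_subset_Icc h0 hx
  have hne : ∀ y ∈ Icc a b, (lam : ℂ) - U y ≠ 0 := fun y hy h => by
    have := hre y hy
    rw [h] at this
    simp at this
  have hc : ContinuousOn (fun t => 1 / 4 * (deriv U t / ((lam : ℂ) - U t))) (uIcc 0 x) :=
    fun y hy => by
      obtain ⟨h1, h2, -⟩ := hU y (hsub hy)
      exact (continuousAt_const.mul (h2.continuousAt.div
        (continuousAt_const.sub h1.continuousAt) (hne y (hsub hy)))).continuousWithinAt
  refine ⟨hc.intervalIntegrable, ?_⟩
  have hd : ∀ y ∈ uIcc 0 x, HasDerivAt (fun t => -(1 / 4) * Complex.log ((lam : ℂ) - U t))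
      (1 / 4 * (deriv U y / ((lam : ℂ) - U y))) y := by
    intro y hy
    have h1 : HasDerivAt (fun t => (lam : ℂ) - U t) (-deriv U y) y :=
      (hU y (hsub hy)).2.2.hasDerivAt.const_sub _
    have h2 := (h1.clog_real (Or.inl (hre y (hsub hy)))).const_mul (-(1 / 4) : ℂ)
    refine h2.congr_deriv ?_
    ring
  rw [intervalIntegral.integral_eq_sub_of_hasDerivAt hd hc.intervalIntegrable]
  have e : -(1 / 4) * Complex.log ((lam : ℂ) - U x) - -(1 / 4) * Complex.log ((lam : ℂ) - U 0) =
      ((1 / 4 : ℝ) : ℂ) *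
        (Complex.log ((lam : ℂ) - U 0) - Complex.log ((lam : ℂ) - U x)) := by
    push_cast; ring
  rw [e, Complex.re_ofReal_mul, Complex.sub_re, Complex.log_re, Complex.log_re]

/-- The ratio of the two numbers is at most 2C, and log t ≤ t. -/
theorem abs_log_sub_log_le (hlam : 0 < lam) (hC : 1 ≤ C) {y z : ℝ} (hy : lam / 2 ≤ y)
    (hy' : y ≤ C * lam) (hz : lam / 2 ≤ z) (hz' : z ≤ C * lam) :
    |Real.log y - Real.log z| ≤ 2 * C := by
  have key : ∀ u v : ℝ, lam / 2 ≤ u → u ≤ C * lam → lam / 2 ≤ v → v ≤ C * lam →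
      Real.log u - Real.log v ≤ 2 * C := by
    intro u v hu hu' hv hv'
    have hu0 : 0 < u := by linarith
    have hv0 : 0 < v := by linarith
    rw [← Real.log_div hu0.ne' hv0.ne']
    refine (Real.log_le_self (by positivity)).trans ?_
    rw [div_le_iff₀ hv0]
    nlinarith
  rw [abs_le]
  exact ⟨by linarith [key z y hz hz' hy hy'], key y z hy hy' hz hz'⟩

/-- The amplitude factor is a quarter power of a ratio of two numbers of order λ, so it changes the
exponent by a bounded amount. Decay need only be proved for the leading term. -/
theorem re_integral_logDeriv (hn : n ≤ 1) (hU : ∀ x ∈ Icc a b, LipAt U x)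
    (hU' : n = 1 → ∀ x ∈ Icc a b, LipAt (deriv U) x ∧ DifferentiableAt ℝ U x)
    (h0 : (0 : ℝ) ∈ Icc a b) (hlam : 0 < lam) (hC : 1 ≤ C)
    (hre : ∀ x ∈ Icc a b, lam / 2 ≤ ((lam : ℂ) - U x).re ∧ ‖(lam : ℂ) - U x‖ ≤ C * lam) {x : ℝ}
    (hx : x ∈ Icc a b) :
    |(∫ t in (0 : ℝ)..x, logDeriv U n lam t).re -
      ∫ t in (0 : ℝ)..x, (logDeriv U 0 lam t).re| ≤ C := by
  have hpos : ∀ x ∈ Icc a b, 0 < ((lam : ℂ) - U x).re := fun x hx => by linarith [(hre x hx).1]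
  have hzero := re_integral_logDeriv_zero hU h0 hpos hx
  interval_cases n
  · rw [hzero, sub_self, abs_zero]; linarith
  · have hc : ContinuousOn (logDeriv U 0 lam) (uIcc 0 x) := fun y hy => by
      have hy' := uIcc_subset_Icc h0 hx hy
      exact (lipAt_logDeriv (hU y hy') (by simp) zero_le_one
        (hpos y hy')).continuousAt.continuousWithinAt
    obtain ⟨hi, hA⟩ := integral_amplitude (fun y hy => ⟨hU y hy, hU' rfl y hy⟩) h0 hpos hx
    have e : logDeriv U 1 lam = fun t =>
        logDeriv U 0 lam t + 1 / 4 * (deriv U t / ((lam : ℂ) - U t)) := rfl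
    rw [e, intervalIntegral.integral_add hc.intervalIntegrable hi, Complex.add_re, hzero, hA,
      add_sub_cancel_left, abs_mul]
    have hb : ∀ y ∈ Icc a b, lam / 2 ≤ ‖(lam : ℂ) - U y‖ := fun y hy =>
      (hre y hy).1.trans (Complex.re_le_norm _)
    have := abs_log_sub_log_le hlam hC (hb 0 h0) (hre 0 h0).2 (hb x hx) (hre x hx).2
    rw [abs_of_pos (by norm_num : (0 : ℝ) < 1 / 4)]
    linarith

theorem jwkb_eq (hn : n ≤ 1) (hU : ∀ x ∈ Icc a b, LipAt U x)
    (hU' : n = 1 → ∀ x ∈ Icc a b, LipAt (deriv U) x ∧ DifferentiableAt ℝ U x)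
    (h0 : (0 : ℝ) ∈ Icc a b) (hlam : 0 < lam)
    (hre : ∀ x ∈ Icc a b, 0 < ((lam : ℂ) - U x).re) {x : ℝ} (hx : x ∈ Icc a b) :
    jwkb U n lam x = Complex.exp (∫ t in (0 : ℝ)..x, logDeriv U n lam t) := by
  -- For k = −1 the prefactor λ^{1/2} cancels the λ^{-1/2} inside ψ'_{-1}; for k = 0 the prefactor
  -- is one.
  have hl : ((lam ^ (-(((0 : ℕ) : ℝ) - 1) / 2) : ℝ) : ℂ) * ((lam ^ (-(1 / 2) : ℝ) : ℝ) : ℂ) = 1 := by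
    rw [← Complex.ofReal_mul, ← Real.rpow_add hlam]
    norm_num
  have e0 : -(((lam ^ (-(((0 : ℕ) : ℝ) - 1) / 2) : ℝ) : ℂ) *
      ∫ t in (0 : ℝ)..x, psiDeriv U lam 0 t) = ∫ t in (0 : ℝ)..x, logDeriv U 0 lam t := by
    rw [← intervalIntegral.integral_const_mul, ← intervalIntegral.integral_neg]
    congr 1 with t
    simp only [psiDeriv, logDeriv]
    linear_combination (-Complex.I * ((lam : ℂ) - U t) ^ (1 / 2 : ℂ)) * hl
  unfold jwkb
  congr 1
  interval_cases n
  · rw [zero_add, Finset.sum_range_one, e0]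
  · have hc : ContinuousOn (logDeriv U 0 lam) (uIcc 0 x) := fun y hy => by
      have hy' := uIcc_subset_Icc h0 hx hy
      exact (lipAt_logDeriv (hU y hy') (by simp) zero_le_one
        (hre y hy')).continuousAt.continuousWithinAt
    obtain ⟨hi, -⟩ := integral_amplitude (fun y hy => ⟨hU y hy, hU' rfl y hy⟩) h0 hre hx
    have e : logDeriv U 1 lam = fun t =>
        logDeriv U 0 lam t + 1 / 4 * (deriv U t / ((lam : ℂ) - U t)) := rfl
    rw [e, intervalIntegral.integral_add hc.intervalIntegrable hi, Finset.sum_range_succ,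
      Finset.sum_range_one, neg_add, e0]
    congr 1
    rw [← intervalIntegral.integral_const_mul, ← intervalIntegral.integral_neg]
    congr 1 with t
    simp [psiDeriv]

end Wkb

/-! ### Decay of the approximate solution towards both ends. -/

section Amplitude

variable {N n : ℕ} {ν : Side → ℝ} {ε₁ : ℝ} {ε₂ : Side → ℝ} {V W₁ W₂ : ℝ → ℂ} {w : ℝ → ℝ}
  {α : Side → ℝ} {α₀ : ℝ}

/-- The regular potential plus the mollified rough potential. -/
def smoothedPotential (w : ℝ → ℝ) (α : Side → ℝ) (α₀ : ℝ) (V W₁ W₂ : ℝ → ℂ) (lam : ℝ) : ℝ → ℂ :=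
  fun y => V y + mollifiedW w α α₀ W₁ W₂ lam y

theorem RoughPotential.contDiff_mollifiedW (hW : RoughPotential ν ε₁ ε₂ V W₁ W₂)
    (hV : Continuous V) (hw : IsMollifier w) {lam : ℝ} (hlam : 0 < lam) :
    ContDiff ℝ ∞ (mollifiedW w α α₀ W₁ W₂ lam) := by
  have h : ∀ s, ContDiff ℝ ∞ (mollify w (lam ^ (-α s)) (Side.halfLine s |>.indicator W₁)) :=
    fun s => contDiff_mollify hw (Real.rpow_pos_of_pos hlam _) (hW.locallyIntegrable_indicator hV s)
  exact ((h .minus).add (h .plus)).add (contDiff_mollify hw (Real.rpow_pos_of_pos hlam _)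
    (hW.memLp₂.locallyIntegrable (by norm_num)))

theorem RoughPotential.lipAt_smoothedPotential (hW : RoughPotential ν ε₁ ε₂ V W₁ W₂)
    (hV : RegularPotential N ν ε₁ V) (hN : 1 ≤ N) (hw : IsMollifier w) {lam : ℝ} (hlam : 0 < lam)
    (x : ℝ) : LipAt (smoothedPotential w α α₀ V W₁ W₂ lam) x :=
  LipAt.add ((hV.lipschitz_and_bounds hN).1 x) (lipAt_of_contDiffAt
    ((hW.contDiff_mollifiedW hV.continuous hw hlam).of_le (by simp)).contDiffAt)

theorem RoughPotential.lipAt_deriv_smoothedPotential (hW : RoughPotential ν ε₁ ε₂ V W₁ W₂)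
    (hV : RegularPotential N ν ε₁ V) (hN : 2 ≤ N) (hw : IsMollifier w) {lam : ℝ} (hlam : 0 < lam)
    (x : ℝ) : LipAt (deriv (smoothedPotential w α α₀ V W₁ W₂ lam)) x ∧
      DifferentiableAt ℝ (smoothedPotential w α α₀ V W₁ W₂ lam) x := by
  have hW' := hW.contDiff_mollifiedW (α := α) (α₀ := α₀) hV.continuous hw hlam
  obtain ⟨hd, hL, -⟩ := hV.contDiff_and_bounds hN
  have hWd : Differentiable ℝ (mollifiedW w α α₀ W₁ W₂ lam) := hW'.differentiable (by simp)
  have e : deriv (smoothedPotential w α α₀ V W₁ W₂ lam) =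
      fun y => deriv V y + deriv (mollifiedW w α α₀ W₁ W₂ lam) y :=
    funext fun y => deriv_add (hd y) (hWd y)
  refine ⟨?_, (hd x).add (hWd x)⟩
  rw [e]
  exact LipAt.add (hL x) (lipAt_of_contDiffAt
    ((contDiff_infty_iff_deriv.1 hW').2.of_le (by simp)).contDiffAt)

theorem sgn_mul_mem_carrier {lam d : ℝ} {s : Side} (hδ : ∀ s, 0 ≤ cutRadius ν ε₁ ε₂ V s lam)
    (hd : 0 ≤ d) (hd' : d ≤ cutRadius ν ε₁ ε₂ V s lam) : s.sgn * d ∈ carrier ν ε₁ ε₂ V lam := by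
  intro s'
  have h1 := hδ s'
  cases s <;> cases s' <;> simp only [Side.sgn] at * <;> linarith

theorem integral_sgn_mul (h : ℝ → ℝ) (s : Side) (d : ℝ) :
    ∫ t in (0 : ℝ)..s.sgn * d, h t = ∫ t in (0 : ℝ)..d, s.sgn * h (s.sgn * t) := by
  rw [intervalIntegral.integral_const_mul, ← smul_eq_mul (a := s.sgn) (b := ∫ _ in _.._, _),
    intervalIntegral.smul_integral_comp_mul_left, mul_zero]

/-- The approximate solution is bounded, bounded below near the origin and small where the
cut-off is not constant. -/
theorem RoughPotential.exists_amplitude_bounds (hW : RoughPotential ν ε₁ ε₂ V W₁ W₂)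
    (hV : RegularPotential N ν ε₁ V) (hn : n ≤ 1) (hN : n + 1 ≤ N) (hν : ∀ s, ν s < 0)
    (hε₂ : ∀ s, 0 < ε₂ s) (hw : IsMollifier w) (hα : ∀ s, 0 < α s) (hα₀ : 0 < α₀ ∧ α₀ < 1) :
    ∃ C c : ℝ, 1 ≤ C ∧ 0 < c ∧ ∀ᶠ lam in atTop,
      (∀ x ∈ carrier ν ε₁ ε₂ V lam,
        jwkb (smoothedPotential w α α₀ V W₁ W₂ lam) n lam x = Complex.exp
          (∫ t in (0 : ℝ)..x, logDeriv (smoothedPotential w α α₀ V W₁ W₂ lam) n lam t) ∧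
        LipAt (logDeriv (smoothedPotential w α α₀ V W₁ W₂ lam) n lam) x ∧
        ‖Complex.exp
          (∫ t in (0 : ℝ)..x, logDeriv (smoothedPotential w α α₀ V W₁ W₂ lam) n lam t)‖ ≤ C) ∧
      (∀ x ∈ Icc (0 : ℝ) 1, C⁻¹ ≤ ‖Complex.exp
        (∫ t in (0 : ℝ)..x, logDeriv (smoothedPotential w α α₀ V W₁ W₂ lam) n lam t)‖) ∧
      ∀ s d, cutRadius ν ε₁ ε₂ V s lam - cutWidth ν ε₁ ε₂ V s lam ≤ d →
        d ≤ cutRadius ν ε₁ ε₂ V s lam → ‖Complex.exp (∫ t in (0 : ℝ)..s.sgn * d,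
          logDeriv (smoothedPotential w α α₀ V W₁ W₂ lam) n lam t)‖ ≤
            C * Real.exp (-c * decayExponent ν ε₁ ε₂ V s lam) := by
  have hN1 : 1 ≤ N := by omega
  obtain ⟨C, hC, hspec⟩ := hW.exists_spectral_bounds hV hN1 hν hε₂ hw hα hα₀
  obtain ⟨R, K, c₂, hR, hK, hc₂, him⟩ := hW.exists_im_mollified hV hN1 hν hw hα hα₀
  choose c₃ hc₃ hdec using fun s => hV.exists_decay hN1 hν hε₂ s
  set c₄ := min (c₃ .minus) (c₃ .plus) with hc₄
  have hc₄0 : 0 < c₄ := lt_min (hc₃ _) (hc₃ _)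
  have hdec' : ∀ᶠ lam in atTop, ∀ s d,
      cutRadius ν ε₁ ε₂ V s lam - 2 * cutWidth ν ε₁ ε₂ V s lam ≤ d →
      d ≤ cutRadius ν ε₁ ε₂ V s lam →
      c₃ s * decayExponent ν ε₁ ε₂ V s lam * lam ^ (1 / 2 : ℝ) ≤
        cutWidth ν ε₁ ε₂ V s lam * |(V (s.sgn * d)).im| := by
    filter_upwards [hdec .minus, hdec .plus] with lam h1 h2 s
    cases s
    exacts [h1, h2]
  have hwid : ∀ᶠ lam in atTop, ∀ s, 2 * R ≤ cutRadius ν ε₁ ε₂ V s lam ∧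
      1 / 4 ≤ cutWidth ν ε₁ ε₂ V s lam ∧
      cutWidth ν ε₁ ε₂ V s lam ≤ cutRadius ν ε₁ ε₂ V s lam / 4 := by
    filter_upwards [hV.cutWidth_bounds hN1 hν hε₂ .minus, hV.cutWidth_bounds hN1 hν hε₂ .plus,
      (hV.tendsto_cutRadius hε₂ .minus).eventually_ge_atTop (2 * R),
      (hV.tendsto_cutRadius hε₂ .plus).eventually_ge_atTop (2 * R)] with lam h1 h2 h3 h4 s
    cases s
    exacts [⟨h3, h1⟩, ⟨h4, h2⟩]
  have hdE : ∀ᶠ lam in atTop, ∀ s, 0 ≤ decayExponent ν ε₁ ε₂ V s lam := by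
    filter_upwards [eventually_ge_atTop 1, hwid] with lam h1 h2 s
    unfold decayExponent
    split_ifs
    · exact Real.rpow_nonneg (by linarith) _
    · exact Real.rpow_nonneg (by linarith [(h2 s).1]) _
  -- In the exponent, 1 comes from the central region and C from the amplitude factor. The 2C in the
  -- rate is from Re S ≤ Cλ^{1/2}.
  refine ⟨Real.exp (1 + C), c₂ * c₄ / (2 * C), Real.one_le_exp (by linarith), by positivity, ?_⟩
  have hsm := eventually_rpow_neg_le (a := (1 - α₀) / 2) (b := 1 / (R * K)) (by linarith)
    (by positivity)
  filter_upwards [hspec, him, hdec', hwid, hdE, hsm, eventually_ge_atTop 1]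
    with lam hsp him hdec hwid hdE hsm hl1
  have hl : 0 < lam := by linarith
  set U := smoothedPotential w α α₀ V W₁ W₂ lam with hU
  have hδ0 : ∀ s, 0 ≤ cutRadius ν ε₁ ε₂ V s lam := fun s => by linarith [(hwid s).1]
  have hUL : ∀ x, LipAt U x := hW.lipAt_smoothedPotential hV hN1 hw hl
  have hUL' : n = 1 → ∀ x, LipAt (deriv U) x ∧ DifferentiableAt ℝ U x := fun h x =>
    hW.lipAt_deriv_smoothedPotential hV (by omega) hw hl x
  have hcar : ∀ x, x ∈ carrier ν ε₁ ε₂ V lam ↔ x ∈ Icc (-cutRadius ν ε₁ ε₂ V .minus lam)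
    (cutRadius ν ε₁ ε₂ V .plus lam) := fun x => mem_carrier_iff
  have h0 : (0 : ℝ) ∈ Icc (-cutRadius ν ε₁ ε₂ V .minus lam) (cutRadius ν ε₁ ε₂ V .plus lam) :=
    ⟨by linarith [hδ0 .minus], hδ0 .plus⟩
  have hre : ∀ x ∈ Icc (-cutRadius ν ε₁ ε₂ V .minus lam) (cutRadius ν ε₁ ε₂ V .plus lam),
      lam / 2 ≤ ((lam : ℂ) - U x).re ∧ ‖(lam : ℂ) - U x‖ ≤ C * lam := fun x hx =>
    hsp x ((hcar x).2 hx)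
  have hpos : ∀ x ∈ Icc (-cutRadius ν ε₁ ε₂ V .minus lam) (cutRadius ν ε₁ ε₂ V .plus lam),
      0 < ((lam : ℂ) - U x).re := fun x hx => by linarith [(hre x hx).1]
  have hlip : ∀ x ∈ carrier ν ε₁ ε₂ V lam, LipAt (logDeriv U n lam) x := fun x hx =>
    lipAt_logDeriv (hUL x) (fun h => (hUL' h x).1) hn (hpos x ((hcar x).1 hx))
  have hlip0 : ∀ x ∈ carrier ν ε₁ ε₂ V lam, LipAt (logDeriv U 0 lam) x := fun x hx =>
    lipAt_logDeriv (hUL x) (by simp) zero_le_one (hpos x ((hcar x).1 hx))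
  set h : ℝ → ℝ := fun t => (logDeriv U 0 lam t).re with hh
  have hroot : ∀ x ∈ carrier ν ε₁ ε₂ V lam, ∃ r : ℝ, lam ^ (1 / 2 : ℝ) ≤ 2 * r ∧
      r ≤ C * lam ^ (1 / 2 : ℝ) ∧ 2 * (r * h x) = -(U x).im := by
    intro x hx
    obtain ⟨h1, h2⟩ := cpow_half_re_bounds ((lam : ℂ) - U x)
    obtain ⟨h3, h4⟩ := hsp x hx
    refine ⟨_, ?_, h2.trans ?_, re_logDeriv_zero_mul x⟩
    · have h5 : Real.sqrt (lam / 2) ≤ _ := (Real.sqrt_le_sqrt h3).trans h1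
      have h6 : lam ^ (1 / 2 : ℝ) ≤ 2 * Real.sqrt (lam / 2) := by
        rw [← Real.sqrt_eq_rpow, Real.sqrt_le_left (by positivity), mul_pow,
          Real.sq_sqrt (by positivity)]
        linarith
      exact h6.trans (mul_le_mul_of_nonneg_left h5 zero_le_two)
    · rw [← Real.sqrt_eq_rpow, Real.sqrt_le_left (by positivity), mul_pow, Real.sq_sqrt hl.le]
      exact h4.trans (mul_le_mul_of_nonneg_right (by nlinarith) hl.le)
  have hlp : 0 < lam ^ (1 / 2 : ℝ) := Real.rpow_pos_of_pos hl _
  -- Here |Im U| = O(λ^{α₀/2}) is divided by a quantity of order λ^{1/2}; α₀ < 1 makes the quotient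
  -- small.
  have hcentral : ∀ x ∈ carrier ν ε₁ ε₂ V lam, |x| ≤ R → |h x| ≤ 1 / R := by
    intro x hx hxR
    obtain ⟨r, hr1, -, hr3⟩ := hroot x hx
    have h1 : |(U x).im| ≤ K * lam ^ (α₀ / 2) := him.2 x hxR
    have h2 : 2 * r * |h x| = |(U x).im| := by
      rw [← abs_neg (U x).im, ← hr3, abs_mul, abs_mul, abs_of_pos (by linarith : 0 < r)]
      norm_num
      ring
    have h3 : lam ^ (α₀ / 2) = lam ^ (-((1 - α₀) / 2)) * lam ^ (1 / 2 : ℝ) := by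
      rw [← Real.rpow_add hl]; congr 1; ring
    have h4 : K * lam ^ (α₀ / 2) ≤ 1 / R * lam ^ (1 / 2 : ℝ) := by
      rw [h3, ← mul_assoc]
      refine mul_le_mul_of_nonneg_right ?_ hlp.le
      calc _ ≤ K * (1 / (R * K)) := mul_le_mul_of_nonneg_left hsm (by linarith)
        _ = 1 / R := by field_simp
    have h5 : lam ^ (1 / 2 : ℝ) * |h x| ≤ lam ^ (1 / 2 : ℝ) * (1 / R) :=
      (mul_le_mul_of_nonneg_right hr1 (abs_nonneg _)).trans (by linarith)
    exact le_of_mul_le_mul_left h5 hlp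
  -- Far out the sign of Im U is known, and Re S ≤ Cλ^{1/2} turns it into a quantitative negative
  -- upper bound.
  have houter : ∀ s d, R ≤ d → d ≤ cutRadius ν ε₁ ε₂ V s lam →
      2 * C * lam ^ (1 / 2 : ℝ) * (s.sgn * h (s.sgn * d)) ≤ -(c₂ * |(V (s.sgn * d)).im|) ∧
      s.sgn * h (s.sgn * d) ≤ 0 := by
    intro s d hd hd'
    obtain ⟨r, hr1, hr2, hr3⟩ := hroot _ (sgn_mul_mem_carrier hδ0 (by linarith) hd')
    have h1 : c₂ * |(V (s.sgn * d)).im| ≤ s.sgn * (U (s.sgn * d)).im := him.1 s d hd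
    have h2 : 2 * r * (s.sgn * h (s.sgn * d)) ≤ -(c₂ * |(V (s.sgn * d)).im|) := by
      have : 2 * r * (s.sgn * h (s.sgn * d)) = -(s.sgn * (U (s.sgn * d)).im) := by
        linear_combination s.sgn * hr3
      linarith
    have h3 : 0 ≤ c₂ * |(V (s.sgn * d)).im| := by positivity
    have hr0 : 0 < r := by linarith
    have h4 : s.sgn * h (s.sgn * d) ≤ 0 := by
      by_contra hcon
      have := mul_pos (mul_pos two_pos hr0) (not_le.1 hcon)
      linarith
    refine ⟨?_, h4⟩
    have h5 := mul_le_mul_of_nonpos_right (show 2 * r ≤ 2 * C * lam ^ (1 / 2 : ℝ) by linarith) h4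
    linarith
  have hint : ∀ s, (∀ d ∈ Icc 0 (cutRadius ν ε₁ ε₂ V s lam),
        ∫ t in (0 : ℝ)..s.sgn * d, h t ≤ 1) ∧
      ∀ d ∈ Icc (cutRadius ν ε₁ ε₂ V s lam - cutWidth ν ε₁ ε₂ V s lam)
        (cutRadius ν ε₁ ε₂ V s lam), ∫ t in (0 : ℝ)..s.sgn * d, h t ≤
          1 - c₂ * c₄ / (2 * C) * decayExponent ν ε₁ ε₂ V s lam := by
    intro s
    obtain ⟨w1, w2, w3⟩ := hwid s
    have hw0 : 0 < cutWidth ν ε₁ ε₂ V s lam := by linarith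
    have hc4s : c₄ ≤ c₃ s := by
      cases s
      exacts [min_le_left _ _, min_le_right _ _]
    -- The decay is collected on [δ − 2Δ, δ − Δ], so it is complete where the cut-off varies. This
    -- strip has length Δ, whence the division by Δ in μ.
    have key := integral_le_of_decay (ψ := fun t => s.sgn * h (s.sgn * t)) (R := R)
      (p := cutRadius ν ε₁ ε₂ V s lam - 2 * cutWidth ν ε₁ ε₂ V s lam)
      (p' := cutRadius ν ε₁ ε₂ V s lam - cutWidth ν ε₁ ε₂ V s lam)
      (δ := cutRadius ν ε₁ ε₂ V s lam)
      (μ := c₂ * c₄ / (2 * C) * decayExponent ν ε₁ ε₂ V s lam / cutWidth ν ε₁ ε₂ V s lam)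
      (by linarith) (by linarith) (by linarith) (by linarith) ?_ ?_ ?_ ?_
    · rw [show cutRadius ν ε₁ ε₂ V s lam - cutWidth ν ε₁ ε₂ V s lam -
        (cutRadius ν ε₁ ε₂ V s lam - 2 * cutWidth ν ε₁ ε₂ V s lam) =
          cutWidth ν ε₁ ε₂ V s lam by ring, div_mul_cancel₀ _ hw0.ne'] at key
      refine ⟨fun d hd => ?_, fun d hd => ?_⟩
      · rw [integral_sgn_mul]; exact key.1 d hd
      · rw [integral_sgn_mul]; exact key.2 d hd
    · refine continuousOn_const.mul fun t ht => ContinuousAt.continuousWithinAt ?_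
      have h1 := (hlip0 _ (sgn_mul_mem_carrier (s := s) hδ0 ht.1 ht.2)).continuousAt
      exact (Complex.continuous_re.continuousAt.comp h1).comp
        (continuous_const.mul continuous_id).continuousAt
    · intro t ht
      have h1 := hcentral _ (sgn_mul_mem_carrier (s := s) (d := t) hδ0 ht.1
        (by linarith [ht.2])) (by rw [abs_mul, s.abs_sgn, one_mul, abs_of_nonneg ht.1]; exact ht.2)
      refine (le_abs_self _).trans ?_
      rwa [abs_mul, s.abs_sgn, one_mul]
    · exact fun t ht => (houter s t ht.1 ht.2).2
    · intro t ht
      have h1 := (houter s t (by linarith [ht.1]) (by linarith [ht.2])).1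
      have h2 := hdec s t ht.1 (by linarith [ht.2])
      have h3 : c₄ * decayExponent ν ε₁ ε₂ V s lam * lam ^ (1 / 2 : ℝ) ≤
          cutWidth ν ε₁ ε₂ V s lam * |(V (s.sgn * t)).im| :=
        (mul_le_mul_of_nonneg_right (mul_le_mul_of_nonneg_right hc4s (hdE s)) hlp.le).trans h2
      rw [le_neg, div_le_iff₀ hw0, div_mul_eq_mul_div, div_le_iff₀ (by positivity)]
      refine le_of_mul_le_mul_right ?_ hlp
      have h4 := mul_le_mul_of_nonneg_left h3 hc₂.le
      have h5 := mul_le_mul_of_nonneg_left h1 hw0.le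
      linarith
  have hglob : ∀ x ∈ carrier ν ε₁ ε₂ V lam, |(∫ t in (0 : ℝ)..x, logDeriv U n lam t).re -
      ∫ t in (0 : ℝ)..x, h t| ≤ C := fun x hx =>
    re_integral_logDeriv hn (fun y _ => hUL y) (fun hn y _ => hUL' hn y) h0 hl hC hre
      ((hcar x).1 hx)
  refine ⟨fun x hx => ⟨?_, hlip x hx, ?_⟩, fun x hx => ?_, fun s d hd hd' => ?_⟩
  · exact jwkb_eq hn (fun y _ => hUL y) (fun hn y _ => hUL' hn y) h0 hl hpos ((hcar x).1 hx)
  · rw [Complex.norm_exp, Real.exp_le_exp]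
    obtain ⟨s, hs⟩ := Side.exists_nonneg x
    have h1 := (hint s).1 _ ⟨hs, hx s⟩
    rw [s.sgn_mul_sgn_mul] at h1
    linarith [(abs_le.1 (hglob x hx)).2]
  · have hx' : ∀ y ∈ Icc 0 x, y ∈ carrier ν ε₁ ε₂ V lam ∧ |y| ≤ R := fun y hy => by
      refine ⟨(hcar y).2 ⟨by linarith [hy.1, h0.1], ?_⟩, ?_⟩
      · linarith [hy.2, hx.2, (hwid .plus).1]
      · rw [abs_of_nonneg hy.1]; linarith [hy.2, hx.2]
    rw [Complex.norm_exp, ← Real.exp_neg, Real.exp_le_exp]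
    have h1 : ‖∫ t in (0 : ℝ)..x, h t‖ ≤ 1 / R * |x - 0| := by
      refine intervalIntegral.norm_integral_le_of_norm_le_const fun t ht => ?_
      rw [uIoc_of_le hx.1] at ht
      obtain ⟨h2, h3⟩ := hx' t ⟨ht.1.le, ht.2⟩
      exact hcentral t h2 h3
    have h2 : 1 / R * |x - 0| ≤ 1 := by
      rw [sub_zero, abs_of_nonneg hx.1, div_mul_eq_mul_div, one_mul, div_le_one (by linarith)]
      linarith [hx.2]
    have h3 := hglob x (hx' x ⟨hx.1, le_rfl⟩).1
    rw [Real.norm_eq_abs] at h1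
    linarith [(abs_le.1 h3).1, (abs_le.1 (h1.trans h2)).1]
  · rw [Complex.norm_exp, ← Real.exp_add, Real.exp_le_exp]
    have hd0 : 0 ≤ d := by linarith [(hwid s).1, (hwid s).2.2]
    have h1 := (hint s).2 d ⟨hd, hd'⟩
    linarith [(abs_le.1 (hglob _ (sgn_mul_mem_carrier hδ0 hd0 hd'))).2]

end Amplitude


theorem Side.eventually_forall {β : Type*} {l : Filter β} {P : Side → β → Prop}
    (h : ∀ s, ∀ᶠ x in l, P s x) : ∀ᶠ x in l, ∀ s, P s x := by
  filter_upwards [h .minus, h .plus] with x h1 h2 s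
  cases s
  exacts [h1, h2]

theorem Side.exists_upper (C : Side → ℝ) : ∃ K : ℝ, 1 ≤ K ∧ ∀ s, C s ≤ K := by
  refine ⟨max 1 (max (C .minus) (C .plus)), le_max_left _ _, fun s => ?_⟩
  cases s
  · exact (le_max_left _ _).trans (le_max_right _ _)
  · exact (le_max_right _ _).trans (le_max_right _ _)

/-! ### The share of V in the remainder, and a crude bound on the logarithmic derivative. -/

section Bounds

variable {N n : ℕ} {ν : Side → ℝ} {ε₁ : ℝ} {ε₂ : Side → ℝ} {V W₁ W₂ : ℝ → ℂ} {w : ℝ → ℝ}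
  {α : Side → ℝ} {α₀ : ℝ}

theorem RegularPotential.exists_norm_le_lam (hV : RegularPotential N ν ε₁ V) (hN : 1 ≤ N)
    (hν : ∀ s, ν s < 0) (hε₂ : ∀ s, 0 < ε₂ s) (s : Side) : ∃ C : ℝ, 1 ≤ C ∧ ∀ᶠ lam in atTop,
      ∀ x ∈ cutInterval ν ε₁ ε₂ V s lam, ‖V x‖ ≤ C * lam := by
  obtain ⟨C, hC, h⟩ := hV.exists_im_le_lam (ε₂ := ε₂) hN hν hε₂ s
  refine ⟨1 + C, by linarith, ?_⟩
  filter_upwards [h, hV.re_le_lam (ε₂ := ε₂) hN hν hε₂ s one_pos] with lam h1 h2 x hx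
  rw [mem_cutInterval] at hx
  have h1' := h1 _ hx.1.le (by linarith)
  have h2' := h2 _ hx.1.le (by linarith)
  rw [s.sgn_mul_sgn_mul] at h1' h2'
  have := Complex.norm_le_abs_re_add_abs_im (V x)
  linarith

/-- The part of the remainder due to the regular potential. -/
theorem RegularPotential.exists_remainder_le (hV : RegularPotential N ν ε₁ V) (hn : n ≤ 1)
    (hN : n + 1 ≤ N) (hν : ∀ s, ν s < 0) (hε₂ : ∀ s, 0 < ε₂ s) (s : Side) :
    ∃ C : ℝ, 1 ≤ C ∧ ∀ᶠ lam in atTop, ∀ᵐ x ∂volume, x ∈ cutInterval ν ε₁ ε₂ V s lam →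
      ‖deriv V x‖ ≤ C * lam ∧ remainderSize V n lam x ≤ C * sigmaRate ν ε₁ ε₂ V n s lam := by
  obtain ⟨C₁, hC₁, h₁⟩ := hV.exists_norm_le_lam (ε₂ := ε₂) (by omega) hν hε₂ s
  obtain ⟨C₂, hC₂, h₂⟩ := hV.exists_deriv_le (by omega) s
  obtain ⟨C₃, hC₃, h₃⟩ := hV.exists_sigmaSup hν hε₂ n s
  have hderiv : ∀ᶠ lam in atTop, ∀ᵐ x ∂volume, x ∈ cutInterval ν ε₁ ε₂ V s lam →
      ‖deriv V x‖ ≤ 2 * C₂ * C₁ * lam := by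
    filter_upwards [h₁, eventually_ge_atTop 1] with lam h1 hl
    filter_upwards [h₂] with x h2 hx
    have hx' := mem_cutInterval.1 hx
    have h3 := h2 hx'.1
    have h4 := h1 x hx
    have h5 : ‖V x‖ * bracket x ^ ν s ≤ C₁ * lam :=
      (mul_le_of_le_one_right (norm_nonneg _) (bracket_rpow_le_one (hν s).le x)).trans h4
    have h6 : 1 ≤ C₁ * lam := by nlinarith
    calc _ ≤ C₂ * (1 + ‖V x‖ * bracket x ^ ν s) := h3
      _ ≤ C₂ * (C₁ * lam + C₁ * lam) := by gcongr
      _ = _ := by ring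
  have hpos : 0 ≤ C₂ * C₁ := by positivity
  interval_cases n
  · refine ⟨2 * C₂ * C₁ * C₃, by nlinarith [mul_le_mul hC₂ hC₁ zero_le_one (by linarith)], ?_⟩
    filter_upwards [hderiv, h₃, eventually_ge_atTop 1] with lam h1 h3 hl
    filter_upwards [h1, h₂] with x h4 h5 hx
    have hl0 : 0 < lam := by linarith
    refine ⟨(h4 hx).trans ?_, ?_⟩
    · exact mul_le_mul_of_nonneg_right (le_mul_of_one_le_right (by positivity) hC₃) hl0.le
    · have h6 := h5 (mem_cutInterval.1 hx).1
      have h7 := h3.2 x hx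
      norm_num at h7
      rw [sigmaRate_eq]
      norm_num [remainderSize]
      have hp : 0 ≤ lam ^ (-(1 / 2) : ℝ) := Real.rpow_nonneg hl0.le _
      have hS : 0 ≤ C₃ * sigmaSup ν ε₁ ε₂ V 0 s lam := by linarith [h3.1]
      have h8 : ‖deriv V x‖ ≤ 2 * C₂ * C₁ * C₃ * sigmaSup ν ε₁ ε₂ V 0 s lam := by
        calc _ ≤ C₂ * (1 + ‖V x‖ * bracket x ^ ν s) := h6
          _ ≤ C₂ * (C₃ * sigmaSup ν ε₁ ε₂ V 0 s lam + C₃ * sigmaSup ν ε₁ ε₂ V 0 s lam) := by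
            gcongr
            exact h3.1
          _ = 2 * C₂ * (C₃ * sigmaSup ν ε₁ ε₂ V 0 s lam) := by ring
          _ ≤ 2 * C₂ * (C₃ * sigmaSup ν ε₁ ε₂ V 0 s lam) * C₁ :=
            le_mul_of_one_le_right (by positivity) hC₁
          _ = _ := by ring
      calc _ ≤ lam ^ (-(1 / 2) : ℝ) * (2 * C₂ * C₁ * C₃ * sigmaSup ν ε₁ ε₂ V 0 s lam) := by
            gcongr
        _ = _ := by ring
  · obtain ⟨C₄, hC₄, h₄⟩ := hV.exists_deriv_deriv_le hN s
    refine ⟨2 * C₂ * C₁ + 2 * C₄ * C₃ + 8 * C₂ ^ 2 * C₁ * C₃, ?_, ?_⟩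
    · nlinarith [mul_le_mul hC₂ hC₁ zero_le_one (by linarith),
        mul_le_mul hC₄ hC₃ zero_le_one (by linarith), show 0 ≤ 8 * C₂ ^ 2 * C₁ * C₃ by positivity]
    filter_upwards [hderiv, h₃, h₁, eventually_ge_atTop 1] with lam h1 h3 hb hl
    filter_upwards [h1, h₂, h₄] with x h4 h5 h5' hx
    have hl0 : 0 < lam := by linarith
    refine ⟨(h4 hx).trans ?_, ?_⟩
    · refine mul_le_mul_of_nonneg_right ?_ hl0.le
      nlinarith [show 0 ≤ C₄ * C₃ by positivity, show 0 ≤ C₂ ^ 2 * C₁ * C₃ by positivity]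
    · have h6 := h5 (mem_cutInterval.1 hx).1
      have h6' := h5' (mem_cutInterval.1 hx).1
      have h7 := h3.2 x hx
      have hVb := hb x hx
      rw [show (((1 : ℕ) : ℝ) + 1) = 2 by norm_num] at h7
      rw [sigmaRate_eq,
        show (-(((1 : ℕ) : ℝ) + 1) / 2) = -1 by norm_num, Real.rpow_neg_one]
      set Q := sigmaSup ν ε₁ ε₂ V 1 s lam
      have hS : 1 ≤ C₃ * Q := h3.1
      have hb0 : 0 < bracket x := bracket_pos x
      set β := bracket x ^ ν s with hβ
      have hβ2 : bracket x ^ (2 * ν s) = β ^ 2 := by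
        rw [hβ, ← Real.rpow_natCast, ← Real.rpow_mul hb0.le]
        congr 1; push_cast; ring
      rw [hβ2] at h7 h6'
      have hβ0 : 0 ≤ β := Real.rpow_nonneg hb0.le _
      have hdd : ‖deriv (deriv V) x‖ ≤ 2 * C₄ * C₃ * Q := by
        calc _ ≤ C₄ * (1 + ‖V x‖ * β ^ 2) := h6'
          _ ≤ C₄ * (C₃ * Q + C₃ * Q) := by gcongr
          _ = _ := by ring
      have hsq : ‖deriv V x‖ ^ 2 ≤ 4 * C₂ ^ 2 * C₁ * C₃ * Q * lam := by
        -- One factor V is O(λ) and cancels one power of λ in the prefactor λ^{-2}; the other is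
        -- kept with the weight ⟨x⟩^{2ν} and bounded by the supremum.
        have e1 : (‖V x‖ * β) ^ 2 ≤ C₁ * lam * (C₃ * Q) := by
          calc (‖V x‖ * β) ^ 2 = ‖V x‖ * (‖V x‖ * β ^ 2) := by ring
            _ ≤ _ := mul_le_mul hVb h7 (by positivity) (by positivity)
        have e2 : 1 ≤ C₁ * lam * (C₃ * Q) := by
          have : 1 ≤ C₁ * lam := by nlinarith
          nlinarith
        calc ‖deriv V x‖ ^ 2 ≤ (C₂ * (1 + ‖V x‖ * β)) ^ 2 := by gcongr
          _ ≤ C₂ ^ 2 * (2 * (1 + (‖V x‖ * β) ^ 2)) := by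
            rw [mul_pow]
            gcongr
            nlinarith [sq_nonneg (1 - ‖V x‖ * β)]
          _ ≤ C₂ ^ 2 * (2 * (C₁ * lam * (C₃ * Q) + C₁ * lam * (C₃ * Q))) := by gcongr
          _ = _ := by ring
      simp only [remainderSize]
      have e3 : (lam ^ 2)⁻¹ * ‖deriv V x‖ ^ 2 ≤ lam⁻¹ * (4 * C₂ ^ 2 * C₁ * C₃ * Q) := by
        calc _ ≤ (lam ^ 2)⁻¹ * (4 * C₂ ^ 2 * C₁ * C₃ * Q * lam) := by gcongr
          _ = _ := by field_simp
      have e4 : lam⁻¹ * ‖deriv (deriv V) x‖ ≤ lam⁻¹ * (2 * C₄ * C₃ * Q) := by gcongr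
      have e5 : 0 ≤ lam⁻¹ * (2 * C₂ * C₁ * Q) := by
        have : 0 ≤ Q := by
          by_contra hneg
          nlinarith [not_le.1 hneg]
        positivity
      calc _ ≤ lam⁻¹ * (2 * C₄ * C₃ * Q) + 2 * (lam⁻¹ * (4 * C₂ ^ 2 * C₁ * C₃ * Q)) := by
            linarith
        _ ≤ lam⁻¹ * (2 * C₄ * C₃ * Q) + 2 * (lam⁻¹ * (4 * C₂ ^ 2 * C₁ * C₃ * Q)) +
          lam⁻¹ * (2 * C₂ * C₁ * Q) := le_add_of_nonneg_right e5
        _ = _ := by ring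

theorem RoughPotential.deriv_mollifiedW (hW : RoughPotential ν ε₁ ε₂ V W₁ W₂)
    (hV : Continuous V) (hw : IsMollifier w) {lam : ℝ} (hlam : 0 < lam) (x : ℝ) :
    deriv (mollifiedW w α α₀ W₁ W₂ lam) x =
      deriv (mollify w (lam ^ (-α .minus)) (Side.minus.halfLine.indicator W₁)) x +
      deriv (mollify w (lam ^ (-α .plus)) (Side.plus.halfLine.indicator W₁)) x +
      deriv (mollify w (lam ^ (-α₀)) W₂) x := by
  have h : ∀ s : Side, DifferentiableAt ℝ
      (mollify w (lam ^ (-α s)) (s.halfLine.indicator W₁)) x := fun s =>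
    (contDiff_mollify hw (Real.rpow_pos_of_pos hlam _)
      (hW.locallyIntegrable_indicator hV s)).differentiable (by simp) x
  have h2 : DifferentiableAt ℝ (mollify w (lam ^ (-α₀)) W₂) x :=
    (contDiff_mollify hw (Real.rpow_pos_of_pos hlam _)
      (hW.memLp₂.locallyIntegrable (by norm_num))).differentiable (by simp) x
  exact (((h .minus).hasDerivAt.add (h .plus).hasDerivAt).add h2.hasDerivAt).deriv

/-- A crude power of λ suffices, since this bound is only used next to an exponentially small
factor. Each mollified derivative is at most Mλ·λ^α with α < 1. -/
theorem RoughPotential.exists_logDeriv_le (hW : RoughPotential ν ε₁ ε₂ V W₁ W₂)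
    (hV : RegularPotential N ν ε₁ V) (hn : n ≤ 1) (hN : n + 1 ≤ N) (hν : ∀ s, ν s < 0)
    (hε₂ : ∀ s, 0 < ε₂ s) (hw : IsMollifier w) (hα : ∀ s, 0 < α s ∧ α s < 1)
    (hα₀ : 0 < α₀ ∧ α₀ < 1) : ∃ C : ℝ, 1 ≤ C ∧ ∀ᶠ lam in atTop, ∀ᵐ x ∂volume,
      x ∈ carrier ν ε₁ ε₂ V lam →
        ‖logDeriv (smoothedPotential w α α₀ V W₁ W₂ lam) n lam x‖ ≤ C * lam ^ 2 := by
  have hN1 : 1 ≤ N := by omega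
  obtain ⟨C, hC, hspec⟩ := hW.exists_spectral_bounds hV hN1 hν hε₂ hw (fun s => (hα s).1) hα₀
  obtain ⟨M, hM, hmol⟩ := hW.exists_deriv_mollify_le hV hN1 hν hε₂ hw (fun s => (hα s).1) hα₀
  choose C' hC' hreg using fun s => hV.exists_remainder_le (ε₂ := ε₂) (n := 0) zero_le_one
    (by omega) hν hε₂ s
  obtain ⟨K, hK, hCK⟩ := Side.exists_upper C'
  have hL := (hV.lipschitz_and_bounds hN1).1
  refine ⟨C + K + 3 * M, by linarith, ?_⟩
  filter_upwards [hspec, hmol, Side.eventually_forall hreg, eventually_ge_atTop 1]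
    with lam hsp hmo hre hl1
  have hl : 0 < lam := by linarith
  have hre' : ∀ᵐ x ∂volume, ∀ s, x ∈ cutInterval ν ε₁ ε₂ V s lam →
      ‖deriv V x‖ ≤ C' s * lam := by
    filter_upwards [hre .minus, hre .plus] with x h1 h2 s hx
    cases s
    exacts [(h1 hx).1, (h2 hx).1]
  have hends : ∀ s, ∀ᵐ x ∂(volume : Measure ℝ), s.sgn * x ≠ cutRadius ν ε₁ ε₂ V s lam := by
    intro s
    have : ∀ᵐ x ∂(volume : Measure ℝ), x ≠ s.sgn * cutRadius ν ε₁ ε₂ V s lam := by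
      simp [ae_iff, measure_singleton]
    filter_upwards [this] with x hx h
    exact hx (by rw [← h, s.sgn_mul_sgn_mul])
  have hy0 : ∀ᵐ y ∂(volume : Measure ℝ), y ≠ 0 := by simp [ae_iff, measure_singleton]
  filter_upwards [hre', hasDerivAt_ae_of_locallyLipschitz hL, hends .minus, hends .plus, hy0]
    with x hx hVx he1 he2 hx0 hxc
  have hsum : lam ≤ lam ^ 2 := by nlinarith
  have hroot : ‖-Complex.I * ((lam : ℂ) - smoothedPotential w α α₀ V W₁ W₂ lam x) ^ (1 / 2 : ℂ)‖
      ≤ C * lam := by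
    rw [norm_mul, norm_neg, Complex.norm_I, one_mul, norm_cpow_half,
      Real.sqrt_le_left (by positivity)]
    refine (hsp x hxc).2.trans (le_self_pow₀ ?_ two_ne_zero)
    nlinarith
  interval_cases n
  · refine hroot.trans ?_
    nlinarith
  · have hxs : ∃ s, x ∈ cutInterval ν ε₁ ε₂ V s lam := by
      obtain ⟨s, hs⟩ := Side.exists_nonneg x
      refine ⟨s, mem_cutInterval.2 ⟨lt_of_le_of_ne hs ?_, lt_of_le_of_ne (hxc s) ?_⟩⟩
      · intro h
        rw [eq_comm, mul_eq_zero] at h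
        rcases h with h | h
        · have := s.abs_sgn
          rw [h, abs_zero] at this
          exact zero_ne_one this
        · exact hx0 h
      · cases s
        exacts [he1, he2]
    obtain ⟨s, hs⟩ := hxs
    have hV' : ‖deriv V x‖ ≤ K * lam :=
      (hx s hs).trans (mul_le_mul_of_nonneg_right (hCK s) hl.le)
    have hpow : ∀ a : ℝ, a < 1 → M * lam / lam ^ (-a) ≤ M * lam ^ 2 := by
      intro a ha
      rw [div_eq_mul_inv, ← Real.rpow_neg hl.le, neg_neg, mul_assoc, sq]
      gcongr
      calc lam ^ a ≤ lam ^ (1 : ℝ) := Real.rpow_le_rpow_of_exponent_le hl1 ha.le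
        _ = lam := Real.rpow_one _
    obtain ⟨m1, -, m3⟩ := hmo x hxc
    have hd : deriv (smoothedPotential w α α₀ V W₁ W₂ lam) x =
        deriv V x + deriv (mollifiedW w α α₀ W₁ W₂ lam) x :=
      deriv_add hVx.differentiableAt
        ((hW.contDiff_mollifiedW hV.continuous hw hl).differentiable (by simp) x)
    have hU' : ‖deriv (smoothedPotential w α α₀ V W₁ W₂ lam) x‖ ≤ (K + 3 * M) * lam ^ 2 := by
      rw [hd, hW.deriv_mollifiedW hV.continuous hw hl]
      refine (norm_add_le _ _).trans ?_
      have h3 := norm_add₃_le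
        (a := deriv (mollify w (lam ^ (-α .minus)) (Side.minus.halfLine.indicator W₁)) x)
        (b := deriv (mollify w (lam ^ (-α .plus)) (Side.plus.halfLine.indicator W₁)) x)
        (c := deriv (mollify w (lam ^ (-α₀)) W₂) x)
      have h4 := (m1 .minus).trans (hpow _ (hα .minus).2)
      have h5 := (m1 .plus).trans (hpow _ (hα .plus).2)
      have h6 := m3.trans (hpow _ hα₀.2)
      have h7 : K * lam ≤ K * lam ^ 2 := by gcongr
      linarith
    have hden : lam / 2 ≤ ‖(lam : ℂ) - smoothedPotential w α α₀ V W₁ W₂ lam x‖ :=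
      (hsp x hxc).1.trans (Complex.re_le_norm _)
    have hamp : ‖(1 / 4 : ℂ) * (deriv (smoothedPotential w α α₀ V W₁ W₂ lam) x /
        ((lam : ℂ) - smoothedPotential w α α₀ V W₁ W₂ lam x))‖ ≤ (K + 3 * M) * lam ^ 2 := by
      rw [norm_mul, norm_div]
      calc _ ≤ 1 / 4 * ((K + 3 * M) * lam ^ 2 / (lam / 2)) := by
            norm_num only [norm_div, Complex.norm_ofNat, norm_one]
            gcongr
        _ ≤ _ := by
            rw [div_div_eq_mul_div, ← mul_div_assoc, div_le_iff₀ hl]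
            have : 0 ≤ (K + 3 * M) * lam ^ 2 := by positivity
            nlinarith
    refine (norm_add_le _ _).trans ?_
    have : C * lam ≤ C * lam ^ 2 := by gcongr
    linarith

end Bounds


/-! ### The cut-off and its commutator. -/

section Cutoff

variable {δ Δ : Side → ℝ} {C : ℝ} {ξ : ℝ → ℝ}

/-- Off the transition strips the cut-off is locally constant: either on the plateau or outside the
support. -/
theorem IsCutoff.deriv_eq_zero (hξ : IsCutoff δ Δ C ξ) {x : ℝ}
    (hx : ∀ s, ¬(δ s - Δ s ≤ s.sgn * x ∧ s.sgn * x ≤ δ s)) :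
    deriv ξ x = 0 ∧ deriv (deriv ξ) x = 0 := by
  have key : ∃ c : ℝ, ξ =ᶠ[𝓝 x] fun _ => c := by
    by_cases h : x ∈ Icc (-δ .minus) (δ .plus)
    · have h1 := hx .minus
      have h2 := hx .plus
      simp only [Side.sgn, neg_one_mul, one_mul, not_and, not_le] at h1 h2
      have hxI : x ∈ Ioo (-δ .minus + Δ .minus) (δ .plus - Δ .plus) := by
        constructor
        · by_contra hcon
          have := h1 (by linarith)
          linarith [h.1]
        · by_contra hcon
          have := h2 (by linarith)
          linarith [h.2]
      exact ⟨1, by filter_upwards [isOpen_Ioo.mem_nhds hxI] with y hy using hξ.eq_one y hy⟩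
    · refine ⟨0, ?_⟩
      filter_upwards [isClosed_Icc.isOpen_compl.mem_nhds h] with y hy
      exact hξ.eq_zero y fun hy' => hy (Ioo_subset_Icc_self hy')
  obtain ⟨c, hc⟩ := key
  have h1 : deriv ξ =ᶠ[𝓝 x] fun _ => 0 := by
    refine hc.deriv.trans (Eventually.of_forall fun y => ?_)
    simp
  exact ⟨h1.self_of_nhds, by rw [h1.deriv_eq, deriv_const]⟩

/-- The region at the end `s` in which a cut-off may vary. -/
def transitionRegion (δ Δ : Side → ℝ) (s : Side) : Set ℝ :=
  {x | δ s - Δ s ≤ s.sgn * x ∧ s.sgn * x ≤ δ s}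

theorem transitionRegion_eq (s : Side) : transitionRegion δ Δ s = match s with
    | .minus => Icc (-δ .minus) (-(δ .minus - Δ .minus))
    | .plus => Icc (δ .plus - Δ .plus) (δ .plus) := by
  ext x
  cases s <;> simp only [transitionRegion, Side.sgn, mem_ofPred_eq, mem_Icc]
  · constructor <;> rintro ⟨h1, h2⟩ <;> constructor <;> linarith
  · constructor <;> rintro ⟨h1, h2⟩ <;> constructor <;> linarith

theorem measurableSet_transitionRegion (s : Side) : MeasurableSet (transitionRegion δ Δ s) := by
  rw [transitionRegion_eq]
  cases s <;> exact measurableSet_Icc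

theorem volume_transitionRegion (s : Side) :
    volume (transitionRegion δ Δ s) = ENNReal.ofReal (Δ s) := by
  rw [transitionRegion_eq]
  cases s <;> rw [Real.volume_Icc] <;> congr 1 <;> ring

/-- The norm is K Δ^{-1/2}, up to the form of the estimate √Δ ≤ 2Δ, which holds as Δ ≥ 1/4. -/
theorem eLpNorm_indicator_transitionRegion_le (s : Side) (hΔ : 1 / 4 ≤ Δ s) {K : ℝ} (hK : 0 ≤ K) :
    eLpNorm ((transitionRegion δ Δ s).indicator fun _ => K / Δ s) 2 volume ≤
      ENNReal.ofReal (2 * K) := by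
  have hΔ0 : 0 < Δ s := by linarith
  rw [eLpNorm_indicator_const (measurableSet_transitionRegion s) two_ne_zero ENNReal.ofNat_ne_top,
    volume_transitionRegion, ENNReal.ofReal_rpow_of_pos hΔ0, Real.enorm_eq_ofReal (by positivity),
    ← ENNReal.ofReal_mul (by positivity)]
  refine ENNReal.ofReal_le_ofReal ?_
  have h1 : Δ s ^ (1 / (2 : ℝ≥0∞).toReal) = Real.sqrt (Δ s) := by
    rw [Real.sqrt_eq_rpow]; norm_num
  rw [h1]
  have h2 : Real.sqrt (Δ s) ≤ 2 * Δ s := by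
    rw [Real.sqrt_le_left (by positivity)]
    nlinarith
  calc K / Δ s * Real.sqrt (Δ s) ≤ K / Δ s * (2 * Δ s) := by gcongr
    _ = 2 * K := by field_simp

/-- The commutator of the second derivative with a cut-off. -/
theorem IsCutoff.norm_commutator_le (hξ : IsCutoff δ Δ C ξ) (hC : 0 ≤ C)
    (hΔ : ∀ s, 1 / 4 ≤ Δ s) (hΔδ : ∀ s, Δ s ≤ δ s / 4) {x : ℝ} {m g : ℂ} {M : ℝ} {B : Side → ℝ}
    (hM : 1 ≤ M) (hB : ∀ s, 0 ≤ B s) (hm : x ∈ Icc (-δ .minus) (δ .plus) → ‖m‖ ≤ M)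
    (hg : ∀ s, x ∈ transitionRegion δ Δ s → ‖g‖ ≤ B s) :
    ‖((((deriv (deriv ξ) x : ℝ) : ℂ) + 2 * ((deriv ξ x : ℝ) : ℂ) * m)) * g‖ ≤
      (transitionRegion δ Δ .minus).indicator (fun _ => 6 * C * M * B .minus / Δ .minus) x +
      (transitionRegion δ Δ .plus).indicator (fun _ => 6 * C * M * B .plus / Δ .plus) x := by
  have hnn : ∀ s, 0 ≤ (transitionRegion δ Δ s).indicator
      (fun _ => 6 * C * M * B s / Δ s) x := fun s => indicator_nonneg (fun _ _ => by
        have := hB s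
        have := hΔ s
        have : 0 ≤ Δ s := by linarith
        positivity) x
  by_cases h : ∀ s, ¬(δ s - Δ s ≤ s.sgn * x ∧ s.sgn * x ≤ δ s)
  · obtain ⟨h1, h2⟩ := hξ.deriv_eq_zero h
    rw [h1, h2]
    simpa using add_nonneg (hnn .minus) (hnn .plus)
  · simp only [not_forall, not_not] at h
    obtain ⟨s, hs⟩ := h
    have hxs : x ∈ transitionRegion δ Δ s := hs
    have hΔ0 : 0 < Δ s := by linarith [hΔ s]
    have hx0 : 0 < s.sgn * x := by linarith [hs.1, hΔδ s]
    have hxI : x ∈ Icc (-δ .minus) (δ .plus) := by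
      have a1 := hΔ .minus
      have a2 := hΔ .plus
      have a3 := hΔδ .minus
      have a4 := hΔδ .plus
      cases s <;> simp only [Side.sgn] at hs hx0 <;> constructor <;> linarith [hs.2]
    have d1 := hξ.deriv_le s 1 le_rfl one_le_two x (s.mem_halfLine.2 hx0)
    have d2 := hξ.deriv_le s 2 one_le_two le_rfl x (s.mem_halfLine.2 hx0)
    rw [iteratedDeriv_one, pow_one] at d1
    rw [iteratedDeriv_succ, iteratedDeriv_one] at d2
    -- One factor of Δ^{-2} is replaced by 4, because Δ ≥ 1/4.
    have d2' : |deriv (deriv ξ) x| ≤ 4 * C / Δ s := by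
      refine d2.trans ?_
      rw [sq, mul_inv, div_eq_mul_inv, ← mul_assoc]
      refine mul_le_mul_of_nonneg_right ?_ (by positivity)
      rw [mul_comm (4 : ℝ)]
      refine mul_le_mul_of_nonneg_left ?_ hC
      rw [inv_le_comm₀ hΔ0 (by norm_num)]
      linarith [hΔ s]
    have main : ‖((((deriv (deriv ξ) x : ℝ) : ℂ) + 2 * ((deriv ξ x : ℝ) : ℂ) * m)) * g‖ ≤
        6 * C * M * B s / Δ s := by
      rw [norm_mul]
      have h1 : ‖(((deriv (deriv ξ) x : ℝ) : ℂ) + 2 * ((deriv ξ x : ℝ) : ℂ) * m)‖ ≤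
          6 * C * M / Δ s := by
        refine (norm_add_le _ _).trans ?_
        rw [norm_mul, norm_mul, Complex.norm_real, Complex.norm_real, Complex.norm_ofNat,
          Real.norm_eq_abs, Real.norm_eq_abs]
        have h2 : 2 * |deriv ξ x| * ‖m‖ ≤ 2 * (C * (Δ s)⁻¹) * M := by
          gcongr
          exact hm hxI
        have h3 : 4 * C / Δ s ≤ 4 * C * M / Δ s :=
          div_le_div_of_nonneg_right (le_mul_of_one_le_right (by positivity) hM) hΔ0.le
        calc _ ≤ 4 * C * M / Δ s + 2 * (C * (Δ s)⁻¹) * M := by linarith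
          _ = _ := by ring
      calc _ ≤ 6 * C * M / Δ s * B s :=
            mul_le_mul h1 (hg s hxs) (norm_nonneg _) (by positivity)
        _ = _ := by ring
    refine main.trans ?_
    cases s
    · rw [indicator_of_mem hxs]
      exact le_add_of_nonneg_right (hnn .plus)
    · rw [indicator_of_mem hxs]
      exact le_add_of_nonneg_left (hnn .minus)

theorem IsCutoff.tsupport_subset (hξ : IsCutoff δ Δ C ξ) :
    tsupport ξ ⊆ Icc (-δ .minus) (δ .plus) :=
  closure_minimal (fun x hx => by
    by_contra h
    exact hx (hξ.eq_zero x fun h' => h (Ioo_subset_Icc_self h'))) isClosed_Icc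

end Cutoff

/-! ### Splitting the remainder between V and the mollified W. -/

section Remainder

variable {φ φ' : ℝ → ℂ} {lam : ℝ} {n : ℕ}

theorem measurable_remainderSize (U : ℝ → ℂ) (n : ℕ) (lam : ℝ) :
    Measurable (remainderSize U n lam) := by
  rcases n with _ | n
  · exact (measurable_deriv U).norm.const_mul _
  · exact ((measurable_deriv _).norm.const_mul _).add
      ((((measurable_deriv U).norm.pow_const 2).const_mul _).const_mul 2)

theorem remainderSize_nonneg (U : ℝ → ℂ) (n : ℕ) (hlam : 0 < lam) (x : ℝ) :
    0 ≤ remainderSize U n lam x := by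
  rcases n with _ | n <;> simp only [remainderSize] <;> positivity

theorem eLpNorm_ofReal_mul {E : Type*} [NormedAddCommGroup E] [NormedSpace ℝ E]
    {μ : Measure ℝ} (c : ℝ) (hc : 0 ≤ c) (h : ℝ → E) :
    eLpNorm (fun x => c * ‖h x‖) 2 μ = ENNReal.ofReal c * eLpNorm h 2 μ := by
  have : (fun x => c * ‖h x‖) = c • fun x => ‖h x‖ := rfl
  rw [this, eLpNorm_const_smul, eLpNorm_norm, Real.enorm_eq_ofReal hc]

theorem eLpNorm_remainder_le (hφ : AEStronglyMeasurable φ volume) (hφ' : ContDiff ℝ ∞ φ')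
    (hlam : 0 < lam) (J : Set ℝ) :
    eLpNorm (fun x => ‖φ x - φ' x‖ + 2 * remainderSize φ' n lam x) 2 (volume.restrict J) ≤
      4 * pieceError n φ φ' J lam := by
  have m0 : AEStronglyMeasurable (fun x => ‖φ x - φ' x‖) (volume.restrict J) :=
    (hφ.sub hφ'.continuous.aestronglyMeasurable).norm.restrict
  refine (eLpNorm_add_le m0 ((measurable_remainderSize φ' n lam).const_mul
    2).aestronglyMeasurable one_le_two).trans ?_
  have e2 : eLpNorm (fun x => 2 * remainderSize φ' n lam x) 2 (volume.restrict J) =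
      2 * eLpNorm (remainderSize φ' n lam) 2 (volume.restrict J) := by
    have : (fun x => 2 * remainderSize φ' n lam x) = (2 : ℝ) • remainderSize φ' n lam := rfl
    rw [this, eLpNorm_const_smul, Real.enorm_eq_ofReal zero_le_two, ENNReal.ofReal_ofNat]
  rw [eLpNorm_norm, e2]
  rcases n with _ | n
  · simp only [pieceError]
    have : eLpNorm (remainderSize φ' 0 lam) 2 (volume.restrict J) =
        ENNReal.ofReal (lam ^ (-(1 / 2) : ℝ)) * eLpNorm (deriv φ') 2 (volume.restrict J) :=
      eLpNorm_ofReal_mul _ (Real.rpow_nonneg hlam.le _) _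
    rw [this, mul_add]
    refine add_le_add (le_mul_of_one_le_left zero_le (by norm_num)) ?_
    gcongr
    norm_num
  · simp only [pieceError]
    have h1 : eLpNorm (remainderSize φ' (n + 1) lam) 2 (volume.restrict J) ≤
        ENNReal.ofReal lam⁻¹ * eLpNorm (deriv (deriv φ')) 2 (volume.restrict J) +
        2 * (ENNReal.ofReal (lam ^ 2)⁻¹ *
          eLpNorm (fun x => ‖deriv φ' x‖ ^ 2) 2 (volume.restrict J)) := by
      refine (eLpNorm_add_le
        (f := fun x => lam⁻¹ * ‖deriv (deriv φ') x‖)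
        (g := fun x => 2 * ((lam ^ 2)⁻¹ * ‖deriv φ' x‖ ^ 2))
        ((measurable_deriv _).norm.const_mul _).aestronglyMeasurable
        ((((measurable_deriv φ').norm.pow_const 2).const_mul _).const_mul
          2).aestronglyMeasurable one_le_two).trans ?_
      rw [eLpNorm_ofReal_mul _ (by positivity)]
      refine add_le_add le_rfl (le_of_eq ?_)
      have : (fun x => 2 * ((lam ^ 2)⁻¹ * ‖deriv φ' x‖ ^ 2)) =
          fun x => (2 * (lam ^ 2)⁻¹) * ‖‖deriv φ' x‖ ^ 2‖ := by
        funext x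
        rw [Real.norm_of_nonneg (by positivity)]
        ring
      rw [this, eLpNorm_ofReal_mul _ (by positivity), ENNReal.ofReal_mul zero_le_two,
        ENNReal.ofReal_ofNat, mul_assoc]
    refine (add_le_add le_rfl (mul_le_mul_right h1 2)).trans ?_
    rw [mul_add, mul_add, mul_add, ← mul_assoc 2 2, ← add_assoc]
    refine add_le_add (add_le_add (le_mul_of_one_le_left zero_le (by norm_num)) ?_) ?_
    · gcongr
      norm_num
    · gcongr
      norm_num

/-- The factors 2 are due to the square of U' = V' + P'; all other terms are subadditive. -/
theorem remainderSize_add_le {V P U : ℝ → ℂ} (hU : U = fun y => V y + P y) (hn : n ≤ 1)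
    (hlam : 0 < lam) {x : ℝ}
    (hP : ContDiff ℝ ∞ P) (hV : DifferentiableAt ℝ V x)
    (hV' : n = 1 → Differentiable ℝ V ∧ DifferentiableAt ℝ (deriv V) x) :
    DifferentiableAt ℝ U x ∧ (n = 1 → DifferentiableAt ℝ (deriv U) x) ∧
    remainderSize U n lam x ≤ 2 * remainderSize V n lam x + 2 * remainderSize P n lam x := by
  have hPd : Differentiable ℝ P := hP.differentiable (by simp)
  have hPd' : Differentiable ℝ (deriv P) :=
    (contDiff_infty_iff_deriv.1 hP).2.differentiable (by simp)
  have hd : deriv U x = deriv V x + deriv P x := by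
    rw [hU]
    exact deriv_add hV (hPd x)
  have e : n = 1 → deriv U = fun y => deriv V y + deriv P y := fun h => by
    rw [hU]
    exact funext fun y => deriv_add ((hV' h).1 y) (hPd y)
  refine ⟨by rw [hU]; exact hV.add (hPd x), fun h => ?_, ?_⟩
  · rw [e h]
    exact (hV' h).2.add (hPd' x)
  · interval_cases n
    · simp only [remainderSize, hd]
      have h1 := norm_add_le (deriv V x) (deriv P x)
      have hp := Real.rpow_nonneg hlam.le (-(1 / 2))
      calc _ ≤ lam ^ (-(1 / 2) : ℝ) * (‖deriv V x‖ + ‖deriv P x‖) := by gcongr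
        _ ≤ _ := by nlinarith [mul_nonneg hp (norm_nonneg (deriv V x)),
          mul_nonneg hp (norm_nonneg (deriv P x))]
    · have hdd : deriv (deriv U) x = deriv (deriv V) x + deriv (deriv P) x := by
        rw [e rfl]
        exact deriv_add (hV' rfl).2 (hPd' x)
      simp only [remainderSize, hd, hdd]
      have h1 := norm_add_le (deriv V x) (deriv P x)
      have h2 := norm_add_le (deriv (deriv V) x) (deriv (deriv P) x)
      have h3 : ‖deriv V x + deriv P x‖ ^ 2 ≤ 2 * (‖deriv V x‖ ^ 2 + ‖deriv P x‖ ^ 2) := by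
        calc _ ≤ (‖deriv V x‖ + ‖deriv P x‖) ^ 2 := by gcongr
          _ ≤ _ := by nlinarith [sq_nonneg (‖deriv V x‖ - ‖deriv P x‖)]
      calc _ ≤ lam⁻¹ * (‖deriv (deriv V) x‖ + ‖deriv (deriv P) x‖) +
            2 * ((lam ^ 2)⁻¹ * (2 * (‖deriv V x‖ ^ 2 + ‖deriv P x‖ ^ 2))) := by gcongr
        _ ≤ _ := by
          have a1 : 0 ≤ lam⁻¹ * ‖deriv (deriv V) x‖ := by positivity
          have a2 : 0 ≤ lam⁻¹ * ‖deriv (deriv P) x‖ := by positivity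
          linarith

end Remainder


/-! ### The residual of the pseudomode. -/

section Residual

variable {N n : ℕ} {ν : Side → ℝ} {ε₁ : ℝ} {ε₂ : Side → ℝ} {V W₁ W₂ : ℝ → ℂ} {w : ℝ → ℝ}
  {α : Side → ℝ} {α₀ : ℝ}

/-- Half of the decay rate pays for λ²: each factor λ is at most the exponential with rate c/4. -/
theorem RegularPotential.exists_pow_mul_kappa_le (hV : RegularPotential N ν ε₁ V) (hN : 1 ≤ N)
    (hν : ∀ s, ν s < 0) (hε₂ : ∀ s, 0 < ε₂ s) {c : ℝ} (hc : 0 < c) :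
    ∀ᶠ lam in atTop, ∀ s, lam ^ 2 * Real.exp (-c * decayExponent ν ε₁ ε₂ V s lam) ≤
      kappaRate ν ε₁ ε₂ V (c / 2) s lam := by
  filter_upwards [Side.eventually_forall fun s =>
    hV.lam_le_exp hN hν hε₂ s (show 0 < c / 4 by positivity), eventually_ge_atTop 0]
    with lam h hl s
  rw [kappaRate_eq]
  calc _ ≤ Real.exp (c / 4 * decayExponent ν ε₁ ε₂ V s lam) ^ 2 *
        Real.exp (-c * decayExponent ν ε₁ ε₂ V s lam) := by
        gcongr
        exact h s
    _ = _ := by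
        rw [← Real.exp_nat_mul, ← Real.exp_add]
        congr 1
        push_cast
        ring

/-- The interval on which the cut-off lives, without the origin. -/
def cutUnion (ν : Side → ℝ) (ε₁ : ℝ) (ε₂ : Side → ℝ) (V : ℝ → ℂ) (lam : ℝ) : Set ℝ :=
  cutInterval ν ε₁ ε₂ V .minus lam ∪ cutInterval ν ε₁ ε₂ V .plus lam

theorem measurableSet_cutUnion (lam : ℝ) : MeasurableSet (cutUnion ν ε₁ ε₂ V lam) :=
  (measurableSet_cutInterval _ _).union (measurableSet_cutInterval _ _)

theorem cutUnion_subset_carrier {lam : ℝ} (hδ : ∀ s, 0 ≤ cutRadius ν ε₁ ε₂ V s lam) :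
    cutUnion ν ε₁ ε₂ V lam ⊆ carrier ν ε₁ ε₂ V lam := by
  have key : ∀ s, cutInterval ν ε₁ ε₂ V s lam ⊆ carrier ν ε₁ ε₂ V lam := fun s x hx => by
    rw [mem_cutInterval] at hx
    rw [← s.sgn_mul_sgn_mul (x := x)]
    exact sgn_mul_mem_carrier hδ hx.1.le hx.2.le
  exact union_subset (key _) (key _)

/-- Away from the origin, the cut-off is supported in `J₋ ∪ J₊`. -/
theorem exists_mem_cutInterval {lam x : ℝ} (hx0 : x ≠ 0)
    (hx : x ∈ Ioo (-cutRadius ν ε₁ ε₂ V .minus lam) (cutRadius ν ε₁ ε₂ V .plus lam)) :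
    ∃ s, x ∈ cutInterval ν ε₁ ε₂ V s lam := by
  rcases lt_or_gt_of_ne hx0 with h | h
  · refine ⟨.minus, mem_cutInterval.2 ?_⟩
    simp only [Side.sgn]
    constructor <;> linarith [hx.1]
  · refine ⟨.plus, mem_cutInterval.2 ?_⟩
    simp only [Side.sgn, one_mul]
    exact ⟨h, hx.2⟩

theorem mem_cutUnion_of_mem {lam x : ℝ} {s : Side} (hx : x ∈ cutInterval ν ε₁ ε₂ V s lam) :
    x ∈ cutUnion ν ε₁ ε₂ V lam := by
  cases s
  exacts [Or.inl hx, Or.inr hx]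

theorem ofReal_inv_le_eLpNorm {f : ℝ → ℂ} {C : ℝ} (hC : 0 < C)
    (hf : ∀ x ∈ Icc (0 : ℝ) 1, C⁻¹ ≤ ‖f x‖) : ENNReal.ofReal C⁻¹ ≤ eLpNorm f 2 volume := by
  have h1 : eLpNorm ((Icc (0 : ℝ) 1).indicator fun _ => C⁻¹) 2 volume = ENNReal.ofReal C⁻¹ := by
    rw [eLpNorm_indicator_const measurableSet_Icc two_ne_zero ENNReal.ofNat_ne_top,
      Real.volume_Icc, Real.enorm_eq_ofReal (by positivity)]
    simp
  rw [← h1]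
  refine eLpNorm_mono fun x => ?_
  by_cases hx : x ∈ Icc (0 : ℝ) 1
  · rw [indicator_of_mem hx, Real.norm_of_nonneg (by positivity)]
    exact hf x hx
  · rw [indicator_of_notMem hx, norm_zero]
    exact norm_nonneg _

theorem sigmaRate_nonneg {lam : ℝ} (hlam : 0 ≤ lam) (n : ℕ) (s : Side) :
    0 ≤ sigmaRate ν ε₁ ε₂ V n s lam := by
  unfold sigmaRate
  split_ifs
  · exact Real.rpow_nonneg hlam _
  · refine mul_nonneg (Real.rpow_nonneg hlam _) (Real.sSup_nonneg ?_)
    rintro _ ⟨x, -, rfl⟩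
    exact mul_nonneg (norm_nonneg _) (Real.rpow_nonneg (bracket_pos x).le _)

theorem kappaRate_nonneg (c : ℝ) (s : Side) (lam : ℝ) : 0 ≤ kappaRate ν ε₁ ε₂ V c s lam := by
  rw [kappaRate_eq]
  exact (Real.exp_pos _).le

/-- The residual is controlled by the cut-off error, the remainder of the expansion for the
regular potential and the mollification error. -/
theorem RoughPotential.exists_residual_bound (hW : RoughPotential ν ε₁ ε₂ V W₁ W₂)
    (hV : RegularPotential N ν ε₁ V) (hn : n ≤ 1) (hN : n + 1 ≤ N) (hν : ∀ s, ν s < 0)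
    (hε₂ : ∀ s, 0 < ε₂ s) (hw : IsMollifier w) (hα : ∀ s, 0 < α s ∧ α s < 1)
    (hα₀ : 0 < α₀ ∧ α₀ < 1) {ξ : ℝ → ℝ → ℝ}
    (hξ : ∃ C : ℝ, ∀ᶠ lam in atTop, IsCutoff (fun s => cutRadius ν ε₁ ε₂ V s lam)
      (fun s => cutWidth ν ε₁ ε₂ V s lam) C (ξ lam)) :
    ∃ C c : ℝ, 1 ≤ C ∧ 0 < c ∧ ∀ᶠ lam in atTop,
      pseudomode w α α₀ V W₁ W₂ ξ n lam ∈ schrodingerDomain (fun y => V y + (W₁ y + W₂ y)) ∧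
      MemLp (pseudomode w α α₀ V W₁ W₂ ξ n lam) 2 volume ∧
      ENNReal.ofReal C⁻¹ ≤ eLpNorm (pseudomode w α α₀ V W₁ W₂ ξ n lam) 2 volume ∧
      eLpNorm (fun x => schrodinger (fun y => V y + (W₁ y + W₂ y))
          (pseudomode w α α₀ V W₁ W₂ ξ n lam) x -
          (lam : ℂ) * pseudomode w α α₀ V W₁ W₂ ξ n lam x) 2 volume ≤
        ENNReal.ofReal C * (ENNReal.ofReal (kappaRate ν ε₁ ε₂ V c .minus lam) +
          ENNReal.ofReal (kappaRate ν ε₁ ε₂ V c .plus lam)) +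
        ENNReal.ofReal C * (ENNReal.ofReal (sigmaRate ν ε₁ ε₂ V n .minus lam) +
          ENNReal.ofReal (sigmaRate ν ε₁ ε₂ V n .plus lam)) *
          eLpNorm (pseudomode w α α₀ V W₁ W₂ ξ n lam) 2 volume +
        ENNReal.ofReal C * pieceError n (fun x => W₁ x + W₂ x) (mollifiedW w α α₀ W₁ W₂ lam)
          (cutUnion ν ε₁ ε₂ V lam) lam := by
  have hN1 : 1 ≤ N := by omega
  have hα' : ∀ s, 0 < α s := fun s => (hα s).1
  obtain ⟨C₁, c, hC₁, hc, hamp⟩ := hW.exists_amplitude_bounds hV hn hN hν hε₂ hw hα' hα₀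
  obtain ⟨C₂, -, hspec⟩ := hW.exists_spectral_bounds hV hN1 hν hε₂ hw hα' hα₀
  obtain ⟨C₃, hC₃, hlog⟩ := hW.exists_logDeriv_le hV hn hN hν hε₂ hw hα hα₀
  choose C₄ hC₄ hrem using fun s => hV.exists_remainder_le (ε₂ := ε₂) hn hN hν hε₂ s
  obtain ⟨K, hK, hCK⟩ := Side.exists_upper C₄
  obtain ⟨C₅, hξ⟩ := hξ
  have hL := (hV.lipschitz_and_bounds hN1).1
  set C₆ := |C₅| with hC₆
  have hC₆0 : 0 ≤ C₆ := abs_nonneg _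
  refine ⟨12 * C₆ * C₃ * C₁ + 2 * K + 4 * C₁, c / 2, ?_, by positivity, ?_⟩
  · nlinarith [show 0 ≤ 12 * C₆ * C₃ * C₁ by positivity]
  have hδ : ∀ᶠ lam in atTop, ∀ s, 2 ≤ cutRadius ν ε₁ ε₂ V s lam ∧
      1 / 4 ≤ cutWidth ν ε₁ ε₂ V s lam ∧
      cutWidth ν ε₁ ε₂ V s lam ≤ cutRadius ν ε₁ ε₂ V s lam / 4 :=
    Side.eventually_forall fun s =>
      ((hV.tendsto_cutRadius hε₂ s).eventually_ge_atTop 2).and (hV.cutWidth_bounds hN1 hν hε₂ s)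
  filter_upwards [hamp, hspec, hlog, Side.eventually_forall hrem, hξ, hδ,
    hV.exists_pow_mul_kappa_le hN1 hν hε₂ hc, eventually_ge_atTop 1]
    with lam hamp hsp hlog hrem hξ hδ hkap hl1
  have hl : 0 < lam := by linarith
  obtain ⟨hcar, hlow, hdecay⟩ := hamp
  set U := smoothedPotential w α α₀ V W₁ W₂ lam with hU
  set g : ℝ → ℂ := fun x => Complex.exp (∫ t in (0 : ℝ)..x, logDeriv U n lam t) with hg
  set f := pseudomode w α α₀ V W₁ W₂ ξ n lam with hf
  set δ : Side → ℝ := fun s => cutRadius ν ε₁ ε₂ V s lam with hδdef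
  set Δ : Side → ℝ := fun s => cutWidth ν ε₁ ε₂ V s lam with hΔdef
  have hδ0 : ∀ s, 0 ≤ cutRadius ν ε₁ ε₂ V s lam := fun s => by linarith [(hδ s).1]
  have hδd : ∀ s, 2 ≤ δ s ∧ 1 / 4 ≤ Δ s ∧ Δ s ≤ δ s / 4 := hδ
  -- The two exponentials are only known to agree on the carrier; elsewhere the cut-off is zero.
  have hfg : f = fun y => (ξ lam y : ℂ) * g y := by
    funext x
    by_cases hx : x ∈ Ioo (-δ .minus) (δ .plus)
    · have : jwkb U n lam x = g x := (hcar x (mem_carrier_iff.2 (Ioo_subset_Icc_self hx))).1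
      rw [← this]
      rfl
    · have h0 : ξ lam x = 0 := hξ.eq_zero x hx
      simp [hf, pseudomode, h0]
  have hle : -δ .minus ≤ δ .plus := by linarith [(hδd .minus).1, (hδd .plus).1]
  obtain ⟨a, b, ha, hb, hlip⟩ := exists_Ioo_lipAt hle
    fun x hx => (hcar x (mem_carrier_iff.2 hx)).2.1
  obtain ⟨hfc, hf2, hdom, hform⟩ := schrodinger_cutoff_exp hV.continuous hW.measurable₁
    (hW.exists_bound hV.continuous) hW.memLp₂ hξ.contDiff hξ.compact
    (a := a) (b := b) ⟨by linarith [(hδd .minus).1], by linarith [(hδd .plus).1]⟩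
    (hξ.tsupport_subset.trans (Icc_subset_Ioo ha hb)) hlip hfg
  -- The interval [0, 1] lies in the plateau, and the exponential is bounded below there.
  have hflow : ENNReal.ofReal C₁⁻¹ ≤ eLpNorm f 2 volume := by
    refine ofReal_inv_le_eLpNorm (by linarith) fun x hx => ?_
    have h1 : ξ lam x = 1 := hξ.eq_one x
      ⟨by linarith [hx.1, hδd .minus], by linarith [hx.2, (hδd .plus).1, (hδd .plus).2.2]⟩
    rw [hfg]
    simp only [h1, Complex.ofReal_one, one_mul]
    exact hlow x hx
  have hfle : ∀ x, ‖f x‖ ≤ C₁ := by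
    intro x
    rw [hfg]
    by_cases hx : x ∈ Ioo (-δ .minus) (δ .plus)
    · have h1 : ‖g x‖ ≤ C₁ := (hcar x (mem_carrier_iff.2 (Ioo_subset_Icc_self hx))).2.2
      rw [norm_mul, Complex.norm_real, Real.norm_of_nonneg (hξ.nonneg x)]
      exact (mul_le_of_le_one_left (norm_nonneg _) (hξ.le_one x)).trans h1
    · simp only [hξ.eq_zero x hx, Complex.ofReal_zero, zero_mul, norm_zero]
      linarith
  set P := mollifiedW w α α₀ W₁ W₂ lam with hP
  have hPc : ContDiff ℝ ∞ P := hW.contDiff_mollifiedW hV.continuous hw hl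
  set J := cutUnion ν ε₁ ε₂ V lam with hJ
  set B : Side → ℝ := fun s => C₁ * Real.exp (-c * decayExponent ν ε₁ ε₂ V s lam) with hB
  have hB0 : ∀ s, 0 ≤ B s := fun s => by positivity
  set A := 2 * K * (sigmaRate ν ε₁ ε₂ V n .minus lam + sigmaRate ν ε₁ ε₂ V n .plus lam) with hA
  have hσ0 := fun s => sigmaRate_nonneg (ν := ν) (ε₁ := ε₁) (ε₂ := ε₂) (V := V) hl.le n s
  have hA0 : 0 ≤ A := by
    have := hσ0 .minus
    have := hσ0 .plus
    positivity
  set M := C₃ * lam ^ 2 with hM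
  have hM1 : 1 ≤ M := by nlinarith
  set T : Side → ℝ → ℝ := fun s => (transitionRegion δ Δ s).indicator
    fun _ => 6 * C₆ * M * B s / Δ s with hT
  set Z : ℝ → ℝ := fun x => ‖W₁ x + W₂ x - P x‖ + 2 * remainderSize P n lam x with hZ
  have hZ0 : ∀ x, 0 ≤ Z x := fun x =>
    add_nonneg (norm_nonneg _) (mul_nonneg zero_le_two (remainderSize_nonneg _ _ hl _))
  have hξ' : IsCutoff δ Δ C₆ (ξ lam) := { hξ with
    deriv_le := fun s j h1 h2 x hx => (hξ.deriv_le s j h1 h2 x hx).trans (by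
      have : 0 ≤ ((fun s => cutWidth ν ε₁ ε₂ V s lam) s ^ j)⁻¹ := by
        have := (hδd s).2.1
        have : 0 ≤ Δ s := by linarith
        positivity
      exact mul_le_mul_of_nonneg_right (le_abs_self _) this) }
  have hpt : ∀ᵐ x ∂volume, ‖schrodinger (fun y => V y + (W₁ y + W₂ y)) f x - (lam : ℂ) * f x‖ ≤
      (T .minus x + T .plus x) + A * ‖f x‖ + J.indicator (fun x => C₁ * Z x) x := by
    have hrem' : ∀ᵐ x ∂volume, ∀ s, x ∈ cutInterval ν ε₁ ε₂ V s lam →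
        remainderSize V n lam x ≤ C₄ s * sigmaRate ν ε₁ ε₂ V n s lam := by
      filter_upwards [hrem .minus, hrem .plus] with x h1 h2 s hx
      cases s
      exacts [(h1 hx).2, (h2 hx).2]
    have hreg : ∀ᵐ x ∂volume, n = 1 → Differentiable ℝ V ∧ DifferentiableAt ℝ (deriv V) x := by
      by_cases h1 : n = 1
      · obtain ⟨hd, hL2, -⟩ := hV.contDiff_and_bounds (by omega)
        filter_upwards [hasDerivAt_ae_of_locallyLipschitz hL2] with x hx _
        exact ⟨hd, hx.differentiableAt⟩
      · exact Eventually.of_forall fun x h => absurd h h1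
    have hy0 : ∀ᵐ y ∂(volume : Measure ℝ), y ≠ 0 := by simp [ae_iff, measure_singleton]
    filter_upwards [hform lam, hrem', hreg, hasDerivAt_ae_of_locallyLipschitz hL, hlog, hy0]
      with x h1 h2 h3 h4 h5 h6
    rw [h1]
    refine (norm_add_le _ _).trans ?_
    rw [norm_neg, add_assoc]
    have hcomm := hξ'.norm_commutator_le hC₆0 (fun s => (hδd s).2.1) (fun s => (hδd s).2.2)
      (x := x) (m := logDeriv U n lam x) (g := g x) (M := M) (B := B) hM1 hB0
      (fun hx => h5 (mem_carrier_iff.2 hx)) (fun s hx => by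
        have := hdecay s (s.sgn * x) hx.1 hx.2
        rwa [s.sgn_mul_sgn_mul] at this)
    refine add_le_add hcomm ?_
    by_cases hx : x ∈ Ioo (-δ .minus) (δ .plus)
    · obtain ⟨s, hs⟩ := exists_mem_cutInterval h6 hx
      have hxJ : x ∈ J := mem_cutUnion_of_mem hs
      rw [indicator_of_mem hxJ]
      have hxc : x ∈ carrier ν ε₁ ε₂ V lam := cutUnion_subset_carrier hδ0 hxJ
      obtain ⟨u1, u2, u3⟩ := remainderSize_add_le (U := U) (V := V) (P := P) rfl hn hl hPc
        h4.differentiableAt h3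
      have hr := norm_remainder_le hn hl u1 u2 (hsp x hxc).1
      -- The potential is that of the WKB expansion plus the mollification error.
      have e : V x + (W₁ x + W₂ x) - lam - (deriv (logDeriv U n lam) x + logDeriv U n lam x ^ 2) =
          (W₁ x + W₂ x - P x) +
          (U x - lam - (deriv (logDeriv U n lam) x + logDeriv U n lam x ^ 2)) := by
        simp only [hU, smoothedPotential, hP]
        ring
      have hrV : 2 * remainderSize V n lam x ≤ A := by
        have q1 := h2 s hs
        have q2 : C₄ s * sigmaRate ν ε₁ ε₂ V n s lam ≤ K * sigmaRate ν ε₁ ε₂ V n s lam :=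
          mul_le_mul_of_nonneg_right (hCK s) (hσ0 s)
        have q3 : sigmaRate ν ε₁ ε₂ V n s lam ≤
            sigmaRate ν ε₁ ε₂ V n .minus lam + sigmaRate ν ε₁ ε₂ V n .plus lam := by
          cases s
          · exact le_add_of_nonneg_right (hσ0 .plus)
          · exact le_add_of_nonneg_left (hσ0 .minus)
        have q4 := mul_le_mul_of_nonneg_left q3 (by linarith : 0 ≤ K)
        rw [hA]
        linarith
      have htot : ‖V x + (W₁ x + W₂ x) - lam -
          (deriv (logDeriv U n lam) x + logDeriv U n lam x ^ 2)‖ ≤ A + Z x := by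
        rw [e]
        refine (norm_add_le _ _).trans ?_
        simp only [hZ]
        linarith
      rw [norm_mul]
      -- The share of V keeps the factor |f| and yields an error relative to the norm of f. In the
      -- rough share |f| is replaced by its bound C₁, so that only the size of the rough terms
      -- remains; this is why ζ appears divided by the norm.
      calc _ ≤ (A + Z x) * ‖f x‖ := mul_le_mul_of_nonneg_right htot (norm_nonneg _)
        _ ≤ A * ‖f x‖ + C₁ * Z x := by
          rw [add_mul, mul_comm C₁]
          exact add_le_add le_rfl (mul_le_mul_of_nonneg_left (hfle x) (hZ0 x))
    · have : f x = 0 := by rw [hfg]; simp [hξ.eq_zero x hx]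
      rw [this, mul_zero, norm_zero, mul_zero, zero_add]
      exact indicator_nonneg (fun y _ => mul_nonneg (by linarith) (hZ0 y)) x
  refine ⟨hdom, hf2, ?_, ?_⟩
  · refine le_trans (ENNReal.ofReal_le_ofReal ?_) hflow
    refine inv_anti₀ (by linarith) ?_
    nlinarith [show 0 ≤ 12 * C₆ * C₃ * C₁ by positivity]
  · have mT : ∀ s, AEStronglyMeasurable (T s) volume := fun s =>
      (measurable_const.indicator (measurableSet_transitionRegion s)).aestronglyMeasurable
    have mf : AEStronglyMeasurable (fun x => A * ‖f x‖) volume :=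
      (hfc.norm.const_mul A).aestronglyMeasurable
    have mZ : AEStronglyMeasurable (J.indicator fun x => C₁ * Z x) volume := by
      refine AEStronglyMeasurable.indicator ?_ (measurableSet_cutUnion lam)
      refine AEStronglyMeasurable.const_mul ?_ _
      exact (((hW.measurable₁.add hW.memLp₂.1).sub hPc.continuous.aestronglyMeasurable).norm).add
        ((measurable_remainderSize P n lam).const_mul 2).aestronglyMeasurable
    refine (eLpNorm_mono_ae_real hpt).trans ?_
    refine (eLpNorm_add_le (((mT _).add (mT _)).add mf) mZ one_le_two).trans ?_
    refine add_le_add ((eLpNorm_add_le ((mT _).add (mT _)) mf one_le_two).trans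
      (add_le_add ((eLpNorm_add_le (mT _) (mT _) one_le_two).trans ?_) ?_)) ?_
    · have key : ∀ s, eLpNorm (T s) 2 volume ≤ ENNReal.ofReal
          (12 * C₆ * C₃ * C₁ + 2 * K + 4 * C₁) *
            ENNReal.ofReal (kappaRate ν ε₁ ε₂ V (c / 2) s lam) := by
        intro s
        refine (eLpNorm_indicator_transitionRegion_le s (hδd s).2.1
          (by have := hB0 s; positivity)).trans ?_
        rw [← ENNReal.ofReal_mul (by positivity)]
        refine ENNReal.ofReal_le_ofReal ?_
        have h1 := hkap s
        have h2 : 0 ≤ 12 * C₆ * C₃ * C₁ := by positivity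
        have h3 := mul_le_mul_of_nonneg_left h1 h2
        have h4 : 0 ≤ (2 * K + 4 * C₁) * kappaRate ν ε₁ ε₂ V (c / 2) s lam :=
          mul_nonneg (by positivity) (kappaRate_nonneg _ _ _)
        simp only [hM, hB]
        linarith
      rw [mul_add]
      exact add_le_add (key _) (key _)
    · rw [eLpNorm_ofReal_mul _ hA0, ← ENNReal.ofReal_add (hσ0 _) (hσ0 _),
        ← ENNReal.ofReal_mul (by positivity)]
      refine mul_le_mul_left (ENNReal.ofReal_le_ofReal ?_) _
      rw [hA]
      refine mul_le_mul_of_nonneg_right ?_ (add_nonneg (hσ0 _) (hσ0 _))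
      linarith [show 0 ≤ 12 * C₆ * C₃ * C₁ by positivity]
    · rw [eLpNorm_indicator_eq_eLpNorm_restrict (measurableSet_cutUnion lam)]
      have e1 : (fun x => C₁ * Z x) = C₁ • Z := rfl
      rw [e1, eLpNorm_const_smul, Real.enorm_eq_ofReal (by linarith)]
      have h1 := eLpNorm_remainder_le (n := n) (hW.measurable₁.add hW.memLp₂.1) hPc hl J
      refine (mul_le_mul_right h1 _).trans ?_
      rw [← mul_assoc]
      refine mul_le_mul_left ?_ _
      rw [show (4 : ℝ≥0∞) = ENNReal.ofReal 4 by norm_num, ← ENNReal.ofReal_mul (by linarith)]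
      refine ENNReal.ofReal_le_ofReal ?_
      linarith [show 0 ≤ 12 * C₆ * C₃ * C₁ by positivity]

end Residual


/-! ### From the norm bound to the decomposition of the quotient. -/

/-- Riesz decomposition: take the smaller of x and a, and the rest. The bounds may be infinite, the
parts are not. -/
theorem exists_add_of_le_add {x : ℝ≥0} {a b : ℝ≥0∞} (h : (x : ℝ≥0∞) ≤ a + b) :
    ∃ y z : ℝ≥0, x = y + z ∧ (y : ℝ≥0∞) ≤ a ∧ (z : ℝ≥0∞) ≤ b := by
  by_cases hx : (x : ℝ≥0∞) ≤ a
  · exact ⟨x, 0, (add_zero x).symm, hx, by simp⟩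
  · have ha : a ≠ ⊤ := (lt_of_not_ge hx).ne_top
    lift a to ℝ≥0 using ha
    rw [ENNReal.coe_le_coe, not_le] at hx
    refine ⟨a, x - a, (add_tsub_cancel_of_le hx.le).symm, le_rfl, ?_⟩
    rw [ENNReal.coe_sub]
    exact tsub_le_iff_left.2 h

theorem exists_sides_of_le_add {x : ℝ≥0} {a : Side → ℝ≥0∞}
    (h : (x : ℝ≥0∞) ≤ a .minus + a .plus) :
    ∃ y : Side → ℝ≥0, x = y .minus + y .plus ∧ ∀ s, (y s : ℝ≥0∞) ≤ a s := by
  obtain ⟨y, z, hx, hy, hz⟩ := exists_add_of_le_add h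
  refine ⟨fun s => match s with | .minus => y | .plus => z, hx, fun s => ?_⟩
  cases s
  exacts [hy, hz]

section Decomposition

variable {N n : ℕ} {ν : Side → ℝ} {ε₁ : ℝ} {ε₂ : Side → ℝ} {V W₁ W₂ : ℝ → ℂ} {w : ℝ → ℝ}
  {α : Side → ℝ} {α₀ : ℝ}

theorem abs_div_le_of_coe_le {y r : ℝ≥0} {C b : ℝ} (hr : C⁻¹ ≤ r) (hC : 0 < C)
    (hb : 0 ≤ b) (hy : (y : ℝ≥0∞) ≤ ENNReal.ofReal C * ENNReal.ofReal b) :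
    |(y : ℝ) / r| ≤ C ^ 2 * b := by
  have hr0 : 0 < (r : ℝ) := lt_of_lt_of_le (by positivity) hr
  rw [abs_of_nonneg (by positivity), div_le_iff₀ hr0]
  rw [← ENNReal.ofReal_mul hC.le] at hy
  have hy' : (y : ℝ) ≤ C * b := ENNReal.toReal_le_of_le_ofReal (by positivity) hy
  have h1 : 1 ≤ C * r := by
    rwa [← div_le_iff₀' hC, one_div]
  nlinarith [mul_nonneg hC.le hb]

/-- A bound by a sum of seven terms yields a decomposition. -/
theorem decomposition_of_le {Φ : Side → ℝ → ℂ} {f : ℝ → ℝ → ℂ} {r : ℝ → ℝ}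
    {C c : ℝ} (hC : 1 ≤ C) (hc : 0 < c) (hr : ∀ lam, 0 ≤ r lam) {D : ℝ≥0}
    (h : ∀ᶠ lam in atTop, C⁻¹ ≤ norm2 (f lam) ∧ ENNReal.ofReal (r lam) ≤
      ENNReal.ofReal C * (ENNReal.ofReal (kappaRate ν ε₁ ε₂ V c .minus lam) +
        ENNReal.ofReal (kappaRate ν ε₁ ε₂ V c .plus lam)) +
      ENNReal.ofReal C * (ENNReal.ofReal (sigmaRate ν ε₁ ε₂ V n .minus lam) +
        ENNReal.ofReal (sigmaRate ν ε₁ ε₂ V n .plus lam)) * ENNReal.ofReal (norm2 (f lam)) +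
      D * ((zetaRate n (lam ^ (-α .minus)) (Φ .minus) (cutInterval ν ε₁ ε₂ V .minus lam) lam +
        zetaRate n (lam ^ (-α .plus)) (Φ .plus) (cutInterval ν ε₁ ε₂ V .plus lam) lam) +
        zetaRate n (lam ^ (-α₀)) W₂ univ lam)) :
    Decomposition ν ε₁ ε₂ V α α₀ n Φ W₂ f fun lam => r lam / norm2 (f lam) := by
  -- The terms are chosen separately for each λ, and as zero where the bound fails, which happens
  -- only outside a neighbourhood of infinity.
  have hpt : ∀ lam, ∃ (k σ z : Side → ℝ) (z₀ : ℝ), 0 < lam → (C⁻¹ ≤ norm2 (f lam) ∧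
      ENNReal.ofReal (r lam) ≤
      ENNReal.ofReal C * (ENNReal.ofReal (kappaRate ν ε₁ ε₂ V c .minus lam) +
        ENNReal.ofReal (kappaRate ν ε₁ ε₂ V c .plus lam)) +
      ENNReal.ofReal C * (ENNReal.ofReal (sigmaRate ν ε₁ ε₂ V n .minus lam) +
        ENNReal.ofReal (sigmaRate ν ε₁ ε₂ V n .plus lam)) * ENNReal.ofReal (norm2 (f lam)) +
      D * ((zetaRate n (lam ^ (-α .minus)) (Φ .minus) (cutInterval ν ε₁ ε₂ V .minus lam) lam +
        zetaRate n (lam ^ (-α .plus)) (Φ .plus) (cutInterval ν ε₁ ε₂ V .plus lam) lam) +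
        zetaRate n (lam ^ (-α₀)) W₂ univ lam)) →
      r lam / norm2 (f lam) = (k .minus + k .plus) + (σ .minus + σ .plus) +
        (z .minus + z .plus + z₀) / norm2 (f lam) ∧
      (∀ s, |k s| ≤ C ^ 2 * kappaRate ν ε₁ ε₂ V c s lam) ∧
      (∀ s, |σ s| ≤ C * sigmaRate ν ε₁ ε₂ V n s lam) ∧
      (∀ s, ENNReal.ofReal |z s| ≤
        D * zetaRate n (lam ^ (-α s)) (Φ s) (cutInterval ν ε₁ ε₂ V s lam) lam) ∧
      ENNReal.ofReal |z₀| ≤ D * zetaRate n (lam ^ (-α₀)) W₂ univ lam := by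
    intro lam
    by_cases hP : 0 < lam ∧ (C⁻¹ ≤ norm2 (f lam) ∧ ENNReal.ofReal (r lam) ≤
      ENNReal.ofReal C * (ENNReal.ofReal (kappaRate ν ε₁ ε₂ V c .minus lam) +
        ENNReal.ofReal (kappaRate ν ε₁ ε₂ V c .plus lam)) +
      ENNReal.ofReal C * (ENNReal.ofReal (sigmaRate ν ε₁ ε₂ V n .minus lam) +
        ENNReal.ofReal (sigmaRate ν ε₁ ε₂ V n .plus lam)) * ENNReal.ofReal (norm2 (f lam)) +
      D * ((zetaRate n (lam ^ (-α .minus)) (Φ .minus) (cutInterval ν ε₁ ε₂ V .minus lam) lam +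
        zetaRate n (lam ^ (-α .plus)) (Φ .plus) (cutInterval ν ε₁ ε₂ V .plus lam) lam) +
        zetaRate n (lam ^ (-α₀)) W₂ univ lam))
    swap
    · exact ⟨0, 0, 0, 0, fun h1 h2 => absurd ⟨h1, h2⟩ hP⟩
    obtain ⟨hl, hf, hb⟩ := hP
    have hC0 : 0 < C := by linarith
    have hf0 : 0 < norm2 (f lam) := lt_of_lt_of_le (by positivity) hf
    rw [← ENNReal.ofNNReal_toNNReal, mul_add (ENNReal.ofReal C), mul_add (ENNReal.ofReal C),
      add_mul (ENNReal.ofReal C * _), mul_add (D : ℝ≥0∞), mul_add (D : ℝ≥0∞)] at hb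
    obtain ⟨y, z, h1, hy, hz⟩ := exists_add_of_le_add hb
    obtain ⟨yk, ys, h2, hyk, hys⟩ := exists_add_of_le_add hy
    obtain ⟨zs, z₀, h3, hzs, hz₀⟩ := exists_add_of_le_add hz
    obtain ⟨k, h4, hk⟩ := exists_sides_of_le_add (a := fun s =>
      ENNReal.ofReal C * ENNReal.ofReal (kappaRate ν ε₁ ε₂ V c s lam)) hyk
    obtain ⟨σ, h5, hσ⟩ := exists_sides_of_le_add (a := fun s =>
      ENNReal.ofReal C * ENNReal.ofReal (sigmaRate ν ε₁ ε₂ V n s lam) *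
        ENNReal.ofReal (norm2 (f lam))) hys
    obtain ⟨ζ, h6, hζ⟩ := exists_sides_of_le_add (a := fun s => (D : ℝ≥0∞) *
      zetaRate n (lam ^ (-α s)) (Φ s) (cutInterval ν ε₁ ε₂ V s lam) lam) hzs
    -- Division by the norm is harmless for κ, as the norm is bounded below, and cancels the norm in
    -- the bound for σ; ζ is left undivided.
    refine ⟨fun s => k s / norm2 (f lam), fun s => σ s / norm2 (f lam), fun s => ζ s, z₀,
      fun _ _ => ⟨?_, fun s => ?_, fun s => ?_, fun s => ?_, ?_⟩⟩
    · have e : r lam = ((r lam).toNNReal : ℝ) := (Real.coe_toNNReal _ (hr lam)).symm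
      rw [e, h1, h2, h3, h4, h5, h6]
      push_cast
      ring
    · have := abs_div_le_of_coe_le (r := (norm2 (f lam)).toNNReal)
        (by rwa [Real.coe_toNNReal _ hf0.le]) hC0 (kappaRate_nonneg c s lam) (hk s)
      rwa [Real.coe_toNNReal _ hf0.le] at this
    · have h7 := hσ s
      have h8 := sigmaRate_nonneg (ν := ν) (ε₁ := ε₁) (ε₂ := ε₂) (V := V) hl.le n s
      rw [← ENNReal.ofReal_mul hC0.le, ← ENNReal.ofReal_mul (by positivity)] at h7
      have h9 : (σ s : ℝ) ≤ C * sigmaRate ν ε₁ ε₂ V n s lam * norm2 (f lam) :=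
        ENNReal.toReal_le_of_le_ofReal (by positivity) h7
      rwa [abs_of_nonneg (by positivity), div_le_iff₀ hf0]
    · rw [abs_of_nonneg (NNReal.coe_nonneg _), ENNReal.ofReal_coe_nnreal]
      exact hζ s
    · rw [abs_of_nonneg (NNReal.coe_nonneg _), ENNReal.ofReal_coe_nnreal]
      exact hz₀
  choose k σ ζ ζ₀ hk using hpt
  have hev := h.and (eventually_gt_atTop 0)
  refine ⟨fun s lam => k lam s, fun s lam => σ lam s, fun s lam => ζ lam s, ζ₀, ?_,
    fun s => ⟨c, hc, ?_⟩, fun s => ?_, fun s => ⟨D, ?_⟩, ⟨D, ?_⟩⟩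
  · filter_upwards [hev] with lam hl using (hk lam hl.2 hl.1).1
  · refine IsBigO.of_bound (C ^ 2) ?_
    filter_upwards [hev] with lam hl
    rw [Real.norm_of_nonneg (kappaRate_nonneg c s lam)]
    exact (hk lam hl.2 hl.1).2.1 s
  · refine IsBigO.of_bound C ?_
    filter_upwards [hev] with lam hl
    rw [Real.norm_of_nonneg (sigmaRate_nonneg hl.2.le n s)]
    exact (hk lam hl.2 hl.1).2.2.1 s
  · filter_upwards [hev] with lam hl using (hk lam hl.2 hl.1).2.2.2.1 s
  · filter_upwards [hev] with lam hl using (hk lam hl.2 hl.1).2.2.2.2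

theorem indicator_add_indicator (W : ℝ → ℂ) {x : ℝ} (hx : x ≠ 0) :
    Side.minus.halfLine.indicator W x + Side.plus.halfLine.indicator W x = W x := by
  simp only [Side.halfLine]
  rcases lt_or_gt_of_ne hx with h | h
  · rw [indicator_of_mem (show x ∈ Iio (0 : ℝ) from h),
      indicator_of_notMem (fun h' : x ∈ Ioi (0 : ℝ) => lt_asymm h h'), add_zero]
  · rw [indicator_of_notMem (fun h' : x ∈ Iio (0 : ℝ) => lt_asymm h h'),
      indicator_of_mem (show x ∈ Ioi (0 : ℝ) from h), zero_add]

theorem mollify_indicator_add (hw : IsMollifier w) {ε : ℝ} (hε : 0 < ε) {φ : ℝ → ℂ}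
    (hφ : LocallyIntegrable φ volume) (x : ℝ) :
    mollify w ε (Side.minus.halfLine.indicator φ) x +
      mollify w ε (Side.plus.halfLine.indicator φ) x = mollify w ε φ x := by
  have hli := fun s : Side => hφ.indicator s.measurableSet_halfLine
  simp only [mollify_eq_mollifyDeriv_zero, mollifyDeriv_apply]
  rw [← integral_add (integrable_molKernel_smul hw hε 0 (hli .minus) x)
    (integrable_molKernel_smul hw hε 0 (hli .plus) x)]
  refine integral_congr_ae ?_
  have hy0 : ∀ᵐ t ∂(volume : Measure ℝ), t ≠ x := by simp [ae_iff, measure_singleton]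
  filter_upwards [hy0] with t ht
  rw [← smul_add, indicator_add_indicator φ (sub_ne_zero.2 ht.symm)]

/-- A half of W₁ vanishes on the opposite side, where its differences come only from shifts over the
origin; these are bounded by the modulus on its own side. -/
theorem eventually_modulus_indicator_le (hV : RegularPotential N ν ε₁ V)
    (hε₂ : ∀ s, 0 < ε₂ s) (hα : ∀ s, 0 < α s) (s : Side) : ∀ᶠ lam in atTop,
      modulus 2 (lam ^ (-α s)) (s.halfLine.indicator W₁) (cutUnion ν ε₁ ε₂ V lam) ≤
        2 * modulus 2 (lam ^ (-α s)) (s.halfLine.indicator W₁)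
          (cutInterval ν ε₁ ε₂ V s lam) := by
  filter_upwards [(hV.tendsto_cutRadius hε₂ s).eventually_ge_atTop 1,
    eventually_rpow_neg_le (hα s) one_pos] with lam h1 h2
  have leak : ∀ s', modulus 2 (lam ^ (-α s)) (s.halfLine.indicator W₁)
      (cutInterval ν ε₁ ε₂ V s' lam) ≤
        modulus 2 (lam ^ (-α s)) (s.halfLine.indicator W₁) (cutInterval ν ε₁ ε₂ V s lam) := by
    intro s'
    by_cases hs : s' = s
    · rw [hs]
    · refine modulus_leak_le s.sgn s.sgn_eq (fun x hx => indicator_of_notMem (fun h => ?_) _)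
        (fun x hx hx' => mem_cutInterval.2 ⟨hx, by linarith⟩) (fun x hx => ?_)
        (measurableSet_cutInterval _ _) (measurableSet_cutInterval _ _)
      · exact absurd (s.mem_halfLine.1 h) (not_lt.2 hx)
      · have := (mem_cutInterval.1 hx).1
        cases s <;> cases s' <;> simp only [Side.sgn, not_true_eq_false] at * <;> linarith
  refine (modulus_union_le _ _ _).trans ?_
  rw [two_mul]
  exact add_le_add (leak _) (leak _)

theorem RoughPotential.exists_mollify_zeta_le (hW : RoughPotential ν ε₁ ε₂ V W₁ W₂)
    (hV : RegularPotential N ν ε₁ V) (hN : 1 ≤ N) (hν : ∀ s, ν s < 0) (hε₂ : ∀ s, 0 < ε₂ s)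
    (hw : IsMollifier w) (hα : ∀ s, 0 < α s) (hα₀ : 0 < α₀ ∧ α₀ < 1) (n : ℕ) :
    ∃ C : ℝ≥0, ∀ᶠ lam in atTop,
      (∀ s : Side, pieceError n (s.halfLine.indicator W₁)
          (mollify w (lam ^ (-α s)) (s.halfLine.indicator W₁)) (cutUnion ν ε₁ ε₂ V lam) lam ≤
        C * zetaTwo n (lam ^ (-α s)) (s.halfLine.indicator W₁) (cutInterval ν ε₁ ε₂ V s lam) lam) ∧
      (∀ s, pieceError n W₁ (mollify w (lam ^ (-α s)) W₁) (cutUnion ν ε₁ ε₂ V lam) lam ≤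
        C * (zetaTwo n (lam ^ (-α s)) W₁ (cutInterval ν ε₁ ε₂ V .minus lam) lam +
          zetaTwo n (lam ^ (-α s)) W₁ (cutInterval ν ε₁ ε₂ V .plus lam) lam)) ∧
      pieceError n W₂ (mollify w (lam ^ (-α₀)) W₂) (cutUnion ν ε₁ ε₂ V lam) lam ≤
        C * zetaTwo n (lam ^ (-α₀)) W₂ univ lam := by
  obtain ⟨M, hM, hmol⟩ := hW.exists_deriv_mollify_le hV hN hν hε₂ hw hα hα₀
  obtain ⟨C, hC⟩ := exists_pieceError_mollify_le hw n (zero_le_one.trans hM)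
  refine ⟨2 * C, ?_⟩
  have hδ : ∀ᶠ lam in atTop, ∀ s, 0 ≤ cutRadius ν ε₁ ε₂ V s lam :=
    Side.eventually_forall fun s => (hV.tendsto_cutRadius hε₂ s).eventually_ge_atTop 0
  filter_upwards [hmol, Side.eventually_forall fun s =>
    eventually_modulus_indicator_le (W₁ := W₁) hV hε₂ hα s, hδ, eventually_gt_atTop 0]
    with lam hmo hleak hδ hl
  have hε : ∀ s, 0 < lam ^ (-α s) := fun s => Real.rpow_pos_of_pos hl _
  have hsub := cutUnion_subset_carrier hδ
  have hm := measurableSet_cutUnion (ν := ν) (ε₁ := ε₁) (ε₂ := ε₂) (V := V) lam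
  have hC2 : ((2 * C : ℝ≥0) : ℝ≥0∞) = C * 2 := by push_cast; ring
  have hle : (C : ℝ≥0∞) ≤ C * 2 := le_mul_of_one_le_right zero_le (by norm_num)
  rw [hC2]
  refine ⟨fun s => ?_, fun s => ?_, ?_⟩
  · refine (hC _ _ _ _ (hε s) hl (hW.locallyIntegrable_indicator hV.continuous s) hm
      fun x hx => (hmo x (hsub hx)).1 s).trans ?_
    rw [mul_assoc]
    exact mul_le_mul_right (zetaTwo_le_of_modulus_le (hleak s)) _
  · refine (hC _ _ _ _ (hε s) hl (hW.locallyIntegrable₁ hV.continuous) hm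
      fun x hx => (hmo x (hsub hx)).2.1 s).trans ?_
    exact mul_le_mul' hle (zetaTwo_union_le _ _ _ _ _ _)
  · refine (hC _ _ _ _ (Real.rpow_pos_of_pos hl _) hl
      (hW.memLp₂.locallyIntegrable (by norm_num)) hm
      fun x hx => (hmo x (hsub hx)).2.2).trans ?_
    refine mul_le_mul' hle ?_
    have := zetaTwo_le_of_modulus_le (n := n) (lam := lam) (c := 1) (φ' := W₂) (J' := univ)
      (φ := W₂) (ε := lam ^ (-α₀)) (J := cutUnion ν ε₁ ε₂ V lam)
      (by rw [one_mul]; exact modulus_mono_set _ (subset_univ _))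
    rwa [one_mul] at this

/-- The mollification error is controlled by the moduli of continuity of the two halves
of `W₁`. -/
theorem RoughPotential.exists_pieceError_le (hW : RoughPotential ν ε₁ ε₂ V W₁ W₂)
    (hV : RegularPotential N ν ε₁ V) (hN : 1 ≤ N) (hν : ∀ s, ν s < 0) (hε₂ : ∀ s, 0 < ε₂ s)
    (hw : IsMollifier w) (hα : ∀ s, 0 < α s) (hα₀ : 0 < α₀ ∧ α₀ < 1) (n : ℕ) :
    ∃ C : ℝ≥0, ∀ᶠ lam in atTop,
      pieceError n (fun x => W₁ x + W₂ x) (mollifiedW w α α₀ W₁ W₂ lam)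
          (cutUnion ν ε₁ ε₂ V lam) lam ≤
        C * ((zetaTwo n (lam ^ (-α .minus)) (Side.minus.halfLine.indicator W₁)
            (cutInterval ν ε₁ ε₂ V .minus lam) lam +
          zetaTwo n (lam ^ (-α .plus)) (Side.plus.halfLine.indicator W₁)
            (cutInterval ν ε₁ ε₂ V .plus lam) lam) +
          zetaTwo n (lam ^ (-α₀)) W₂ univ lam) := by
  obtain ⟨C, hC⟩ := hW.exists_mollify_zeta_le hV hN hν hε₂ hw hα hα₀ n
  refine ⟨4 * C, ?_⟩
  filter_upwards [hC, eventually_gt_atTop 0] with lam h hl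
  obtain ⟨h1, -, h2⟩ := h
  have hlis := fun s => hW.locallyIntegrable_indicator hV.continuous s
  have hcd : ∀ s : Side, ContDiff ℝ ∞
      (mollify w (lam ^ (-α s)) (s.halfLine.indicator W₁)) := fun s =>
    contDiff_mollify hw (Real.rpow_pos_of_pos hl _) (hlis s)
  have hcd2 : ContDiff ℝ ∞ (mollify w (lam ^ (-α₀)) W₂) :=
    contDiff_mollify hw (Real.rpow_pos_of_pos hl _) (hW.memLp₂.locallyIntegrable (by norm_num))
  have e : pieceError n (fun x => W₁ x + W₂ x) (mollifiedW w α α₀ W₁ W₂ lam)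
      (cutUnion ν ε₁ ε₂ V lam) lam = pieceError n (fun x =>
        (Side.minus.halfLine.indicator W₁ x + Side.plus.halfLine.indicator W₁ x) + W₂ x)
        (mollifiedW w α α₀ W₁ W₂ lam) (cutUnion ν ε₁ ε₂ V lam) lam := by
    refine pieceError_congr n ?_ rfl
    have hy0 : ∀ᵐ y ∂(volume : Measure ℝ), y ≠ 0 := by simp [ae_iff, measure_singleton]
    filter_upwards [hy0] with x hx
    rw [indicator_add_indicator W₁ hx]
  rw [e]
  have s1 := pieceError_add_le n
    (φ₁ := fun x => Side.minus.halfLine.indicator W₁ x + Side.plus.halfLine.indicator W₁ x)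
    (φ₂ := W₂) (ψ₁ := fun x =>
      mollify w (lam ^ (-α .minus)) (Side.minus.halfLine.indicator W₁) x +
      mollify w (lam ^ (-α .plus)) (Side.plus.halfLine.indicator W₁) x)
    (ψ₂ := mollify w (lam ^ (-α₀)) W₂)
    ((hlis .minus).aestronglyMeasurable.add (hlis .plus).aestronglyMeasurable) hW.memLp₂.1
    ((hcd .minus).add (hcd .plus)) hcd2 (J := cutUnion ν ε₁ ε₂ V lam) lam
  have s2 := pieceError_add_le n (hlis .minus).aestronglyMeasurable
    (hlis .plus).aestronglyMeasurable (hcd .minus) (hcd .plus) (J := cutUnion ν ε₁ ε₂ V lam) lam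
  refine s1.trans ?_
  refine (mul_le_mul_right (add_le_add (s2.trans (mul_le_mul_right
    (add_le_add (h1 .minus) (h1 .plus)) 2)) h2) 2).trans ?_
  -- Three pieces are added in two steps, each of which costs a factor 2.
  have key : ∀ a b d : ℝ≥0∞, 2 * (2 * (C * a + C * b) + C * d) ≤
      ((4 * C : ℝ≥0) : ℝ≥0∞) * ((a + b) + d) := by
    intro a b d
    rw [show 2 * (2 * (C * a + C * b) + C * d) = 4 * (C * (a + b)) + 2 * (C * d) by ring,
      ENNReal.coe_mul, ENNReal.coe_ofNat, mul_assoc, mul_add (C : ℝ≥0∞) (a + b),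
      mul_add (4 : ℝ≥0∞)]
    gcongr
    norm_num
  exact key _ _ _

/-- With equal scales the two mollified halves add up to the mollification of W₁ itself, so the
artificial jump at the origin never appears. -/
theorem RoughPotential.exists_pieceError_le_of_eq (hW : RoughPotential ν ε₁ ε₂ V W₁ W₂)
    (hV : RegularPotential N ν ε₁ V) (hN : 1 ≤ N) (hν : ∀ s, ν s < 0) (hε₂ : ∀ s, 0 < ε₂ s)
    (hw : IsMollifier w) (hα : ∀ s, 0 < α s) (hα₀ : 0 < α₀ ∧ α₀ < 1) (n : ℕ)
    (heq : α .minus = α .plus) :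
    ∃ C : ℝ≥0, ∀ᶠ lam in atTop,
      pieceError n (fun x => W₁ x + W₂ x) (mollifiedW w α α₀ W₁ W₂ lam)
          (cutUnion ν ε₁ ε₂ V lam) lam ≤
        C * ((zetaTwo n (lam ^ (-α .minus)) W₁ (cutInterval ν ε₁ ε₂ V .minus lam) lam +
          zetaTwo n (lam ^ (-α .plus)) W₁ (cutInterval ν ε₁ ε₂ V .plus lam) lam) +
          zetaTwo n (lam ^ (-α₀)) W₂ univ lam) := by
  obtain ⟨C, hC⟩ := hW.exists_mollify_zeta_le hV hN hν hε₂ hw hα hα₀ n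
  refine ⟨2 * C, ?_⟩
  filter_upwards [hC, eventually_gt_atTop 0] with lam h hl
  obtain ⟨-, h1, h2⟩ := h
  have hli := hW.locallyIntegrable₁ hV.continuous
  have hε : 0 < lam ^ (-α .plus) := Real.rpow_pos_of_pos hl _
  have hlis := fun s => hW.locallyIntegrable_indicator hV.continuous s
  have e : mollifiedW w α α₀ W₁ W₂ lam = fun x =>
      mollify w (lam ^ (-α .plus)) W₁ x + mollify w (lam ^ (-α₀)) W₂ x := by
    funext x
    simp only [mollifiedW, heq]
    rw [mollify_indicator_add hw hε hli]
  rw [e]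
  refine (pieceError_add_le n hli.aestronglyMeasurable hW.memLp₂.1 (contDiff_mollify hw hε hli)
    (contDiff_mollify hw (Real.rpow_pos_of_pos hl _)
      (hW.memLp₂.locallyIntegrable (by norm_num))) lam).trans ?_
  rw [heq]
  refine (mul_le_mul_right (add_le_add (h1 .plus) h2) 2).trans (le_of_eq ?_)
  push_cast
  ring

/-- Once the scales are below r, cutting W₁ at the origin does not increase the modulus, and the
general bound can be reused. -/
theorem RoughPotential.exists_pieceError_le_of_eq_zero (hW : RoughPotential ν ε₁ ε₂ V W₁ W₂)
    (hV : RegularPotential N ν ε₁ V) (hN : 1 ≤ N) (hν : ∀ s, ν s < 0) (hε₂ : ∀ s, 0 < ε₂ s)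
    (hw : IsMollifier w) (hα : ∀ s, 0 < α s) (hα₀ : 0 < α₀ ∧ α₀ < 1) (n : ℕ) {r : ℝ}
    (hr : 0 < r) (hzero : ∀ᵐ x ∂volume, |x| < r → W₁ x = 0) :
    ∃ C : ℝ≥0, ∀ᶠ lam in atTop,
      pieceError n (fun x => W₁ x + W₂ x) (mollifiedW w α α₀ W₁ W₂ lam)
          (cutUnion ν ε₁ ε₂ V lam) lam ≤
        C * ((zetaTwo n (lam ^ (-α .minus)) W₁ (cutInterval ν ε₁ ε₂ V .minus lam) lam +
          zetaTwo n (lam ^ (-α .plus)) W₁ (cutInterval ν ε₁ ε₂ V .plus lam) lam) +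
          zetaTwo n (lam ^ (-α₀)) W₂ univ lam) := by
  obtain ⟨C, hC⟩ := hW.exists_pieceError_le hV hN hν hε₂ hw hα hα₀ n
  refine ⟨C, ?_⟩
  filter_upwards [hC, Side.eventually_forall fun s => eventually_rpow_neg_le (hα s) hr]
    with lam h hle
  have key : ∀ s : Side, zetaTwo n (lam ^ (-α s)) (s.halfLine.indicator W₁)
      (cutInterval ν ε₁ ε₂ V s lam) lam ≤
        zetaTwo n (lam ^ (-α s)) W₁ (cutInterval ν ε₁ ε₂ V s lam) lam := by
    intro s
    have h1 := modulus_indicator_le (φ := W₁) s.sgn s.sgn_eq (fun x => s.mem_halfLine) (hle s) hzero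
      (fun x hx => (mem_cutInterval.1 hx).1)
      (measurableSet_cutInterval (ν := ν) (ε₁ := ε₁) (ε₂ := ε₂) (V := V) s lam)
    rw [← one_mul (modulus 2 _ W₁ _)] at h1
    have h2 := zetaTwo_le_of_modulus_le (n := n) (lam := lam) h1
    rwa [one_mul] at h2
  exact h.trans (mul_le_mul_right (add_le_add (add_le_add (key _) (key _)) le_rfl) _)

/-- A bound for the mollification error yields the decomposition of the quotient. -/
theorem RoughPotential.decomposition (hW : RoughPotential ν ε₁ ε₂ V W₁ W₂)
    (hV : RegularPotential N ν ε₁ V) (hn : n ≤ 1) (hN : n + 1 ≤ N) (hν : ∀ s, ν s < 0)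
    (hε₂ : ∀ s, 0 < ε₂ s) (hw : IsMollifier w) (hα : ∀ s, 0 < α s ∧ α s < 1)
    (hα₀ : 0 < α₀ ∧ α₀ < 1) {ξ : ℝ → ℝ → ℝ}
    (hξ : ∃ C : ℝ, ∀ᶠ lam in atTop, IsCutoff (fun s => cutRadius ν ε₁ ε₂ V s lam)
      (fun s => cutWidth ν ε₁ ε₂ V s lam) C (ξ lam)) {Φ : Side → ℝ → ℂ}
    (hΦ : ∃ C : ℝ≥0, ∀ᶠ lam in atTop,
      pieceError n (fun x => W₁ x + W₂ x) (mollifiedW w α α₀ W₁ W₂ lam)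
          (cutUnion ν ε₁ ε₂ V lam) lam ≤
        C * ((zetaTwo n (lam ^ (-α .minus)) (Φ .minus) (cutInterval ν ε₁ ε₂ V .minus lam) lam +
          zetaTwo n (lam ^ (-α .plus)) (Φ .plus) (cutInterval ν ε₁ ε₂ V .plus lam) lam) +
          zetaTwo n (lam ^ (-α₀)) W₂ univ lam)) :
    Decomposition ν ε₁ ε₂ V α α₀ n Φ W₂ (pseudomode w α α₀ V W₁ W₂ ξ n) fun lam =>
      norm2 (fun x => schrodinger (fun y => V y + (W₁ y + W₂ y))
        (pseudomode w α α₀ V W₁ W₂ ξ n lam) x -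
        (lam : ℂ) * pseudomode w α α₀ V W₁ W₂ ξ n lam x) /
      norm2 (pseudomode w α α₀ V W₁ W₂ ξ n lam) := by
  obtain ⟨C, c, hC, hc, hres⟩ := hW.exists_residual_bound hV hn hN hν hε₂ hw hα hα₀ hξ
  obtain ⟨D, hD⟩ := hΦ
  refine decomposition_of_le (D := C.toNNReal * D) hC hc (fun lam => ENNReal.toReal_nonneg) ?_
  filter_upwards [hres, hD] with lam h1 h2
  obtain ⟨-, h3, h4, h5⟩ := h1
  have h6 : ENNReal.ofReal (norm2 (pseudomode w α α₀ V W₁ W₂ ξ n lam)) =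
      eLpNorm (pseudomode w α α₀ V W₁ W₂ ξ n lam) 2 volume := ENNReal.ofReal_toReal h3.2.ne
  refine ⟨(ENNReal.ofReal_le_iff_le_toReal h3.2.ne).1 h4, ENNReal.ofReal_toReal_le.trans ?_⟩
  rw [h6]
  refine h5.trans (add_le_add le_rfl ?_)
  rw [ENNReal.coe_mul, ENNReal.ofNNReal_toNNReal, mul_assoc]
  refine mul_le_mul_right (h2.trans (mul_le_mul_right ?_ _)) _
  exact add_le_add (add_le_add (zetaTwo_le_zetaRate _ _ _ _ _) (zetaTwo_le_zetaRate _ _ _ _ _))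
    (zetaTwo_le_zetaRate _ _ _ _ _)

end Decomposition

end Pseudomode
end

/-! ### The theorem. -/

theorem mainTheorem2
    (N n : ℕ) (hN : N ≤ 2) (hn : n + 1 ≤ N)
    (ν : Pseudomode.Side → ℝ) (hν : ∀ s, ν s < 0)
    (ε₁ : ℝ) (ε₂ : Pseudomode.Side → ℝ) (hε₂ : ∀ s, 0 < ε₂ s ∧ ε₂ s < 1 - ν s)
    (V W₁ W₂ : ℝ → ℂ)
    (hV : Pseudomode.RegularPotential N ν ε₁ V)
    (hW : Pseudomode.RoughPotential ν ε₁ ε₂ V W₁ W₂)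
    (w : ℝ → ℝ) (hw : Pseudomode.IsMollifier w)
    (α : Pseudomode.Side → ℝ) (hα : ∀ s, 0 < α s ∧ α s < 1)
    (α₀ : ℝ) (hα₀ : 0 < α₀ ∧ α₀ < 1)
    (ξ : ℝ → ℝ → ℝ)
    (hξ : ∃ C : ℝ, ∀ᶠ lam in atTop,
      Pseudomode.IsCutoff (fun s => Pseudomode.cutRadius ν ε₁ ε₂ V s lam)
        (fun s => Pseudomode.cutWidth ν ε₁ ε₂ V s lam) C (ξ lam))
    (f : ℝ → ℝ → ℂ) (hf : f = Pseudomode.pseudomode w α α₀ V W₁ W₂ ξ n)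
    (q : ℝ → ℝ)
    (hq : q = fun lam =>
      Pseudomode.norm2 (fun x =>
        Pseudomode.schrodinger (fun y => V y + (W₁ y + W₂ y)) (f lam) x - (lam : ℂ) * f lam x) /
      Pseudomode.norm2 (f lam)) :
    (∀ᶠ lam in atTop,
      f lam ∈ Pseudomode.schrodingerDomain (fun y => V y + (W₁ y + W₂ y)) ∧
        0 < Pseudomode.norm2 (f lam)) ∧
    Pseudomode.Decomposition ν ε₁ ε₂ V α α₀ n (fun s => s.halfLine.indicator W₁) W₂ f q ∧
    ((α .minus = α .plus ∨ ∃ r : ℝ, 0 < r ∧ ∀ᵐ x ∂volume, |x| < r → W₁ x = 0) →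
      Pseudomode.Decomposition ν ε₁ ε₂ V α α₀ n (fun _ => W₁) W₂ f q) := by
  have hε₂' : ∀ s, 0 < ε₂ s := fun s => (hε₂ s).1
  have hα' : ∀ s, 0 < α s := fun s => (hα s).1
  have hn1 : n ≤ 1 := by omega
  have hN1 : 1 ≤ N := by omega
  subst hf hq
  refine ⟨?_, ?_, fun h => ?_⟩
  · obtain ⟨C, c, hC, -, hres⟩ :=
      hW.exists_residual_bound hV hn1 hn hν hε₂' hw hα hα₀ hξ
    filter_upwards [hres] with lam hlam
    obtain ⟨h1, h2, h3, -⟩ := hlam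
    -- The pseudomode is nonzero because its norm is at least C⁻¹ > 0.
    refine ⟨h1, ENNReal.toReal_pos (fun h0 => ?_) h2.2.ne⟩
    rw [h0, nonpos_iff_eq_zero, ENNReal.ofReal_eq_zero, inv_nonpos] at h3
    linarith
  · exact hW.decomposition hV hn1 hn hν hε₂' hw hα hα₀ hξ
      (hW.exists_pieceError_le hV hN1 hν hε₂' hw hα' hα₀ n)
  · refine hW.decomposition hV hn1 hn hν hε₂' hw hα hα₀ hξ ?_
    rcases h with h | ⟨r, hr, h⟩
    · exact hW.exists_pieceError_le_of_eq hV hN1 hν hε₂' hw hα' hα₀ n h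
    · exact hW.exists_pieceError_le_of_eq_zero hV hN1 hν hε₂' hw hα' hα₀ n hr h
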